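/- Let $M$ be a compact complex manifold of dimension $n$ and let $\omega$ be a real-analytic Kähler form on $M$ (a closed, strictly positive, real-analytic real $(1,1)$-form). If $u$ is a real-analytic potential of $\omega$ (that is, $\omega=i\partial\bar\partial u$) on a connected open set $U\subset M$, and $u_{\mathbb C}$ is a function on $U\times U$, holomorphic in the first and antiholomorphic in the second variable, with $u_{\mathbb C}(z,z)=u(z)$, put $D_\omega(z,w)=u(z)+u(w)-2\,\mathrm{Re}\,u_{\mathbb C}(z,w)$ on $U\times U$ (Calabi's diastasis function). Call an open neighbourhood $V_\omega$ of the diagonal in $M\times M$ admissible if it is a union of such squares $U\times U$ on which these local expressions define one function $D_\omega$ on $V_\omega$, and if on $V_\omega$ the function $D_\omega$ is bounded below by a positive constant outside each neighbourhood of the diagonal (equivalently, $D_\omega\ge C d^2$ on $V_\omega$ for some $C>0$, where $d$ is a Riemannian distance). Admissible neighbourhoods exist. Fix one, $V_\omega$, and for $\psi:M\to\mathbb R\cup\{\infty\}$ let $$L_\omega(\psi)(q)=\mathrm{usc}\sup_{p\in M,\ (p,q)\in V_\omega}\bigl[-D_\omega(p,q)-\psi(p)\bigr],$$ where $\mathrm{usc}$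 denotes the upper semicontinuous regularization. **Theorem 6.1.** Fix a $C^2$ norm on $M$. There is $\varepsilon>0$ such that the following holds for every smooth $\psi:M\to\mathbb R$ with $\|\psi\|_{C^2(M)}<\varepsilon$ and $\omega_\psi:=\omega+i\partial\bar\partial\psi>0$. For each $q\in M$ the supremum above is attained at exactly one point, denoted $G(\psi)(q)$; the map $G(\psi):M\to M$ is a smooth diffeomorphism; $L_\omega\psi$ is a smooth real-valued function; and $$G(\psi)^*\omega_\psi=\omega_{L_\omega\psi}:=\omega+i\partial\bar\partial L_\omega\psi .$$ Consequently $G(\psi)^*(\omega_\psi^n)=\omega_{L_\omega\psi}^n$: the complex Monge–Ampère measure $\omega_\psi^n$ of $\psi$ is pulled back under $G(\psi)$ to the complex Monge–Ampère measure of $L_\omega\psi$. -/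

import Mathlib

open Set Filter Topology MeasureTheory
open scoped Manifold ContDiff ENNReal

noncomputable section

namespace CxLegendre

/-! ### Differential forms on the model space

Throughout, `E` is a finite-dimensional complex vector space, the model of an `n`-dimensional complex
manifold with `n = finrank ℂ E`. -/

section Flat

variable {E : Type*} [NormedAddCommGroup E] [NormedSpace ℂ E]

/-- The complex structure `v ↦ i v`, as a real-linear map. -/
def J : E →L[ℝ] E := Complex.I • ContinuousLinearMap.id ℝ E

/-- The operator `dᶜ = i(∂̄ - ∂)` on real functions, that is `dᶜu (v) = - du (i v)`. -/
def dcFlat (u : E → ℝ) (y : E) : E [⋀^Fin 1]→L[ℝ] ℝ :=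
  ContinuousAlternatingMap.ofSubsingleton ℝ E ℝ (0 : Fin 1) (-((fderiv ℝ u y).comp J))

/-- The real `(1,1)`-form `i∂∂̄u = (1/2) d dᶜ u`, in coordinates
`i ∑ ∂²u / ∂z_j ∂z̄_k dz_j ∧ dz̄_k`. -/
def ddbarFlat (u : E → ℝ) (y : E) : E [⋀^Fin 2]→L[ℝ] ℝ :=
  (1 / 2 : ℝ) • extDeriv (dcFlat u) y

/-- The `k`-th exterior power `α ∧ ⋯ ∧ α` of an alternating 2-form, evaluated on the `2k` vectors
`v (0,0), v (0,1), v (1,0), v (1,1), …` :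
`α^k (v₁, …, v₂ₖ) = 2⁻ᵏ ∑_σ sgn σ ∏ᵢ α (v_σ(2i-1), v_σ(2i))`. -/
def wedgePow (α : E [⋀^Fin 2]→L[ℝ] ℝ) (k : ℕ) (v : Fin k × Fin 2 → E) : ℝ :=
  (2 ^ k : ℝ)⁻¹ * ∑ σ : Equiv.Perm (Fin k × Fin 2),
    ((Equiv.Perm.sign σ : ℤ) : ℝ) * ∏ i : Fin k, α ![v (σ (i, 0)), v (σ (i, 1))]

/-- A real basis `e₁, i e₁, …, eₙ, i eₙ` of `E`, coming from a complex basis `e₁, …, eₙ`. -/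
def realBasis (E : Type*) [NormedAddCommGroup E] [NormedSpace ℂ E] [FiniteDimensional ℂ E] :
    Module.Basis (Fin (Module.finrank ℂ E) × Fin 2) ℝ E :=
  Complex.basisOneI.smulTower' (Module.finBasis ℂ E)

end Flat

/-! ### Real differential 2-forms on a complex manifold

`M` is a complex manifold modelled on `E`. Its real tangent space at `x` is
`TangentSpace 𝓘(ℝ, E) x`, which is `E` through the preferred (holomorphic) chart at `x`. -/

section Manifold

variable {E : Type*} [NormedAddCommGroup E] [NormedSpace ℂ E]
  {M : Type*} [TopologicalSpace M] [ChartedSpace E M]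

/-- Real 2-forms on `M` (no regularity imposed). -/
abbrev TwoForm (E : Type*) [NormedAddCommGroup E] [NormedSpace ℂ E]
    (M : Type*) [TopologicalSpace M] [ChartedSpace E M] : Type _ :=
  ∀ x : M, TangentSpace 𝓘(ℝ, E) x [⋀^Fin 2]→L[ℝ] ℝ

/-- The complex structure on the tangent spaces of `M`; since coordinate changes are holomorphic it
does not depend on the chart. -/
def tangentJ (x : M) : TangentSpace 𝓘(ℝ, E) x →L[ℝ] TangentSpace 𝓘(ℝ, E) x :=
  (J : E →L[ℝ] E)

/-- The pullback `G^*α` of a 2-form under a map `G : M → M`. -/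
def pullback (G : M → M) (α : TwoForm E M) : TwoForm E M := fun x =>
  (α (G x)).compContinuousLinearMap (mfderiv 𝓘(ℝ, E) 𝓘(ℝ, E) G x)

/-- The expression of a 2-form in a chart `e`, i.e. its pullback under `e⁻¹` (used on `e.target`). -/
def inChart (e : OpenPartialHomeomorph M E) (α : TwoForm E M) (y : E) : E [⋀^Fin 2]→L[ℝ] ℝ :=
  (α (e.symm y)).compContinuousLinearMap (mfderiv 𝓘(ℝ, E) 𝓘(ℝ, E) e.symm y)

/-- The 2-form `i∂∂̄u` of a real function `u` on `M`, computed at `x` in the preferred chart. -/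
def ddbar (u : M → ℝ) : TwoForm E M := fun x =>
  (ddbarFlat (u ∘ (chartAt E x).symm) (chartAt E x x) : E [⋀^Fin 2]→L[ℝ] ℝ)

/-- Strict positivity of a 2-form: `α (v, J v) > 0` for every tangent vector `v ≠ 0`. -/
def IsPositive (α : TwoForm E M) : Prop :=
  ∀ (x : M) (v : TangentSpace 𝓘(ℝ, E) x), v ≠ 0 → 0 < α x ![v, tangentJ x v]

/-- A real-analytic Kähler form: a closed, strictly positive, real-analytic real `(1,1)`-form. -/
structure IsAnalyticKahlerForm (κ : TwoForm E M) : Prop where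
  /-- `κ` has type `(1,1)`. -/
  type_one_one : ∀ (x : M) (v w : TangentSpace 𝓘(ℝ, E) x),
    κ x ![tangentJ x v, tangentJ x w] = κ x ![v, w]
  pos : IsPositive κ
  analytic : ∀ e ∈ atlas E M, AnalyticOnNhd ℝ (inChart e κ) e.target
  closed : ∀ e ∈ atlas E M, ∀ y ∈ e.target, extDeriv (inChart e κ) y = 0

/-- The form `κ_ψ = κ + i∂∂̄ψ`. -/
def perturb (κ : TwoForm E M) (ψ : M → ℝ) : TwoForm E M := fun x => κ x + ddbar ψ x

/-! ### Monge–Ampère measures -/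

/-- The measure on `M` defined by the top-degree form `αⁿ`, `n = dim_ℂ M`. In a chart `e` it is the
measure with density `|αⁿ (b₁, …, b₂ₙ)|` with respect to the Lebesgue measure normalized by the real
basis `b = (e₁, i e₁, …, eₙ, i eₙ)`; for a positive `α` the value of `αⁿ` on `b` is positive. These
local measures agree on overlaps, and their supremum is the measure that restricts to each of them. -/
def topMeasure [FiniteDimensional ℂ E] [MeasurableSpace E] [BorelSpace E] [MeasurableSpace M]
    (α : TwoForm E M) : Measure M :=
  ⨆ e ∈ atlas E M,
    (((realBasis E).addHaar.withDensity
      (fun y => ‖wedgePow (inChart e α y) (Module.finrank ℂ E) (realBasis E)‖ₑ)).restrict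
        e.target).map e.symm

/-! ### The `C²` norm -/

/-- A finite family of charts of `M` with compact subsets of their domains that cover `M`. -/
structure FiniteAtlas (E : Type*) [NormedAddCommGroup E] [NormedSpace ℂ E]
    (M : Type*) [TopologicalSpace M] [ChartedSpace E M] where
  size : ℕ
  chart : Fin size → OpenPartialHomeomorph M E
  chart_mem : ∀ i, chart i ∈ atlas E M
  piece : Fin size → Set M
  piece_compact : ∀ i, IsCompact (piece i)
  piece_subset : ∀ i, piece i ⊆ (chart i).source
  cover : ⋃ i, piece i = univ

/-- The `C²` norm of a function on `M` given by a finite atlas: the supremum of the norms of the real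
derivatives of order `0, 1, 2` in the charts, over the compact pieces. -/
def c2Norm (𝒜 : FiniteAtlas E M) (ψ : M → ℝ) : ℝ≥0∞ :=
  ⨆ (i : Fin 𝒜.size), ⨆ x ∈ 𝒜.piece i, ⨆ j : Fin 3,
    ‖iteratedFDeriv ℝ (j : ℕ) (ψ ∘ (𝒜.chart i).symm) (𝒜.chart i x)‖ₑ

/-! ### Calabi's diastasis function -/

/-- `u` is a real-analytic potential of `κ` on the open set `U`, and `uC` is its polarization on
`U × U`: it is holomorphic in the first variable, antiholomorphic in the second one (and jointly
smooth), and `uC (z, z) = u z`. -/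
structure IsPolarizedPotential (κ : TwoForm E M) (U : Set M) (u : M → ℝ) (uC : M → M → ℂ) :
    Prop where
  analytic : ContMDiffOn 𝓘(ℝ, E) 𝓘(ℝ, ℝ) ω u U
  potential : ∀ x ∈ U, ddbar u x = κ x
  smooth : ContMDiffOn (𝓘(ℝ, E).prod 𝓘(ℝ, E)) 𝓘(ℝ, ℂ) ∞ (fun p : M × M => uC p.1 p.2) (U ×ˢ U)
  holo : ∀ w ∈ U, MDifferentiableOn 𝓘(ℂ, E) 𝓘(ℂ, ℂ) (fun z => uC z w) U
  antiholo : ∀ z ∈ U, MDifferentiableOn 𝓘(ℂ, E) 𝓘(ℂ, ℂ) (fun w => starRingEnd ℂ (uC z w)) U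
  diag : ∀ z ∈ U, uC z z = u z

/-- `V` is an open neighbourhood of the diagonal on which the diastasis `D` of `κ` is defined, and is
bounded below by a positive constant away from each neighbourhood of the diagonal.

The first part says that `V` is a union of squares `U × U` of connected open sets that carry a
polarized potential `(u, u_ℂ)` of `κ`, with `D (p, q) = u (p) + u (q) - 2 Re u_ℂ (p, q)` there. This
determines `D` on `V`: two such functions agree near the diagonal, and they are real-analytic on the
connected sets `U × U`. The last part is, on a compact `M`, the same as the existence of a `C > 0` with
`D (p, q) ≥ C d (p, q)²` on `V`, for a Riemannian distance `d`. -/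
structure IsCalabiDiastasis (κ : TwoForm E M) (V : Set (M × M)) (D : M → M → ℝ) : Prop where
  isOpen : IsOpen V
  diag_subset : ∀ p : M, (p, p) ∈ V
  local_form : ∀ p q : M, (p, q) ∈ V → ∃ U : Set M, IsOpen U ∧ IsConnected U ∧ p ∈ U ∧ q ∈ U ∧
    U ×ˢ U ⊆ V ∧ ∃ (u : M → ℝ) (uC : M → M → ℂ), IsPolarizedPotential κ U u uC ∧
      ∀ z ∈ U, ∀ w ∈ U, D z w = u z + u w - 2 * (uC z w).re
  bounded_below : ∀ N : Set (M × M), IsOpen N → (∀ p : M, (p, p) ∈ N) →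
    ∃ c : ℝ, 0 < c ∧ ∀ p q : M, (p, q) ∈ V → (p, q) ∉ N → c ≤ D p q

/-- The neighbourhoods `V_κ` of the diagonal that can be used to define the Legendre transform. -/
def IsCalabiNhd (κ : TwoForm E M) (V : Set (M × M)) : Prop :=
  ∃ D : M → M → ℝ, IsCalabiDiastasis κ V D

open Classical in
/-- Calabi's diastasis function `D_κ` on `V` (and an irrelevant value if there is none). -/
def diastasis (κ : TwoForm E M) (V : Set (M × M)) : M → M → ℝ :=
  if h : IsCalabiNhd κ V then h.choose else 0

/-! ### The Legendre transform and the generalized gradient map -/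

/-- The complex Legendre transform `L_κ ψ (q) = usc sup {- D_κ (p, q) - ψ (p) : (p, q) ∈ V}`, where
`usc` is the upper semicontinuous regularization. -/
def legendre (κ : TwoForm E M) (V : Set (M × M)) (ψ : M → EReal) (q : M) : EReal :=
  limsup (fun q' => ⨆ (p : M) (_ : (p, q') ∈ V), ((-diastasis κ V p q' : ℝ) : EReal) - ψ p) (𝓝 q)

/-- The supremum in the definition of `L_κ ψ` at `q` is attained at the point `z`. -/
def IsAttainedAt (κ : TwoForm E M) (V : Set (M × M)) (ψ : M → ℝ) (q z : M) : Prop :=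
  (z, q) ∈ V ∧ ∀ p : M, (p, q) ∈ V → -diastasis κ V p q - ψ p ≤ -diastasis κ V z q - ψ z

open Classical in
/-- The generalized gradient map `G (ψ)`, which sends `q` to the point at which the supremum in the
definition of `L_κ ψ (q)` is attained (and to `q` if there is no such point). -/
def gradientMap (κ : TwoForm E M) (V : Set (M × M)) (ψ : M → ℝ) (q : M) : M :=
  if h : ∃ z : M, IsAttainedAt κ V ψ q z then h.choose else q

end Manifold

end CxLegendre

end

set_option linter.unusedSectionVars false

noncomputable section

namespace CxLegendre

/-! ### Calculus of `ddbarFlat` -/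

section Flat

variable {E : Type*} [NormedAddCommGroup E] [NormedSpace ℂ E]

/-! On a square carrying a polarized potential, `-D (p, q) - ψ (p) = 2 Re u_ℂ (p, q) - (u + ψ) (p) -
u (q)`. So, with `φ = L ψ`, the function `u + φ` is locally the Legendre transform of `u + ψ` for
the pairing `2 Re u_ℂ`, which is holomorphic in `p` and antiholomorphic in `q`. The proof minimizes
`D (p, q) + ψ (p)` over `p`.

The transformation rule is a first-order computation (`ddbarFlat_comp_gradient`,
`pullback_perturb`). Along the graph `p = G q` of the minimizer, the differential of `u + ψ` is `2
Re ∂₁u_ℂ`, and by the envelope principle the differential of `u + φ` is `2 Re ∂₂u_ℂ`. Since `∂₁u_ℂ`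
is complex linear and `∂₂u_ℂ` is conjugate linear, `G^* dᶜ(u + ψ) - dᶜ(u + φ)` is the differential
of `2 Im u_ℂ (G q, q)`. Applying `d` removes this exact term. The statement on measures follows by
change of variables (`topMeasure_comap`).

Existence, uniqueness and smoothness of `G` come from convexity. On the diagonal, `D` and its
differential in `p` vanish, the second derivative in `p` along `v` is `κ (v, Jv)`, and the mixed one
is `-κ (v, Jv)`. By continuity both signs persist in a chart ball
(`IsPolarizedPotential.exists_isConvexBall`), and a `C²`-small `ψ` does not destroy them. The lower
bound on `D` away from the diagonal keeps all minimizers inside such balls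
(`IsCalabiDiastasis.exists_isAdmissible`). Convexity gives uniqueness, the implicit function theorem
gives smoothness, and the mixed derivative makes `G` an injective local diffeomorphism
(`IsAdapted.isChartDiffeoAt`, `IsAdmissible.injective`). Its image is open and closed and meets the
connected squares making up `V`, so `G` is onto. The supremum is then continuous in `q`, and the
regularization has no effect (`legendre_eq`).

Admissible neighbourhoods exist because a closed real-analytic `(1,1)`-form can be extended
holomorphically to doubled variables and integrated once in each variable (`exists_flat_potential`).
Two potentials of the same form differ by a pluriharmonic function, whose diastasis vanishes
(`IsSesqui.eventually_diastasis_eq_zero`), so the local diastasis functions glue near the diagonal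
(`exists_isCalabiNhd`). -/

@[simp] lemma J_apply (v : E) : J v = Complex.I • v := rfl

lemma J_J (v : E) : J (J v) = -v := by simp [smul_smul]

lemma dcFlat_apply (u : E → ℝ) (y : E) (v : Fin 1 → E) :
    dcFlat u y v = -fderiv ℝ u y (J (v 0)) := rfl

lemma two_le_smooth : (2 : WithTop ℕ∞) ≤ ((⊤ : ℕ∞) : WithTop ℕ∞) :=
  WithTop.coe_le_coe.2 (le_top : (2 : ℕ∞) ≤ ⊤)

lemma differentiableAt_ofSubsingleton {f : E → E →L[ℝ] ℝ} {y : E} (hf : DifferentiableAt ℝ f y) :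
    DifferentiableAt ℝ (fun z => ContinuousAlternatingMap.ofSubsingleton ℝ E ℝ (0 : Fin 1) (f z)) y :=
  ((ContinuousAlternatingMap.ofSubsingletonLIE (𝕜 := ℝ) (E := E) (F := ℝ)
    (0 : Fin 1)).differentiableAt).comp y hf

lemma extDeriv_ofSubsingleton_apply {f : E → E →L[ℝ] ℝ} {y : E} (hf : DifferentiableAt ℝ f y)
    (v : Fin 2 → E) :
    extDeriv (fun z => ContinuousAlternatingMap.ofSubsingleton ℝ E ℝ (0 : Fin 1) (f z)) y v =
      fderiv ℝ f y (v 0) (v 1) - fderiv ℝ f y (v 1) (v 0) := by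
  rw [extDeriv_apply (differentiableAt_ofSubsingleton hf)]
  have key (w : E) : fderiv ℝ (fun x => f x w) y = (fderiv ℝ f y).flip w := by
    rw [fderiv_clm_apply hf (by fun_prop)]; ext; simp
  rw [Fin.sum_univ_two]
  simp [ContinuousAlternatingMap.ofSubsingleton_apply_apply, key, Fin.removeNth, sub_eq_add_neg, Fin.tail]

lemma differentiableAt_fderiv_of_contDiffAt {F G : Type*} [NormedAddCommGroup F] [NormedSpace ℝ F]
    [NormedAddCommGroup G] [NormedSpace ℝ G] {u : F → G} {y : F}
    (hu : ContDiffAt ℝ 2 u y) : DifferentiableAt ℝ (fderiv ℝ u) y :=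
  (hu.fderiv_right (m := 1) (by norm_num)).differentiableAt (by norm_num)

lemma differentiableAt_dcFlat {u : E → ℝ} {y : E} (hu : ContDiffAt ℝ 2 u y) :
    DifferentiableAt ℝ (dcFlat u) y := by
  have h := differentiableAt_fderiv_of_contDiffAt hu
  exact differentiableAt_ofSubsingleton ((h.clm_comp (differentiableAt_const _)).neg)

lemma ddbarFlat_apply {u : E → ℝ} {y : E} (hu : ContDiffAt ℝ 2 u y) (v : Fin 2 → E) :
    ddbarFlat u y v = (1 / 2) * (fderiv ℝ (fderiv ℝ u) y (v 1) (J (v 0)) -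
      fderiv ℝ (fderiv ℝ u) y (v 0) (J (v 1))) := by
  have h := differentiableAt_fderiv_of_contDiffAt hu
  have h' : DifferentiableAt ℝ (fun z => -((fderiv ℝ u z).comp J)) y :=
    (h.clm_comp (differentiableAt_const _)).neg
  have h2 : fderiv ℝ (fun z => -((fderiv ℝ u z).comp (J : E →L[ℝ] E))) y =
      -(ContinuousLinearMap.compL ℝ E E ℝ).flip J ∘L fderiv ℝ (fderiv ℝ u) y :=
    ((((ContinuousLinearMap.compL ℝ E E ℝ).flip J).hasFDerivAt.comp y h.hasFDerivAt).neg).fderiv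
  have := extDeriv_ofSubsingleton_apply h' v
  rw [h2] at this
  simp only [ddbarFlat, ContinuousAlternatingMap.smul_apply, smul_eq_mul]
  erw [this]
  simp
  ring

lemma ddbarFlat_congr {u u' : E → ℝ} {y : E} (h : u =ᶠ[𝓝 y] u') : ddbarFlat u y = ddbarFlat u' y := by
  unfold ddbarFlat
  rw [Filter.EventuallyEq.extDeriv_eq]
  filter_upwards [h.fderiv (𝕜 := ℝ)] with z hz
  simp [dcFlat, hz]

lemma ddbarFlat_add {u u' : E → ℝ} {y : E} (hu : ContDiffAt ℝ 2 u y) (hu' : ContDiffAt ℝ 2 u' y) :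
    ddbarFlat (fun z => u z + u' z) y = ddbarFlat u y + ddbarFlat u' y := by
  have e : dcFlat (fun z => u z + u' z) =ᶠ[𝓝 y] fun z => dcFlat u z + dcFlat u' z := by
    filter_upwards [hu.eventually (by simp), hu'.eventually (by simp)] with z hz hz'
    ext v
    simp only [dcFlat_apply, ContinuousAlternatingMap.add_apply]
    rw [fderiv_fun_add (hz.differentiableAt (by simp)) (hz'.differentiableAt (by simp))]
    simp [add_comm]
  unfold ddbarFlat
  rw [Filter.EventuallyEq.extDeriv_eq e,
    extDeriv_fun_add (differentiableAt_dcFlat hu) (differentiableAt_dcFlat hu'), smul_add]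

lemma ddbarFlat_sub {u u' : E → ℝ} {y : E} (hu : ContDiffAt ℝ 2 u y) (hu' : ContDiffAt ℝ 2 u' y) :
    ddbarFlat (fun z => u z - u' z) y = ddbarFlat u y - ddbarFlat u' y := by
  have h := ddbarFlat_add (hu.sub hu') hu'
  simp only [sub_add_cancel] at h
  rw [h, add_sub_cancel_right]

lemma minSmoothness_real_two : minSmoothness ℝ 2 ≤ (2 : WithTop ℕ∞) := by
  simp

/-- `i∂∂̄` commutes with pullback under maps whose differential is complex linear. -/
lemma ddbarFlat_comp {f : E → ℝ} {τ : E → E} {y : E} (hf : ContDiffAt ℝ 2 f (τ y))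
    (hτ : ContDiffAt ℝ 2 τ y) (hJ : ∀ᶠ z in 𝓝 y, ∀ v, fderiv ℝ τ z (J v) = J (fderiv ℝ τ z v)) :
    ddbarFlat (f ∘ τ) y = (ddbarFlat f (τ y)).compContinuousLinearMap (fderiv ℝ τ y) := by
  have e : dcFlat (f ∘ τ) =ᶠ[𝓝 y]
      fun z => (dcFlat f (τ z)).compContinuousLinearMap (fderiv ℝ τ z) := by
    have h1 : ∀ᶠ z in 𝓝 y, ContDiffAt ℝ 2 f (τ z) :=
      hτ.continuousAt.eventually (hf.eventually (by simp))
    filter_upwards [h1, hτ.eventually (by simp), hJ] with z hz hz' hzJ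
    ext v
    rw [dcFlat_apply, fderiv_comp z (hz.differentiableAt (by simp)) (hz'.differentiableAt (by simp))]
    simp only [ContinuousAlternatingMap.compContinuousLinearMap_apply, dcFlat_apply,
      ContinuousLinearMap.comp_apply, hzJ, Function.comp]
  unfold ddbarFlat
  rw [Filter.EventuallyEq.extDeriv_eq e,
    extDeriv_pullback (differentiableAt_dcFlat hf) hτ minSmoothness_real_two]
  rfl

lemma fderiv_real_J {τ : E → E} {z : E} (h : DifferentiableAt ℂ τ z) (v : E) :
    fderiv ℝ τ z (J v) = J (fderiv ℝ τ z v) := by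
  rw [h.fderiv_restrictScalars ℝ]
  simp

/-! ### Functions holomorphic in the first and antiholomorphic in the second variable -/

/-- `g` is smooth on `S`, holomorphic in the first and antiholomorphic in the second variable. -/
structure IsSesqui (g : E × E → ℂ) (S : Set (E × E)) : Prop where
  contDiffOn : ContDiffOn ℝ ∞ g S
  left : ∀ p ∈ S, ∀ v : E, fderiv ℝ g p (J v, 0) = Complex.I * fderiv ℝ g p (v, 0)
  right : ∀ p ∈ S, ∀ v : E, fderiv ℝ g p (0, J v) = -Complex.I * fderiv ℝ g p (0, v)

namespace IsSesqui

variable {g g' : E × E → ℂ} {S S' : Set (E × E)}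

lemma contDiffAt (h : IsSesqui g S) (hS : IsOpen S) {p : E × E} (hp : p ∈ S) :
    ContDiffAt ℝ ∞ g p := h.contDiffOn.contDiffAt (hS.mem_nhds hp)

lemma differentiableAt (h : IsSesqui g S) (hS : IsOpen S) {p : E × E} (hp : p ∈ S) :
    DifferentiableAt ℝ g p := (h.contDiffAt hS hp).differentiableAt (by simp)

lemma differentiableAt_fderiv (h : IsSesqui g S) (hS : IsOpen S) {p : E × E} (hp : p ∈ S) :
    DifferentiableAt ℝ (fderiv ℝ g) p :=
  differentiableAt_fderiv_of_contDiffAt ((h.contDiffAt hS hp).of_le two_le_smooth)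

lemma mono (h : IsSesqui g S) (hs : S' ⊆ S) : IsSesqui g S' :=
  ⟨h.contDiffOn.mono hs, fun p hp => h.left p (hs hp), fun p hp => h.right p (hs hp)⟩

lemma sub (h : IsSesqui g S) (h' : IsSesqui g' S) (hS : IsOpen S) :
    IsSesqui (fun p => g p - g' p) S := by
  have e : ∀ p ∈ S, fderiv ℝ (fun p => g p - g' p) p = fderiv ℝ g p - fderiv ℝ g' p :=
    fun p hp => fderiv_fun_sub (h.differentiableAt hS hp) (h'.differentiableAt hS hp)
  refine ⟨h.contDiffOn.sub h'.contDiffOn, fun p hp v => ?_, fun p hp v => ?_⟩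
  · rw [e p hp]
    simp only [_root_.sub_apply, h.left p hp, h'.left p hp]; ring
  · rw [e p hp]
    simp only [_root_.sub_apply, h.right p hp, h'.right p hp]; ring

lemma symm_fderiv (h : IsSesqui g S) (hS : IsOpen S) {p : E × E} (hp : p ∈ S) (ξ η : E × E) :
    fderiv ℝ (fderiv ℝ g) p ξ η = fderiv ℝ (fderiv ℝ g) p η ξ :=
  (((h.contDiffAt hS hp).of_le (m := 2) two_le_smooth).isSymmSndFDerivAt
    minSmoothness_real_two) ξ η

lemma fderiv_fderiv_apply (h : IsSesqui g S) (hS : IsOpen S) {p : E × E} (hp : p ∈ S)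
    (ξ η : E × E) :
    fderiv ℝ (fun q => fderiv ℝ g q η) p ξ = fderiv ℝ (fderiv ℝ g) p ξ η := by
  rw [fderiv_clm_apply (h.differentiableAt_fderiv hS hp) (by fun_prop)]; simp

lemma fderiv_fderiv_left (h : IsSesqui g S) (hS : IsOpen S) {p : E × E} (hp : p ∈ S)
    (ξ : E × E) (v : E) : fderiv ℝ (fderiv ℝ g) p ξ (J v, 0) =
      Complex.I * fderiv ℝ (fderiv ℝ g) p ξ (v, 0) := by
  rw [← h.fderiv_fderiv_apply hS hp, ← h.fderiv_fderiv_apply hS hp]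
  have e : (fun q => fderiv ℝ g q (J v, 0)) =ᶠ[𝓝 p] fun q => Complex.I * fderiv ℝ g q (v, 0) := by
    filter_upwards [hS.mem_nhds hp] with q hq using h.left q hq v
  rw [e.fderiv_eq, fderiv_const_mul ((h.differentiableAt_fderiv hS hp).clm_apply (by fun_prop))]
  simp

lemma fderiv_fderiv_right (h : IsSesqui g S) (hS : IsOpen S) {p : E × E} (hp : p ∈ S)
    (ξ : E × E) (v : E) : fderiv ℝ (fderiv ℝ g) p ξ (0, J v) =
      -Complex.I * fderiv ℝ (fderiv ℝ g) p ξ (0, v) := by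
  rw [← h.fderiv_fderiv_apply hS hp, ← h.fderiv_fderiv_apply hS hp]
  have e : (fun q => fderiv ℝ g q (0, J v)) =ᶠ[𝓝 p]
      fun q => -Complex.I * fderiv ℝ g q (0, v) := by
    filter_upwards [hS.mem_nhds hp] with q hq using h.right q hq v
  rw [e.fderiv_eq, fderiv_const_mul ((h.differentiableAt_fderiv hS hp).clm_apply (by fun_prop))]
  simp

/-- Symmetry of the second derivative carries the Cauchy–Riemann relations over to a derivative in a
fixed direction. Hence vanishing and reality results for the class apply to derivatives of its
members as well. -/
lemma dir (h : IsSesqui g S) (hS : IsOpen S) (η : E × E) :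
    IsSesqui (fun p => fderiv ℝ g p η) S := by
  refine ⟨(h.contDiffOn.fderiv_of_isOpen hS (by simp)).clm_apply contDiffOn_const,
    fun p hp v => ?_, fun p hp v => ?_⟩
  · rw [h.fderiv_fderiv_apply hS hp, h.fderiv_fderiv_apply hS hp, h.symm_fderiv hS hp,
      h.fderiv_fderiv_left hS hp, h.symm_fderiv hS hp]
  · rw [h.fderiv_fderiv_apply hS hp, h.fderiv_fderiv_apply hS hp, h.symm_fderiv hS hp,
      h.fderiv_fderiv_right hS hp, h.symm_fderiv hS hp]

lemma fderiv_conj_swap (h : IsSesqui g S) (hS : IsOpen S) {p : E × E} (hp : p.swap ∈ S) (η : E × E) :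
    fderiv ℝ (fun p : E × E => starRingEnd ℂ (g p.swap)) p η =
      starRingEnd ℂ (fderiv ℝ g p.swap η.swap) := by
  have h1 : HasFDerivAt (fun p : E × E => g p.swap)
      ((fderiv ℝ g p.swap).comp (ContinuousLinearEquiv.prodComm ℝ E E : E × E →L[ℝ] E × E)) p :=
    (h.differentiableAt hS (p := p.swap) hp).hasFDerivAt.comp p
      (ContinuousLinearEquiv.prodComm ℝ E E).hasFDerivAt
  have h2 := (Complex.conjCLE.hasFDerivAt (x := g p.swap)).comp p h1
  have h3 : fderiv ℝ (fun p : E × E => starRingEnd ℂ (g p.swap)) p = _ := h2.fderiv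
  rw [h3]
  simp

/-- The function `(z, w) ↦ conj (g (w, z))`. -/
lemma conj_swap (h : IsSesqui g S) (hS : IsOpen S) :
    IsSesqui (fun p => starRingEnd ℂ (g p.swap)) (Prod.swap ⁻¹' S) := by
  have e : ∀ p ∈ Prod.swap ⁻¹' S, ∀ η : E × E,
      fderiv ℝ (fun p : E × E => starRingEnd ℂ (g p.swap)) p η =
        starRingEnd ℂ (fderiv ℝ g p.swap η.swap) := fun p hp => h.fderiv_conj_swap hS hp
  have hsw : ContDiff ℝ ∞ (Prod.swap : E × E → E × E) := contDiff_snd.prodMk contDiff_fst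
  refine ⟨?_, fun p hp v => ?_, fun p hp v => ?_⟩
  · exact Complex.conjCLE.contDiff.comp_contDiffOn
      (h.contDiffOn.comp hsw.contDiffOn (fun p hp => hp))
  · rw [e p hp, e p hp]
    simp only [Prod.swap_prod_mk]
    rw [h.right p.swap hp]; simp
  · rw [e p hp, e p hp]
    simp only [Prod.swap_prod_mk]
    rw [h.left p.swap hp]; simp

end IsSesqui

end Flat

/-! ### Sesquiholomorphic functions near the diagonal -/

section Sesqui

variable {E : Type*} [NormedAddCommGroup E] [NormedSpace ℂ E]

lemma smul_eq_re_im (c : ℂ) (v : E) : c • v = c.re • v + c.im • J v := by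
  conv_lhs => rw [← Complex.re_add_im c, add_smul, mul_smul]
  simp

namespace IsSesqui

variable {g g' : E × E → ℂ} {S S' : Set (E × E)}

lemma fderiv_smul_left (h : IsSesqui g S) {p : E × E} (hp : p ∈ S) (c : ℂ) (v : E) :
    fderiv ℝ g p (c • v, 0) = c * fderiv ℝ g p (v, 0) := by
  have e : ((c • v, 0) : E × E) = c.re • (v, 0) + c.im • (J v, 0) := by
    ext
    · simpa using smul_eq_re_im c v
    · simp
  rw [e, map_add, map_smul, map_smul, h.left p hp]
  apply Complex.ext <;> simp
  ring

lemma fderiv_smul_right (h : IsSesqui g S) {p : E × E} (hp : p ∈ S) (c : ℂ) (v : E) :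
    fderiv ℝ g p (0, c • v) = starRingEnd ℂ c * fderiv ℝ g p (0, v) := by
  have e : ((0, c • v) : E × E) = c.re • (0, v) + c.im • (0, J v) := by
    ext
    · simp
    · simpa using smul_eq_re_im c v
  rw [e, map_add, map_smul, map_smul, h.right p hp]
  apply Complex.ext <;> simp

/-- A sesquiholomorphic function that vanishes on the diagonal vanishes near the diagonal. -/
lemma eq_zero_of_ball (h : IsSesqui g S) (hS : IsOpen S) {x : E} {r : ℝ}
    (hb₁ : Metric.ball (x, x) r ⊆ S) (hb₂ : ∀ z ∈ Metric.ball x r, g (z, z) = 0) {p : E × E}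
    (hp : p ∈ Metric.ball (x, x) (r / 4)) : g p = 0 := by
  have hr : 0 < r := by linarith [Metric.pos_of_mem_ball hp]
  have hp' : ‖p.1 - x‖ < r / 4 ∧ ‖p.2 - x‖ < r / 4 := by
    have := mem_ball_iff_norm.1 hp
    rw [Prod.norm_def] at this
    exact max_lt_iff.1 this
  -- The points `a` and `b` are chosen so that `p = (a + i b, a - i b)`. The curve `γ t = (a + t b,
  -- a + t̄ b)` then passes through `p` at `t = i` and lies on the diagonal for real `t`. The radius
  -- `r / 4` keeps it in the ball for `‖t‖ < 2`.
  obtain ⟨a, ha⟩ : ∃ a : E, a = (1 / 2 : ℂ) • (p.1 + p.2) := ⟨_, rfl⟩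
  obtain ⟨b, hb⟩ : ∃ b : E, b = (-Complex.I / 2 : ℂ) • (p.1 - p.2) := ⟨_, rfl⟩
  have hna : ‖a - x‖ < r / 4 := by
    have : a - x = (1 / 2 : ℂ) • ((p.1 - x) + (p.2 - x)) := by
      rw [ha]; module
    rw [this, norm_smul]
    have := norm_add_le (p.1 - x) (p.2 - x)
    have h2 : ‖(1 / 2 : ℂ)‖ = 1 / 2 := by norm_num
    rw [h2]; linarith
  have hnb : ‖b‖ < r / 4 := by
    have : b = (-Complex.I / 2 : ℂ) • ((p.1 - x) - (p.2 - x)) := by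
      rw [hb]; module
    rw [this, norm_smul]
    have := norm_sub_le (p.1 - x) (p.2 - x)
    have h2 : ‖(-Complex.I / 2 : ℂ)‖ = 1 / 2 := by simp
    rw [h2]; linarith
  have hline (t : ℂ) (ht : ‖t‖ < 2) : ‖a + t • b - x‖ < r := by
    have : a + t • b - x = (a - x) + t • b := by abel
    rw [this]
    calc _ ≤ ‖a - x‖ + ‖t‖ * ‖b‖ := (norm_add_le _ _).trans (by rw [norm_smul])
      _ ≤ ‖a - x‖ + 2 * ‖b‖ := by gcongr
      _ < r := by linarith
  let γ : ℂ → E × E := fun t => (a + t • b, a + starRingEnd ℂ t • b)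
  have hγS (t : ℂ) (ht : ‖t‖ < 2) : γ t ∈ S := by
    apply hb₁
    rw [mem_ball_iff_norm, Prod.norm_def]
    refine max_lt ?_ ?_
    · exact hline t ht
    · exact hline _ (by simpa using ht)
  have hγ (t : ℂ) : HasFDerivAt γ (((1 : ℂ →L[ℝ] ℂ).smulRight b).prod
      ((Complex.conjCLE : ℂ →L[ℝ] ℂ).smulRight b)) t := by
    have h1 : HasFDerivAt (fun t : ℂ => a + t • b) ((1 : ℂ →L[ℝ] ℂ).smulRight b) t :=
      ((hasFDerivAt_id (𝕜 := ℝ) t).smul_const b).const_add a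
    have h2 : HasFDerivAt (fun t : ℂ => a + starRingEnd ℂ t • b)
        ((Complex.conjCLE : ℂ →L[ℝ] ℂ).smulRight b) t :=
      ((Complex.conjCLE.hasFDerivAt (x := t)).smul_const b).const_add a
    exact h1.prodMk h2
  -- The conjugate in the second component of `γ` compensates the antiholomorphy of `g`, so the
  -- composite is holomorphic in `t`.
  have hd : DifferentiableOn ℂ (g ∘ γ) (Metric.ball 0 2) := by
    intro t ht
    have ht' := hγS t (by simpa using ht)
    apply DifferentiableAt.differentiableWithinAt
    have hc := (h.differentiableAt hS ht').hasFDerivAt.comp t (hγ t)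
    rw [differentiableAt_iff_restrictScalars ℝ hc.differentiableAt]
    refine ⟨ContinuousLinearMap.toSpanSingleton ℂ (fderiv ℝ g (γ t) (b, b)), ?_⟩
    rw [hc.fderiv]
    ext s
    have e : ((s • b, starRingEnd ℂ s • b) : E × E) = (s • b, 0) + (0, starRingEnd ℂ s • b) := by
      simp
    have e' : ((b, b) : E × E) = (b, 0) + (0, b) := by simp
    simp only [ContinuousLinearMap.coe_restrictScalars',
      ContinuousLinearMap.toSpanSingleton_apply, ContinuousLinearMap.comp_apply,
      ContinuousLinearMap.prod_apply, ContinuousLinearMap.smulRight_apply]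
    simp only [one_apply_eq_self, ContinuousLinearEquiv.coe_coe, Complex.conjCLE_apply]
    rw [e, e', map_add, map_add, h.fderiv_smul_left ht' s, h.fderiv_smul_right ht', Complex.conj_conj,
      smul_eq_mul, mul_add]
  -- The composite vanishes at real `t`, and these accumulate at `0`. The identity theorem extends
  -- the vanishing to `t = i`.
  have hfr : ∃ᶠ t in 𝓝[≠] (0 : ℂ), (g ∘ γ) t = 0 := by
    have hreal : ∀ s : ℝ, |s| < 2 → (g ∘ γ) (s : ℂ) = 0 := by
      intro s hs
      simp only [Function.comp, γ, Complex.conj_ofReal]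
      refine hb₂ _ (mem_ball_iff_norm.2 ?_)
      exact hline s (by simpa using hs)
    have ht : Tendsto (fun s : ℝ => (s : ℂ)) (𝓝[>] 0) (𝓝[≠] 0) := by
      refine tendsto_nhdsWithin_iff.2 ⟨?_, ?_⟩
      · exact (Complex.continuous_ofReal.tendsto' 0 0 (by simp)).mono_left nhdsWithin_le_nhds
      · filter_upwards [self_mem_nhdsWithin] with s hs
        simpa using (ne_of_gt hs)
    refine ht.frequently (Filter.Eventually.frequently ?_)
    have : ∀ᶠ s : ℝ in 𝓝 0, |s| < 2 := by
      have := (continuous_abs.tendsto (0 : ℝ))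
      exact this.eventually (gt_mem_nhds (by simp))
    filter_upwards [nhdsWithin_le_nhds this] with s hs using hreal s hs
  have := (hd.analyticOnNhd Metric.isOpen_ball).eqOn_zero_of_preconnected_of_frequently_eq_zero
    (convex_ball _ _).isPreconnected (Metric.mem_ball_self (by norm_num)) hfr
  have hI := this (x := Complex.I) (by simp)
  have e1 : γ Complex.I = p := by
    ext
    · simp only [γ, ha, hb, smul_smul]
      have : Complex.I * (-Complex.I / 2) = 1 / 2 := by ring_nf; simp; norm_num
      rw [this]; module
    · simp only [γ, ha, hb, smul_smul]
      have : starRingEnd ℂ Complex.I * (-Complex.I / 2) = -(1 / 2) := by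
        simp only [Complex.conj_I]; ring_nf; simp; norm_num
      rw [this]; module
  simpa [e1] using hI

/-! #### The restriction to the diagonal -/

section Diagonal

variable {u : E → ℝ} {x : E}

lemma hasFDerivAt_diag (h : IsSesqui g S) (hS : IsOpen S) (hx : (x, x) ∈ S)
    (hu : ∀ᶠ z in 𝓝 x, g (z, z) = u z) :
    HasFDerivAt u (Complex.reCLM ∘L fderiv ℝ g (x, x) ∘L
      ((ContinuousLinearMap.id ℝ E).prod (ContinuousLinearMap.id ℝ E))) x := by
  have h1 : HasFDerivAt (fun z : E => (z, z))
      ((ContinuousLinearMap.id ℝ E).prod (ContinuousLinearMap.id ℝ E)) x :=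
    (hasFDerivAt_id x).prodMk (hasFDerivAt_id x)
  have h2 := Complex.reCLM.hasFDerivAt.comp x
    (HasFDerivAt.comp x (f := fun z : E => (z, z)) (h.differentiableAt hS hx).hasFDerivAt h1)
  refine h2.congr_of_eventuallyEq ?_
  filter_upwards [hu] with z hz
  simp [hz]

omit [NormedSpace ℂ E] in
lemma eventually_mem_diag (hS : IsOpen S) (hx : (x, x) ∈ S) : ∀ᶠ z in 𝓝 x, (z, z) ∈ S :=
  (continuous_id.prodMk continuous_id).continuousAt.eventually (hS.mem_nhds hx)

lemma im_fderiv_diag (h : IsSesqui g S) (hS : IsOpen S) (hx : (x, x) ∈ S)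
    (hu : ∀ᶠ z in 𝓝 x, g (z, z) = u z) (v : E) :
    (fderiv ℝ g (x, x) (v, v)).im = 0 := by
  have h1 : HasFDerivAt (fun z : E => (z, z))
      ((ContinuousLinearMap.id ℝ E).prod (ContinuousLinearMap.id ℝ E)) x :=
    (hasFDerivAt_id x).prodMk (hasFDerivAt_id x)
  have h2 := Complex.imCLM.hasFDerivAt.comp x
    (HasFDerivAt.comp x (f := fun z : E => (z, z)) (h.differentiableAt hS hx).hasFDerivAt h1)
  have h3 : HasFDerivAt (Complex.imCLM ∘ g ∘ fun z : E => (z, z)) (0 : E →L[ℝ] ℝ) x := by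
    refine (hasFDerivAt_const (0 : ℝ) x).congr_of_eventuallyEq ?_
    filter_upwards [hu] with z hz
    simp [hz]
  have := congrArg (fun L => L v) (h2.unique h3)
  simpa using this

/-- The derivative along the diagonal is real because `u` is. In the direction `Jv` its imaginary
part is the real part of the difference of the two partial derivatives along `v`. -/
lemma re_fderiv_left_eq_right (h : IsSesqui g S) (hS : IsOpen S) (hx : (x, x) ∈ S)
    (hu : ∀ᶠ z in 𝓝 x, g (z, z) = u z) (v : E) :
    (fderiv ℝ g (x, x) (v, 0)).re = (fderiv ℝ g (x, x) (0, v)).re := by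
  have h1 := h.im_fderiv_diag hS hx hu (J v)
  have e : ((J v, J v) : E × E) = (J v, 0) + (0, J v) := by simp
  rw [e, map_add, h.left _ hx, h.right _ hx] at h1
  simp at h1
  linarith

lemma fderiv_diag (h : IsSesqui g S) (hS : IsOpen S) (hx : (x, x) ∈ S)
    (hu : ∀ᶠ z in 𝓝 x, g (z, z) = u z) (v : E) :
    fderiv ℝ u x v = 2 * (fderiv ℝ g (x, x) (v, 0)).re := by
  rw [(h.hasFDerivAt_diag hS hx hu).fderiv]
  have e : ((v, v) : E × E) = (v, 0) + (0, v) := by simp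
  have := h.re_fderiv_left_eq_right hS hx hu v
  simp only [ContinuousLinearMap.comp_apply, ContinuousLinearMap.prod_apply,
    ContinuousLinearMap.id_apply, Complex.reCLM_apply]
  rw [e, map_add, Complex.add_re]; linarith

lemma contDiffAt_diag (h : IsSesqui g S) (hS : IsOpen S) (hx : (x, x) ∈ S)
    (hu : ∀ᶠ z in 𝓝 x, g (z, z) = u z) : ContDiffAt ℝ 2 u x := by
  have h1 : ContDiffAt ℝ 2 (Complex.reCLM ∘ g ∘ fun z : E => (z, z)) x :=
    Complex.reCLM.contDiff.contDiffAt.comp x (ContDiffAt.comp x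
      (f := fun z : E => (z, z)) ((h.contDiffAt hS hx).of_le two_le_smooth)
      (contDiffAt_id.prodMk contDiffAt_id))
  refine h1.congr_of_eventuallyEq ?_
  filter_upwards [hu] with z hz
  simp [hz]

lemma fderiv_fderiv_diag (h : IsSesqui g S) (hS : IsOpen S) (hx : (x, x) ∈ S)
    (hu : ∀ᶠ z in 𝓝 x, g (z, z) = u z) (v w : E) :
    fderiv ℝ (fderiv ℝ u) x v w = 2 * ((fderiv ℝ (fderiv ℝ g) (x, x) (v, 0) (w, 0)).re
      + (fderiv ℝ (fderiv ℝ g) (x, x) (0, v) (w, 0)).re) := by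
  have h1 : fderiv ℝ (fun z => fderiv ℝ u z w) x v = fderiv ℝ (fderiv ℝ u) x v w := by
    rw [fderiv_clm_apply (differentiableAt_fderiv_of_contDiffAt (h.contDiffAt_diag hS hx hu))
      (by fun_prop)]
    simp
  have hD := h.dir hS (w, 0)
  have h2 : ∀ᶠ z in 𝓝 x, fderiv ℝ u z w = 2 * (fderiv ℝ g (z, z) (w, 0)).re := by
    filter_upwards [eventually_mem_diag hS hx, eventually_eventually_nhds.2 hu] with z hz hz'
    exact h.fderiv_diag hS hz hz' w
  have hd : HasFDerivAt (fun z : E => (z, z))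
      ((ContinuousLinearMap.id ℝ E).prod (ContinuousLinearMap.id ℝ E)) x :=
    (hasFDerivAt_id x).prodMk (hasFDerivAt_id x)
  have h3 := (Complex.reCLM.hasFDerivAt.comp x
    (HasFDerivAt.comp x (f := fun z : E => (z, z)) (hD.differentiableAt hS hx).hasFDerivAt hd)
    ).const_mul (2 : ℝ)
  have h4 : fderiv ℝ (fun z => fderiv ℝ u z w) x = _ :=
    (h3.congr_of_eventuallyEq (by filter_upwards [h2] with z hz; simpa using hz)).fderiv
  rw [← h1, h4]
  have e : ((v, v) : E × E) = (v, 0) + (0, v) := by simp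
  simp only [_root_.smul_apply, ContinuousLinearMap.comp_apply,
    ContinuousLinearMap.prod_apply, ContinuousLinearMap.id_apply, Complex.reCLM_apply, smul_eq_mul,
    h.fderiv_fderiv_apply hS hx]
  rw [e, map_add]; simp

/-- `i∂∂̄u` in terms of the mixed second derivatives of a polarization of `u`. -/
lemma ddbarFlat_diag (h : IsSesqui g S) (hS : IsOpen S) (hx : (x, x) ∈ S)
    (hu : ∀ᶠ z in 𝓝 x, g (z, z) = u z) (v w : E) :
    ddbarFlat u x ![v, w] = -(fderiv ℝ (fderiv ℝ g) (x, x) (0, w) (v, 0)).im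
      + (fderiv ℝ (fderiv ℝ g) (x, x) (0, v) (w, 0)).im := by
  rw [ddbarFlat_apply (h.contDiffAt_diag hS hx hu)]
  simp only [Matrix.cons_val_zero, Matrix.cons_val_one]
  rw [h.fderiv_fderiv_diag hS hx hu, h.fderiv_fderiv_diag hS hx hu,
    h.fderiv_fderiv_left hS hx, h.fderiv_fderiv_left hS hx, h.fderiv_fderiv_left hS hx,
    h.fderiv_fderiv_left hS hx, h.symm_fderiv hS hx (v, 0) (w, 0)]
  simp
  ring

lemma ddbarFlat_diag_self (h : IsSesqui g S) (hS : IsOpen S) (hx : (x, x) ∈ S)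
    (hu : ∀ᶠ z in 𝓝 x, g (z, z) = u z) (v : E) :
    ddbarFlat u x ![v, J v] = 2 * (fderiv ℝ (fderiv ℝ g) (x, x) (0, v) (v, 0)).re := by
  rw [h.ddbarFlat_diag hS hx hu, h.fderiv_fderiv_left hS hx,
    h.symm_fderiv hS hx (0, J v), h.fderiv_fderiv_right hS hx, h.symm_fderiv hS hx (v, 0)]
  simp; ring

end Diagonal

end IsSesqui

end Sesqui

/-! ### Pluriharmonic potentials -/

section Sesqui

variable {E : Type*} [NormedAddCommGroup E] [NormedSpace ℂ E]

namespace IsSesqui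

variable {g g' : E × E → ℂ} {S S' : Set (E × E)} {u : E → ℝ} {x : E}

/-- Let `B (v, w)` be the mixed derivative. Vanishing of `i∂∂̄u` makes `Im B` symmetric. The second
derivative along the diagonal is real. Replacing `(v, w)` by `(Jv, Jw)` changes the sign of the pure
terms and keeps the mixed ones, so `Im B (v, w) + Im B (w, v) = 0`. Hence `Im B = 0`, and replacing
`w` by `Jw` gives `Re B = 0`. -/
lemma mixed_eq_zero (h : IsSesqui g S) (hS : IsOpen S) (hx : (x, x) ∈ S)
    (hu : ∀ᶠ z in 𝓝 x, g (z, z) = u z) (hdd : ddbarFlat u x = 0) (v w : E) :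
    fderiv ℝ (fderiv ℝ g) (x, x) (0, v) (w, 0) = 0 := by
  have skew (v w : E) : (fderiv ℝ (fderiv ℝ g) (x, x) (0, w) (v, 0)).im =
      (fderiv ℝ (fderiv ℝ g) (x, x) (0, v) (w, 0)).im := by
    have := h.ddbarFlat_diag hS hx hu v w
    rw [hdd, show (0 : E [⋀^Fin 2]→L[ℝ] ℝ) ![v, w] = 0 from rfl] at this
    linarith
  have im0 (v w : E) : (fderiv ℝ (fderiv ℝ g) (x, x) (v, v) (w, w)).im = 0 := by
    rw [← h.fderiv_fderiv_apply hS hx]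
    refine (h.dir hS (w, w)).im_fderiv_diag hS hx
      (u := fun z => (fderiv ℝ g (z, z) (w, w)).re) ?_ v
    filter_upwards [eventually_mem_diag hS hx, eventually_eventually_nhds.2 hu] with z hz hz'
    exact Complex.ext (by simp) (by simpa using h.im_fderiv_diag hS hz hz' w)
  have e (v : E) : ((v, v) : E × E) = (v, 0) + (0, v) := by simp
  have im1 (v w : E) : (fderiv ℝ (fderiv ℝ g) (x, x) (0, v) (w, 0)).im = 0 := by
    have h1 := im0 v w
    have h2 := im0 (J v) (J w)
    have h3 := skew v w
    simp only [e v, e w, e (J v), e (J w), map_add, _root_.add_apply] at h1 h2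
    rw [h.fderiv_fderiv_left hS hx, h.fderiv_fderiv_right hS hx, h.fderiv_fderiv_left hS hx,
      h.fderiv_fderiv_right hS hx,
      h.symm_fderiv hS hx (J v, 0), h.symm_fderiv hS hx (0, J v), h.symm_fderiv hS hx (J v, 0),
      h.symm_fderiv hS hx (0, J v), h.fderiv_fderiv_left hS hx, h.fderiv_fderiv_right hS hx,
      h.fderiv_fderiv_left hS hx, h.fderiv_fderiv_right hS hx] at h2
    rw [h.symm_fderiv hS hx (v, 0) (0, w)] at h1
    rw [h.symm_fderiv hS hx (w, 0) (0, v), h.symm_fderiv hS hx (w, 0) (v, 0),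
      h.symm_fderiv hS hx (0, w) (0, v)] at h2
    simp at h1 h2
    linarith
  have re1 := im1 v (J w)
  rw [h.fderiv_fderiv_left hS hx] at re1
  refine Complex.ext ?_ (im1 v w)
  simpa using re1

/-- The difference between `g` and the conjugate of `g ∘ swap` is of the same class and vanishes on
the diagonal, since `u` is real. -/
lemma re_symm_of_ball (h : IsSesqui g S) (hS : IsOpen S) {r : ℝ}
    (hb₁ : Metric.ball (x, x) r ⊆ S) (hu : ∀ z ∈ Metric.ball x r, g (z, z) = u z) {p : E × E}
    (hp : p ∈ Metric.ball (x, x) (r / 4)) : (g p.swap).re = (g p).re := by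
  have hT : IsOpen (S ∩ Prod.swap ⁻¹' S) := hS.inter (hS.preimage continuous_swap)
  have hsub := (h.mono (S' := S ∩ Prod.swap ⁻¹' S) inter_subset_left).sub
    ((h.conj_swap hS).mono inter_subset_right) hT
  have := hsub.eq_zero_of_ball hT (x := x) (r := r) ?_ ?_ hp
  · have := congrArg Complex.re this
    simp at this
    linarith
  · intro q hq
    refine ⟨hb₁ hq, hb₁ ?_⟩
    rw [mem_ball_iff_norm, Prod.norm_def] at hq ⊢
    simpa [max_comm] using hq
  · intro z hz
    simp [hu z hz]

/-- The diastasis of a pluriharmonic function vanishes. -/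
lemma eventually_diastasis_eq_zero (h : IsSesqui g S) (hS : IsOpen S) (hx : (x, x) ∈ S)
    (hu : ∀ᶠ z in 𝓝 x, g (z, z) = u z) (hdd : ∀ᶠ z in 𝓝 x, ddbarFlat u z = 0) :
    ∀ᶠ p in 𝓝 (x, x), u p.1 + u p.2 - 2 * (g p).re = 0 := by
  obtain ⟨r₁, hr₁, hb₁⟩ := Metric.isOpen_iff.1 hS _ hx
  obtain ⟨r₂, hr₂, hb₂⟩ := Metric.eventually_nhds_iff_ball.1
    (hu.and (hdd.and (eventually_mem_diag hS hx)))
  set r := min r₁ r₂ with hrdef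
  have hr : 0 < r := lt_min hr₁ hr₂
  have hbS : Metric.ball (x, x) r ⊆ S := (Metric.ball_subset_ball (min_le_left _ _)).trans hb₁
  have hbu : ∀ z ∈ Metric.ball x r, g (z, z) = u z := fun z hz =>
    (hb₂ z (Metric.ball_subset_ball (min_le_right _ _) hz)).1
  -- Mixed derivatives are themselves sesquiholomorphic and vanish on the diagonal, hence on a ball.
  -- As a result `g` splits into a function of the first variable plus a function of the second.
  have hmix : ∀ p ∈ Metric.ball (x, x) (r / 4), ∀ v w : E,
      fderiv ℝ (fun q => fderiv ℝ g q (0, v)) p (w, 0) = 0 := by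
    intro p hp v w
    refine ((h.dir hS (0, v)).dir hS (w, 0)).eq_zero_of_ball hS hbS (fun z hz => ?_) hp
    have hz' := hb₂ z (Metric.ball_subset_ball (min_le_right _ _) hz)
    rw [h.fderiv_fderiv_apply hS hz'.2.2, h.symm_fderiv hS hz'.2.2]
    refine h.mixed_eq_zero hS hz'.2.2 ?_ hz'.2.1 v w
    filter_upwards [Metric.isOpen_ball.mem_nhds hz] with y hy using hbu y hy
  have hB : Metric.ball (x, x) (r / 4) = Metric.ball x (r / 4) ×ˢ Metric.ball x (r / 4) :=
    (ball_prod_same x x _).symm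
  have hBS : Metric.ball x (r / 4) ×ˢ Metric.ball x (r / 4) ⊆ S := by
    rw [← hB]; exact (Metric.ball_subset_ball (by linarith)).trans hbS
  have hd1 : ∀ z ∈ Metric.ball x (r / 4), ∀ z' ∈ Metric.ball x (r / 4),
      ∀ w ∈ Metric.ball x (r / 4), ∀ v,
      fderiv ℝ g (z, w) (0, v) = fderiv ℝ g (z', w) (0, v) := by
    intro z hz z' hz' w hw v
    have hder : ∀ y ∈ Metric.ball x (r / 4), HasFDerivAt (fun y => fderiv ℝ g (y, w) (0, v))
        (0 : E →L[ℝ] ℂ) y := by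
      intro y hy
      have h1 := ((h.dir hS (0, v)).differentiableAt hS (p := (y, w)) (hBS ⟨hy, hw⟩)).hasFDerivAt
      have h2 := HasFDerivAt.comp y (f := fun y : E => (y, w)) h1 (hasFDerivAt_prodMk_left y w)
      refine h2.congr_fderiv ?_
      ext1 η
      have := hmix (y, w) (by rw [hB]; exact ⟨hy, hw⟩) v η
      simpa using this
    refine Metric.isOpen_ball.is_const_of_fderiv_eq_zero (convex_ball _ _).isPreconnected
      (fun y hy => (hder y hy).differentiableAt.differentiableWithinAt)
      (fun y hy => (hder y hy).fderiv) hz hz'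
  -- The difference `g (z, ·) - g (w, ·)` is constant. Comparing its values at `z` and at `w` gives
  -- the identity. Together with the symmetry of `Re g` its real part is the claim.
  have hd2 : ∀ z ∈ Metric.ball x (r / 4), ∀ w ∈ Metric.ball x (r / 4),
      g (z, z) - g (w, z) = g (z, w) - g (w, w) := by
    intro z hz w hw
    have hder : ∀ y ∈ Metric.ball x (r / 4), HasFDerivAt (fun y => g (z, y) - g (w, y))
        (0 : E →L[ℝ] ℂ) y := by
      intro y hy
      have h1 := HasFDerivAt.comp y (f := fun y : E => (z, y))
        (h.differentiableAt hS (p := (z, y)) (hBS ⟨hz, hy⟩)).hasFDerivAt (hasFDerivAt_prodMk_right z y)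
      have h2 := HasFDerivAt.comp y (f := fun y : E => (w, y))
        (h.differentiableAt hS (p := (w, y)) (hBS ⟨hw, hy⟩)).hasFDerivAt (hasFDerivAt_prodMk_right w y)
      refine (h1.sub h2).congr_fderiv ?_
      ext1 η
      simp [hd1 z hz w hw y hy η]
    exact Metric.isOpen_ball.is_const_of_fderiv_eq_zero (convex_ball _ _).isPreconnected
      (fun y hy => (hder y hy).differentiableAt.differentiableWithinAt)
      (fun y hy => (hder y hy).fderiv) hz hw
  refine Metric.eventually_nhds_iff_ball.2 ⟨r / 4, by positivity, fun p hp => ?_⟩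
  have hs := h.re_symm_of_ball hS hbS hbu hp
  rw [hB] at hp
  have h3 := congrArg Complex.re (hd2 p.1 hp.1 p.2 hp.2)
  have hin : Metric.ball x (r / 4) ⊆ Metric.ball x r := Metric.ball_subset_ball (by linarith)
  rw [hbu _ (hin hp.1), hbu _ (hin hp.2)] at h3
  simp only [Complex.sub_re, Complex.ofReal_re, Prod.swap, Prod.mk.eta] at h3 hs
  linarith

end IsSesqui

/-! ### The diastasis of a polarized potential in coordinates -/

section FlatDiastasis

/-- `u z + u w - 2 Re g (z, w)`. -/
def flatDiastasis (u : E → ℝ) (g : E × E → ℂ) (p : E × E) : ℝ := u p.1 + u p.2 - 2 * (g p).re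

variable {g : E × E → ℂ} {S : Set (E × E)} {u : E → ℝ} {x : E}

lemma hasFDerivAt_flatDiastasis {p : E × E} (hg : DifferentiableAt ℝ g p)
    (h1 : DifferentiableAt ℝ u p.1) (h2 : DifferentiableAt ℝ u p.2) :
    HasFDerivAt (flatDiastasis u g) (fderiv ℝ u p.1 ∘L ContinuousLinearMap.fst ℝ E E +
      fderiv ℝ u p.2 ∘L ContinuousLinearMap.snd ℝ E E -
      (2 : ℝ) • (Complex.reCLM ∘L fderiv ℝ g p)) p :=
  ((h1.hasFDerivAt.comp p hasFDerivAt_fst).add (h2.hasFDerivAt.comp p hasFDerivAt_snd)).sub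
    ((Complex.reCLM.hasFDerivAt.comp p hg.hasFDerivAt).const_mul (2 : ℝ))

lemma fderiv_flatDiastasis_diag (h : IsSesqui g S) (hS : IsOpen S) (hx : (x, x) ∈ S)
    (hu : ∀ᶠ z in 𝓝 x, g (z, z) = u z) (v : E) :
    fderiv ℝ (flatDiastasis u g) (x, x) (v, 0) = 0 := by
  have hux := (h.contDiffAt_diag hS hx hu).differentiableAt (by simp)
  rw [(hasFDerivAt_flatDiastasis (p := (x, x)) (h.differentiableAt hS hx) hux hux).fderiv]
  simp [h.fderiv_diag hS hx hu, show ((0, 0) : E × E) = 0 from rfl]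

lemma fderiv_fderiv_flatDiastasis_diag (h : IsSesqui g S) (hS : IsOpen S) (hx : (x, x) ∈ S)
    (hu : ∀ᶠ z in 𝓝 x, g (z, z) = u z) (ξ η : E × E) :
    fderiv ℝ (fderiv ℝ (flatDiastasis u g)) (x, x) ξ η =
      fderiv ℝ (fderiv ℝ u) x ξ.1 η.1 + fderiv ℝ (fderiv ℝ u) x ξ.2 η.2
        - 2 * (fderiv ℝ (fderiv ℝ g) (x, x) ξ η).re := by
  have hux := h.contDiffAt_diag hS hx hu
  have hD := differentiableAt_fderiv_of_contDiffAt hux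
  have hev : ∀ᶠ z in 𝓝 x, DifferentiableAt ℝ u z := by
    filter_upwards [hux.eventually (by simp)] with z hz using hz.differentiableAt (by simp)
  have e : fderiv ℝ (flatDiastasis u g) =ᶠ[𝓝 (x, x)] fun p =>
      fderiv ℝ u p.1 ∘L ContinuousLinearMap.fst ℝ E E +
      fderiv ℝ u p.2 ∘L ContinuousLinearMap.snd ℝ E E -
      (2 : ℝ) • (Complex.reCLM ∘L fderiv ℝ g p) := by
    filter_upwards [hS.mem_nhds hx, (continuousAt_fst (p := (x, x))).eventually hev,
      (continuousAt_snd (p := (x, x))).eventually hev] with p hp h1 h2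
    exact (hasFDerivAt_flatDiastasis (h.differentiableAt hS hp) h1 h2).fderiv
  have h1 : HasFDerivAt (fun p : E × E => fderiv ℝ u p.1 ∘L ContinuousLinearMap.fst ℝ E E)
      ((ContinuousLinearMap.compL ℝ (E × E) E ℝ).flip (ContinuousLinearMap.fst ℝ E E) ∘L
        (fderiv ℝ (fderiv ℝ u) x ∘L ContinuousLinearMap.fst ℝ E E)) (x, x) :=
    ((ContinuousLinearMap.compL ℝ (E × E) E ℝ).flip
      (ContinuousLinearMap.fst ℝ E E)).hasFDerivAt.comp (x, x)
        (HasFDerivAt.comp (x, x) (g := fderiv ℝ u) (f := Prod.fst) hD.hasFDerivAt hasFDerivAt_fst)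
  have h2 : HasFDerivAt (fun p : E × E => fderiv ℝ u p.2 ∘L ContinuousLinearMap.snd ℝ E E)
      ((ContinuousLinearMap.compL ℝ (E × E) E ℝ).flip (ContinuousLinearMap.snd ℝ E E) ∘L
        (fderiv ℝ (fderiv ℝ u) x ∘L ContinuousLinearMap.snd ℝ E E)) (x, x) :=
    ((ContinuousLinearMap.compL ℝ (E × E) E ℝ).flip
      (ContinuousLinearMap.snd ℝ E E)).hasFDerivAt.comp (x, x)
        (HasFDerivAt.comp (x, x) (g := fderiv ℝ u) (f := Prod.snd) hD.hasFDerivAt hasFDerivAt_snd)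
  have h3 : HasFDerivAt (fun p : E × E => (2 : ℝ) • (Complex.reCLM ∘L fderiv ℝ g p))
      ((2 : ℝ) • (ContinuousLinearMap.compL ℝ (E × E) ℂ ℝ Complex.reCLM ∘L
        fderiv ℝ (fderiv ℝ g) (x, x))) (x, x) :=
    ((ContinuousLinearMap.compL ℝ (E × E) ℂ ℝ Complex.reCLM).hasFDerivAt.comp (x, x)
      (h.differentiableAt_fderiv hS hx).hasFDerivAt).const_smul (2 : ℝ)
  have h4 : fderiv ℝ (fun p => fderiv ℝ u p.1 ∘L ContinuousLinearMap.fst ℝ E E +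
      fderiv ℝ u p.2 ∘L ContinuousLinearMap.snd ℝ E E -
      (2 : ℝ) • (Complex.reCLM ∘L fderiv ℝ g p)) (x, x) = _ := ((h1.add h2).sub h3).fderiv
  rw [e.fderiv_eq, h4]
  simp

/-- The pure second derivatives of `2 Re g` cancel those of `u`, and only the mixed part survives.
This is the reason why the diastasis, unlike `u` itself, is convex in its first variable near the
diagonal. -/
lemma fderiv_fderiv_flatDiastasis_left (h : IsSesqui g S) (hS : IsOpen S) (hx : (x, x) ∈ S)
    (hu : ∀ᶠ z in 𝓝 x, g (z, z) = u z) (v : E) :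
    fderiv ℝ (fderiv ℝ (flatDiastasis u g)) (x, x) (v, 0) (v, 0) = ddbarFlat u x ![v, J v] := by
  rw [fderiv_fderiv_flatDiastasis_diag h hS hx hu, h.ddbarFlat_diag_self hS hx hu,
    h.fderiv_fderiv_diag hS hx hu]
  simp; ring

/-- The terms `u (z)` and `u (w)` have no mixed derivatives, so only `-2 Re g` contributes. The
definite sign later yields that `G` is injective and has injective differential. -/
lemma fderiv_fderiv_flatDiastasis_mixed (h : IsSesqui g S) (hS : IsOpen S) (hx : (x, x) ∈ S)
    (hu : ∀ᶠ z in 𝓝 x, g (z, z) = u z) (v : E) :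
    fderiv ℝ (fderiv ℝ (flatDiastasis u g)) (x, x) (v, 0) (0, v) = -ddbarFlat u x ![v, J v] := by
  rw [fderiv_fderiv_flatDiastasis_diag h hS hx hu, h.ddbarFlat_diag_self hS hx hu,
    h.symm_fderiv hS hx]
  simp

end FlatDiastasis

/-- The gradient map intertwines the forms `i∂∂̄b` and `i∂∂̄a`, if `a (q) + b (p)` agrees to first
order with `2 Re g (p, q)` along its graph `p = G q`. -/
lemma ddbarFlat_comp_gradient {g : E × E → ℂ} {S : Set (E × E)} {a b : E → ℝ} {G : E → E} {q : E}
    (h : IsSesqui g S) (hS : IsOpen S) (hq : (G q, q) ∈ S) (hG : ContDiffAt ℝ 2 G q)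
    (ha : ContDiffAt ℝ 2 a q) (hb : ContDiffAt ℝ 2 b (G q))
    (hb' : ∀ᶠ y in 𝓝 q, ∀ v, fderiv ℝ b (G y) v = 2 * (fderiv ℝ g (G y, y) (v, 0)).re)
    (ha' : ∀ᶠ y in 𝓝 q, ∀ v, fderiv ℝ a y v = 2 * (fderiv ℝ g (G y, y) (0, v)).re) :
    (ddbarFlat b (G q)).compContinuousLinearMap (fderiv ℝ G q) = ddbarFlat a q := by
  -- This is the primitive of the difference of the two pulled back 1-forms. `J` acts as `i` in the
  -- first slot of `dg` and as `-i` in the second, which turns the real parts in the hypotheses into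
  -- imaginary parts of opposite sign.
  let s : E → ℝ := fun y => 2 * (g (G y, y)).im
  have hgr : ContDiffAt ℝ 2 (fun y => (G y, y)) q := hG.prodMk contDiffAt_id
  have hs : ContDiffAt ℝ 2 s q :=
    contDiffAt_const.mul (Complex.imCLM.contDiff.contDiffAt.comp q
      (ContDiffAt.comp q (f := fun y => (G y, y)) ((h.contDiffAt hS hq).of_le two_le_smooth) hgr))
  have hs' : ∀ᶠ y in 𝓝 q, ∀ v, fderiv ℝ s y v = 2 * (fderiv ℝ g (G y, y) (fderiv ℝ G y v, v)).im := by
    filter_upwards [hG.eventually (by simp),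
      hgr.continuousAt.eventually (hS.mem_nhds hq)] with y hy hyS v
    have h1 := ((hy.differentiableAt (by simp)).hasFDerivAt).prodMk (hasFDerivAt_id (𝕜 := ℝ) y)
    have h2 := (Complex.imCLM.hasFDerivAt.comp y (HasFDerivAt.comp y (f := fun y => (G y, y))
      (h.differentiableAt hS hyS).hasFDerivAt h1)).const_mul (2 : ℝ)
    have h3 : fderiv ℝ s y = _ := h2.fderiv
    rw [h3]; simp
  have e : (fun y => (dcFlat b (G y)).compContinuousLinearMap (fderiv ℝ G y)) =ᶠ[𝓝 q]
      fun y => dcFlat a y + ContinuousAlternatingMap.ofSubsingleton ℝ E ℝ (0 : Fin 1)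
        (fderiv ℝ s y) := by
    filter_upwards [hb', ha', hs', hgr.continuousAt.eventually (hS.mem_nhds hq)]
      with y hby hay hsy hyS
    ext v
    simp only [ContinuousAlternatingMap.compContinuousLinearMap_apply, dcFlat_apply,
      ContinuousAlternatingMap.add_apply, ContinuousAlternatingMap.ofSubsingleton_apply_apply,
      Function.comp, hby, hay, hsy]
    have e2 : ((fderiv ℝ G y (v 0), v 0) : E × E) = (fderiv ℝ G y (v 0), 0) + (0, v 0) := by simp
    rw [h.left _ hyS, h.right _ hyS, e2, map_add]
    simp; ring
  have hds := differentiableAt_fderiv_of_contDiffAt hs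
  -- Symmetry of the second derivative of `s` is `d (ds) = 0`.
  have hsymm := hs.isSymmSndFDerivAt minSmoothness_real_two
  have h0 : extDeriv (fun y => ContinuousAlternatingMap.ofSubsingleton ℝ E ℝ (0 : Fin 1)
      (fderiv ℝ s y)) q = 0 := by
    ext v
    rw [extDeriv_ofSubsingleton_apply hds, hsymm (v 0) (v 1)]
    simp
  have h4 := extDeriv_pullback (differentiableAt_dcFlat hb) hG minSmoothness_real_two
  rw [Filter.EventuallyEq.extDeriv_eq e, extDeriv_fun_add (differentiableAt_dcFlat ha)
    (differentiableAt_ofSubsingleton hds), h0, add_zero] at h4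
  unfold ddbarFlat
  rw [h4]; rfl

end Sesqui

section Manifold

variable {E : Type*} [NormedAddCommGroup E] [NormedSpace ℂ E]
  {M : Type*} [TopologicalSpace M] [ChartedSpace E M]

/-! ### Charts of a complex manifold as charts of the underlying real manifold -/

lemma contDiffOn_transition [IsManifold 𝓘(ℂ, E) ω M] {e e' : OpenPartialHomeomorph M E}
    (he : e ∈ atlas E M) (he' : e' ∈ atlas E M) :
    ContDiffOn ℂ ω (e' ∘ e.symm) (e.target ∩ e.symm ⁻¹' e'.source) := by
  have h := (contDiffGroupoid ω 𝓘(ℂ, E)).compatible he he'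
  rw [contDiffGroupoid, mem_groupoid_of_pregroupoid] at h
  have h1 := h.1
  simpa [contDiffPregroupoid, OpenPartialHomeomorph.trans_source] using h1

instance isManifold_real [IsManifold 𝓘(ℂ, E) ω M] : IsManifold 𝓘(ℝ, E) ω M := by
  refine isManifold_of_contDiffOn _ _ _ fun e e' he he' => ?_
  have h := (contDiffOn_transition he he').restrict_scalars ℝ
  simpa [OpenPartialHomeomorph.trans_source] using h

variable {e e' : OpenPartialHomeomorph M E} {y : E}

lemma contDiffAt_transition_complex [IsManifold 𝓘(ℂ, E) ω M] (he : e ∈ atlas E M)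
    (he' : e' ∈ atlas E M) (hy : y ∈ e.target) (hy' : e.symm y ∈ e'.source) :
    ContDiffAt ℂ ω (e' ∘ e.symm) y :=
  (contDiffOn_transition he he').contDiffAt
    ((e.isOpen_inter_preimage_symm e'.open_source).mem_nhds ⟨hy, hy'⟩)

lemma contDiffAt_transition [IsManifold 𝓘(ℂ, E) ω M] (he : e ∈ atlas E M)
    (he' : e' ∈ atlas E M) (hy : y ∈ e.target) (hy' : e.symm y ∈ e'.source) :
    ContDiffAt ℝ ω (e' ∘ e.symm) y :=
  (contDiffAt_transition_complex he he' hy hy').restrict_scalars ℝ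

lemma eventually_fderiv_transition_J [IsManifold 𝓘(ℂ, E) ω M] (he : e ∈ atlas E M)
    (he' : e' ∈ atlas E M) (hy : y ∈ e.target) (hy' : e.symm y ∈ e'.source) :
    ∀ᶠ z in 𝓝 y, ∀ v, fderiv ℝ (e' ∘ e.symm) z (J v) = J (fderiv ℝ (e' ∘ e.symm) z v) := by
  filter_upwards [(e.isOpen_inter_preimage_symm e'.open_source).mem_nhds ⟨hy, hy'⟩] with z hz v
  exact fderiv_real_J
    ((contDiffAt_transition_complex he he' hz.1 hz.2).differentiableAt (by simp)) v

section Charts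

variable {𝕜 : Type*} [NontriviallyNormedField 𝕜] [NormedSpace 𝕜 E] [IsManifold 𝓘(𝕜, E) ω M]

lemma contMDiffAt_chart_symm (he : e ∈ atlas E M) (hy : y ∈ e.target) :
    ContMDiffAt 𝓘(𝕜, E) 𝓘(𝕜, E) ω e.symm y :=
  (contMDiffOn_symm_of_mem_maximalAtlas
    (IsManifold.subset_maximalAtlas (I := 𝓘(𝕜, E)) (n := ω) he)).contMDiffAt
      (e.open_target.mem_nhds hy)

lemma contMDiffAt_chart {x : M} (he : e ∈ atlas E M) (hx : x ∈ e.source) :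
    ContMDiffAt 𝓘(𝕜, E) 𝓘(𝕜, E) ω e x :=
  (contMDiffOn_of_mem_maximalAtlas
    (IsManifold.subset_maximalAtlas (I := 𝓘(𝕜, E)) (n := ω) he)).contMDiffAt
      (e.open_source.mem_nhds hx)

lemma contDiffAt_comp_symm {F : Type*} [NormedAddCommGroup F] [NormedSpace 𝕜 F] {u : M → F}
    {n : WithTop ℕ∞} (he : e ∈ atlas E M) (hy : y ∈ e.target)
    (hu : ContMDiffAt 𝓘(𝕜, E) 𝓘(𝕜, F) n u (e.symm y)) : ContDiffAt 𝕜 n (u ∘ e.symm) y :=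
  contMDiffAt_iff_contDiffAt.1
    (ContMDiffAt.comp y hu ((contMDiffAt_chart_symm he hy).of_le le_top))

lemma differentiableAt_comp_symm {F : Type*} [NormedAddCommGroup F] [NormedSpace 𝕜 F] {u : M → F}
    (he : e ∈ atlas E M) (hy : y ∈ e.target)
    (hu : MDifferentiableAt 𝓘(𝕜, E) 𝓘(𝕜, F) u (e.symm y)) : DifferentiableAt 𝕜 (u ∘ e.symm) y :=
  mdifferentiableAt_iff_differentiableAt.1
    (MDifferentiableAt.comp y hu ((contMDiffAt_chart_symm he hy).mdifferentiableAt (by simp)))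

lemma contMDiffAt_of_comp_symm {F : Type*} [NormedAddCommGroup F] [NormedSpace 𝕜 F] {u : M → F}
    {n : WithTop ℕ∞} {x : M} (he : e ∈ atlas E M) (hx : x ∈ e.source)
    (hu : ContDiffAt 𝕜 n (u ∘ e.symm) (e x)) : ContMDiffAt 𝓘(𝕜, E) 𝓘(𝕜, F) n u x := by
  have h := ContMDiffAt.comp x (contMDiffAt_iff_contDiffAt.2 hu)
    ((contMDiffAt_chart (𝕜 := 𝕜) he hx).of_le le_top)
  refine h.congr_of_eventuallyEq ?_
  filter_upwards [e.open_source.mem_nhds hx] with z hz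
  simp [e.left_inv hz]

lemma mfderiv_eq_fderiv_chart {f : E → M} (hf : MDifferentiableAt 𝓘(𝕜, E) 𝓘(𝕜, E) f y) :
    mfderiv 𝓘(𝕜, E) 𝓘(𝕜, E) f y = (fderiv 𝕜 (chartAt E (f y) ∘ f) y : E →L[𝕜] E) := by
  refine hf.mfderiv.trans ?_
  simp [writtenInExtChartAt, fderivWithin_univ, Function.comp_def]
  rfl

lemma mfderiv_eq_fderiv_charts {G : M → M} {x : M}
    (hf : MDifferentiableAt 𝓘(𝕜, E) 𝓘(𝕜, E) G x) :
    mfderiv 𝓘(𝕜, E) 𝓘(𝕜, E) G x =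
      (fderiv 𝕜 (chartAt E (G x) ∘ G ∘ (chartAt E x).symm) (chartAt E x x) : E →L[𝕜] E) := by
  refine hf.mfderiv.trans ?_
  simp [writtenInExtChartAt, fderivWithin_univ, Function.comp_def]
  rfl

end Charts

lemma pullback_id (α : TwoForm E M) : pullback (id : M → M) α = α := by
  ext x v
  have h : mfderiv 𝓘(ℝ, E) 𝓘(ℝ, E) (id : M → M) x = ContinuousLinearMap.id ℝ _ := mfderiv_id
  simp only [pullback]
  rw [h]
  rfl

variable [IsManifold 𝓘(ℂ, E) ω M]

lemma inChart_eq (he : e ∈ atlas E M) (hy : y ∈ e.target) (α : TwoForm E M) :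
    inChart e α y = ContinuousAlternatingMap.compContinuousLinearMap
      (α (e.symm y) : E [⋀^Fin 2]→L[ℝ] ℝ) (fderiv ℝ (chartAt E (e.symm y) ∘ e.symm) y) := by
  have h := mfderiv_eq_fderiv_chart (𝕜 := ℝ)
    ((contMDiffAt_chart_symm (𝕜 := ℝ) he hy).mdifferentiableAt (by simp))
  unfold inChart
  rw [h]
  rfl

lemma inChart_chartAt (x : M) (α : TwoForm E M) :
    inChart (chartAt E x) α (chartAt E x x) = (α x : E [⋀^Fin 2]→L[ℝ] ℝ) := by
  rw [inChart_eq (chart_mem_atlas E x) (mem_chart_target E x)]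
  have hx : (chartAt E x).symm (chartAt E x x) = x := (chartAt E x).left_inv (mem_chart_source E x)
  have e1 : (chartAt E x ∘ (chartAt E x).symm) =ᶠ[𝓝 (chartAt E x x)] id := by
    filter_upwards [(chartAt E x).open_target.mem_nhds (mem_chart_target E x)] with z hz
    simp [(chartAt E x).right_inv hz]
  have key : ∀ p, p = x → ContinuousAlternatingMap.compContinuousLinearMap
      (α p : E [⋀^Fin 2]→L[ℝ] ℝ) (fderiv ℝ (chartAt E p ∘ (chartAt E x).symm) (chartAt E x x)) =
      ContinuousAlternatingMap.compContinuousLinearMap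
      (α x : E [⋀^Fin 2]→L[ℝ] ℝ) (fderiv ℝ (chartAt E x ∘ (chartAt E x).symm) (chartAt E x x)) := by
    rintro _ rfl; rfl
  refine (key _ hx).trans ?_
  have h2 : fderiv ℝ (chartAt E x ∘ (chartAt E x).symm) (chartAt E x x) =
      ContinuousLinearMap.id ℝ E := by rw [e1.fderiv_eq, fderiv_id]
  ext v
  exact congrArg (fun L : E →L[ℝ] E => (α x : E [⋀^Fin 2]→L[ℝ] ℝ) (L ∘ v)) h2

/-- The expression of `i∂∂̄u` in an arbitrary chart. -/
lemma inChart_ddbar (he : e ∈ atlas E M) (hy : y ∈ e.target) {u : M → ℝ}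
    (hu : ContMDiffAt 𝓘(ℝ, E) 𝓘(ℝ, ℝ) 2 u (e.symm y)) :
    inChart e (ddbar u) y = ddbarFlat (u ∘ e.symm) y := by
  rw [inChart_eq he hy]
  set c := chartAt E (e.symm y) with hc
  have hcs : e.symm y ∈ c.source := mem_chart_source E _
  have hcm : c ∈ atlas E M := chart_mem_atlas E _
  have e1 : u ∘ e.symm =ᶠ[𝓝 y] (u ∘ c.symm) ∘ (c ∘ e.symm) := by
    filter_upwards [(e.isOpen_inter_preimage_symm c.open_source).mem_nhds ⟨hy, hcs⟩] with z hz
    simp [c.left_inv hz.2]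
  rw [ddbarFlat_congr e1, ddbarFlat_comp (f := u ∘ c.symm) (τ := c ∘ e.symm)]
  · rfl
  · refine contDiffAt_comp_symm hcm (c.map_source hcs) ?_
    simpa [c.left_inv hcs] using hu
  · exact (contDiffAt_transition he hcm hy hcs).of_le le_top
  · exact eventually_fderiv_transition_J he hcm hy hcs

/-- The expression of a pullback in charts. -/
lemma inChart_pullback {G : M → M} (he : e ∈ atlas E M) (he' : e' ∈ atlas E M) (hy : y ∈ e.target)
    (hG : MDifferentiableAt 𝓘(ℝ, E) 𝓘(ℝ, E) G (e.symm y)) (hy' : G (e.symm y) ∈ e'.source)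
    (α : TwoForm E M) :
    inChart e (pullback G α) y = (inChart e' α (e' (G (e.symm y)))).compContinuousLinearMap
      (fderiv ℝ (e' ∘ G ∘ e.symm) y) := by
  set p := e.symm y with hp
  have h1 : MDifferentiableAt 𝓘(ℝ, E) 𝓘(ℝ, E) e.symm y :=
    (contMDiffAt_chart_symm he hy).mdifferentiableAt (by simp)
  have h2 : MDifferentiableAt 𝓘(ℝ, E) 𝓘(ℝ, E) (G ∘ e.symm) y := MDifferentiableAt.comp y hG h1
  have h3 : MDifferentiableAt 𝓘(ℝ, E) 𝓘(ℝ, E) e' ((G ∘ e.symm) y) :=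
    (contMDiffAt_chart he' hy').mdifferentiableAt (by simp)
  have h4 : MDifferentiableAt 𝓘(ℝ, E) 𝓘(ℝ, E) e'.symm (e' ((G ∘ e.symm) y)) :=
    (contMDiffAt_chart_symm he' (e'.map_source hy')).mdifferentiableAt (by simp)
  have h5 : MDifferentiableAt 𝓘(ℝ, E) 𝓘(ℝ, E) (e' ∘ G ∘ e.symm) y := MDifferentiableAt.comp y h3 h2
  have e1 : G ∘ e.symm =ᶠ[𝓝 y] e'.symm ∘ (e' ∘ G ∘ e.symm) := by
    have hc : ContinuousAt (G ∘ e.symm) y := h2.continuousAt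
    filter_upwards [hc.eventually (e'.open_source.mem_nhds hy')] with z hz
    exact (e'.left_inv hz).symm
  have k1 : HasMFDerivAt 𝓘(ℝ, E) 𝓘(ℝ, E) (G ∘ e.symm) y
      ((mfderiv 𝓘(ℝ, E) 𝓘(ℝ, E) G p).comp (mfderiv 𝓘(ℝ, E) 𝓘(ℝ, E) e.symm y)) :=
    HasMFDerivAt.comp y hG.hasMFDerivAt h1.hasMFDerivAt
  have k2 : HasMFDerivAt 𝓘(ℝ, E) 𝓘(ℝ, E) (e'.symm ∘ (e' ∘ G ∘ e.symm)) y
      ((mfderiv 𝓘(ℝ, E) 𝓘(ℝ, E) e'.symm (e' (G p))).comp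
        (mfderiv 𝓘(ℝ, E) 𝓘(ℝ, E) (e' ∘ G ∘ e.symm) y)) :=
    HasMFDerivAt.comp y h4.hasMFDerivAt h5.hasMFDerivAt
  have k3 := k2.congr_of_eventuallyEq e1
  have k4 := hasMFDerivAt_unique k1 k3
  rw [mfderiv_eq_fderiv] at k4
  have hpt : e'.symm (e' (G p)) = G p := e'.left_inv hy'
  ext v
  have k5 : ∀ w : E, (mfderiv 𝓘(ℝ, E) 𝓘(ℝ, E) G p (mfderiv 𝓘(ℝ, E) 𝓘(ℝ, E) e.symm y w) : E) =
      mfderiv 𝓘(ℝ, E) 𝓘(ℝ, E) e'.symm (e' (G p)) (fderiv ℝ (e' ∘ G ∘ e.symm) y w) :=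
    fun w => congrArg (fun L : E →L[ℝ] E => L w) k4
  change (α (G p) : E [⋀^Fin 2]→L[ℝ] ℝ) (fun i => (mfderiv 𝓘(ℝ, E) 𝓘(ℝ, E) G p
    (mfderiv 𝓘(ℝ, E) 𝓘(ℝ, E) e.symm y (v i)) : E)) = (α (e'.symm (e' (G p))) : E [⋀^Fin 2]→L[ℝ] ℝ)
      (fun i => (mfderiv 𝓘(ℝ, E) 𝓘(ℝ, E) e'.symm (e' (G p))
        (fderiv ℝ (e' ∘ G ∘ e.symm) y (v i)) : E))
  rw [funext fun i => k5 (v i), hpt]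

/-! ### Polarized potentials in charts -/

variable {κ : TwoForm E M} {U : Set M} {u : M → ℝ} {uC : M → M → ℂ}

/-- The part of the target of a chart that corresponds to `U`. -/
def chartDomain (e : OpenPartialHomeomorph M E) (U : Set M) : Set E := e.target ∩ e.symm ⁻¹' U

lemma isOpen_chartDomain (e : OpenPartialHomeomorph M E) (hU : IsOpen U) :
    IsOpen (chartDomain e U) := e.isOpen_inter_preimage_symm hU

lemma mem_chartDomain {x : M} (hx : x ∈ e.source) (hU : x ∈ U) : e x ∈ chartDomain e U :=
  ⟨e.map_source hx, by simpa [e.left_inv hx] using hU⟩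

lemma IsPolarizedPotential.contMDiffAt (h : IsPolarizedPotential κ U u uC) (hU : IsOpen U) {p : M}
    (hp : p ∈ U) : ContMDiffAt 𝓘(ℝ, E) 𝓘(ℝ, ℝ) ∞ u p :=
  (h.analytic.contMDiffAt (hU.mem_nhds hp)).of_le le_top

/-- Two charts are allowed because in `pullback_perturb` the points `G q` and `q` are each read in
their own preferred chart. -/
lemma IsPolarizedPotential.isSesqui (h : IsPolarizedPotential κ U u uC) (hU : IsOpen U)
    (he : e ∈ atlas E M) (he' : e' ∈ atlas E M) :
    IsSesqui (fun p => uC (e.symm p.1) (e'.symm p.2)) (chartDomain e U ×ˢ chartDomain e' U) := by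
  have hopen : IsOpen (chartDomain e U ×ˢ chartDomain e' U) :=
    (isOpen_chartDomain e hU).prod (isOpen_chartDomain e' hU)
  have hs : ∀ p ∈ chartDomain e U ×ˢ chartDomain e' U,
      ContDiffAt ℝ ∞ (fun p : E × E => uC (e.symm p.1) (e'.symm p.2)) p := by
    intro p hp
    have h1 : ContMDiffAt (𝓘(ℝ, E).prod 𝓘(ℝ, E)) 𝓘(ℝ, ℂ) ∞ (fun p : M × M => uC p.1 p.2)
        (e.symm p.1, e'.symm p.2) :=
      h.smooth.contMDiffAt ((hU.prod hU).mem_nhds ⟨hp.1.2, hp.2.2⟩)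
    have h2 : ContMDiffAt 𝓘(ℝ, E × E) (𝓘(ℝ, E).prod 𝓘(ℝ, E)) ∞
        (fun p : E × E => (e.symm p.1, e'.symm p.2)) p := by
      refine ContMDiffAt.prodMk ?_ ?_
      · exact ContMDiffAt.comp p ((contMDiffAt_chart_symm (𝕜 := ℝ) he hp.1.1).of_le le_top)
          contDiffAt_fst.contMDiffAt
      · exact ContMDiffAt.comp p ((contMDiffAt_chart_symm (𝕜 := ℝ) he' hp.2.1).of_le le_top)
          contDiffAt_snd.contMDiffAt
    exact contMDiffAt_iff_contDiffAt.1 (ContMDiffAt.comp p h1 h2)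
  refine ⟨fun p hp => (hs p hp).contDiffWithinAt, fun p hp v => ?_, fun p hp v => ?_⟩
  · have hd := ((hs p hp).differentiableAt (by simp)).hasFDerivAt
    have h1 := HasFDerivAt.comp p.1 (f := fun z : E => (z, p.2)) hd (hasFDerivAt_prodMk_left p.1 p.2)
    have h2 : DifferentiableAt ℂ ((fun z => uC z (e'.symm p.2)) ∘ e.symm) p.1 :=
      differentiableAt_comp_symm he hp.1.1
        ((h.holo _ hp.2.2).mdifferentiableAt (hU.mem_nhds hp.1.2))
    have h3 : fderiv ℝ ((fun z => uC z (e'.symm p.2)) ∘ e.symm) p.1 = _ := h1.fderiv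
    rw [h2.fderiv_restrictScalars ℝ] at h3
    have h4 (w : E) := congrArg (fun L => L w) h3
    simp only [ContinuousLinearMap.coe_restrictScalars', ContinuousLinearMap.comp_apply,
      ContinuousLinearMap.inl_apply] at h4
    rw [← h4 v, ← h4 (J v)]
    simp
  · have hd := ((hs p hp).differentiableAt (by simp)).hasFDerivAt
    have h1 := Complex.conjCLE.hasFDerivAt.comp p.2 (HasFDerivAt.comp p.2
      (f := fun z : E => (p.1, z)) hd (hasFDerivAt_prodMk_right p.1 p.2))
    have h2 : DifferentiableAt ℂ ((fun w => starRingEnd ℂ (uC (e.symm p.1) w)) ∘ e'.symm) p.2 :=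
      differentiableAt_comp_symm he' hp.2.1
        ((h.antiholo _ hp.1.2).mdifferentiableAt (hU.mem_nhds hp.2.2))
    have h3 : fderiv ℝ ((fun w => starRingEnd ℂ (uC (e.symm p.1) w)) ∘ e'.symm) p.2 = _ := h1.fderiv
    rw [h2.fderiv_restrictScalars ℝ] at h3
    have h4 (w : E) := congrArg (fun L => starRingEnd ℂ (L w)) h3
    simp only [ContinuousLinearMap.coe_restrictScalars', ContinuousLinearMap.comp_apply,
      ContinuousLinearMap.inr_apply, ContinuousLinearEquiv.coe_coe, Complex.conjCLE_apply,
      Complex.conj_conj] at h4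
    rw [← h4 v, ← h4 (J v)]
    simp

end Manifold

/-! ### Exterior powers of 2-forms -/

section Wedge

variable {E : Type*} [NormedAddCommGroup E] [NormedSpace ℂ E]

/-- The multilinear map `v ↦ ∏ᵢ α (v (i, 0), v (i, 1))`. -/
def prodMultilinear (α : E [⋀^Fin 2]→L[ℝ] ℝ) (k : ℕ) :
    MultilinearMap ℝ (fun _ : Fin k × Fin 2 => E) ℝ where
  toFun v := ∏ i, α (fun j => v (i, j))
  map_update_add' := by
    classical
    intro _ v m x y
    obtain ⟨i₀, j₀⟩ := m
    have key (z : E) : ∏ i, α (fun j => Function.update v (i₀, j₀) z (i, j)) =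
        α (Function.update (fun j => v (i₀, j)) j₀ z) *
          ∏ i ∈ Finset.univ.erase i₀, α (fun j => v (i, j)) := by
      rw [← Finset.mul_prod_erase _ _ (Finset.mem_univ i₀)]
      congr 1
      · congr 1; ext j; simp [Function.update_apply]
      · refine Finset.prod_congr rfl fun i hi => ?_
        congr 1; ext j
        simp [Finset.ne_of_mem_erase hi]
    convert_to ∏ i, α (fun j => Function.update v (i₀, j₀) (x + y) (i, j)) =
      ∏ i, α (fun j => Function.update v (i₀, j₀) x (i, j)) +
        ∏ i, α (fun j => Function.update v (i₀, j₀) y (i, j))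
    rw [key, key, key, α.map_update_add, add_mul]
  map_update_smul' := by
    classical
    intro _ v m c x
    obtain ⟨i₀, j₀⟩ := m
    have key (z : E) : ∏ i, α (fun j => Function.update v (i₀, j₀) z (i, j)) =
        α (Function.update (fun j => v (i₀, j)) j₀ z) *
          ∏ i ∈ Finset.univ.erase i₀, α (fun j => v (i, j)) := by
      rw [← Finset.mul_prod_erase _ _ (Finset.mem_univ i₀)]
      congr 1
      · congr 1; ext j; simp [Function.update_apply]
      · refine Finset.prod_congr rfl fun i hi => ?_
        congr 1; ext j
        simp [Finset.ne_of_mem_erase hi]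
    convert_to ∏ i, α (fun j => Function.update v (i₀, j₀) (c • x) (i, j)) =
      c • ∏ i, α (fun j => Function.update v (i₀, j₀) x (i, j))
    rw [key, key, α.map_update_smul, smul_mul_assoc]

lemma wedgePow_eq (α : E [⋀^Fin 2]→L[ℝ] ℝ) (k : ℕ) (v : Fin k × Fin 2 → E) :
    wedgePow α k v = (2 ^ k : ℝ)⁻¹ * MultilinearMap.alternatization (prodMultilinear α k) v := by
  rw [wedgePow, MultilinearMap.alternatization_apply]
  congr 1
  refine Finset.sum_congr rfl fun σ _ => ?_
  rw [Units.smul_def, zsmul_eq_mul]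
  congr 1
  refine Finset.prod_congr rfl fun i _ => ?_
  congr 1
  ext j
  fin_cases j <;> rfl

variable [FiniteDimensional ℂ E]

/-- The top power is an alternating map in as many vectors as the real dimension, hence a multiple
of the determinant with respect to `realBasis E`, and composing with `L` multiplies that determinant
by `det L`. -/
lemma wedgePow_compContinuousLinearMap (α : E [⋀^Fin 2]→L[ℝ] ℝ) (L : E →L[ℝ] E) :
    wedgePow (α.compContinuousLinearMap L) (Module.finrank ℂ E) (realBasis E) =
      L.det * wedgePow α (Module.finrank ℂ E) (realBasis E) := by
  have h1 : wedgePow (α.compContinuousLinearMap L) (Module.finrank ℂ E) (realBasis E) =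
      wedgePow α (Module.finrank ℂ E) (L ∘ realBasis E) := by
    unfold wedgePow
    congr 1
    refine Finset.sum_congr rfl fun σ _ => ?_
    congr 1
    refine Finset.prod_congr rfl fun i _ => ?_
    rw [ContinuousAlternatingMap.compContinuousLinearMap_apply]
    congr 1
    ext j
    fin_cases j <;> rfl
  rw [h1, wedgePow_eq, wedgePow_eq,
    (MultilinearMap.alternatization (prodMultilinear α _)).eq_smul_basis_det (realBasis E)]
  have h2 := (realBasis E).det_comp (L : E →ₗ[ℝ] E) (realBasis E)
  simp only [AlternatingMap.smul_apply, (realBasis E).det_self] at h2 ⊢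
  rw [show (L ∘ realBasis E : _ → E) = ((L : E →ₗ[ℝ] E) ∘ realBasis E) from rfl, h2]
  simp [ContinuousLinearMap.det]; ring

end Wedge

/-! ### Monge–Ampère measures -/

section Measure

variable {E : Type*} [NormedAddCommGroup E] [NormedSpace ℂ E] [FiniteDimensional ℂ E]
  [MeasurableSpace E] [BorelSpace E]
  {M : Type*} [TopologicalSpace M] [MeasurableSpace M] [BorelSpace M] [ChartedSpace E M]

/-- The density of the top power of a 2-form in a chart. -/
def chartDensity (e : OpenPartialHomeomorph M E) (α : TwoForm E M) (y : E) : ℝ≥0∞ :=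
  ‖wedgePow (inChart e α y) (Module.finrank ℂ E) (realBasis E)‖ₑ

/-- The measure defined by the top power of a 2-form on the source of a chart. -/
def chartMeasure (e : OpenPartialHomeomorph M E) (α : TwoForm E M) : Measure M :=
  (((realBasis E).addHaar.withDensity (chartDensity e α)).restrict e.target).map e.symm

variable {e e' : OpenPartialHomeomorph M E} {α β : TwoForm E M}

/-- The inverse chart is continuous only on its target, so measurability is checked on the subtype.
-/
lemma measurableSet_chart (e : OpenPartialHomeomorph M E) {A : Set M} (hA : MeasurableSet A) :
    MeasurableSet (e.target ∩ e.symm ⁻¹' A) := by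
  have h : Measurable (e.target.domRestrict e.symm) :=
    (continuousOn_iff_continuous_domRestrict.1 e.continuousOn_symm).measurable
  have h2 := (MeasurableEmbedding.subtype_coe e.open_target.measurableSet).measurableSet_image.2
    (h hA)
  convert h2 using 1
  ext y
  exact ⟨fun h => ⟨⟨y, h.1⟩, h.2, rfl⟩, by rintro ⟨z, hz, rfl⟩; exact ⟨z.2, hz⟩⟩

lemma chartMeasure_apply {A : Set M} (hA : MeasurableSet A) :
    chartMeasure e α A = ∫⁻ y in e.target ∩ e.symm ⁻¹' A, chartDensity e α y
      ∂(realBasis E).addHaar := by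
  rw [chartMeasure, Measure.map_apply_of_aemeasurable
    (e.continuousOn_symm.aemeasurable e.open_target.measurableSet) hA,
    Measure.restrict_apply' e.open_target.measurableSet, inter_comm,
    withDensity_apply _ (measurableSet_chart e hA)]

lemma chartMeasure_inter_source {A : Set M} (hA : MeasurableSet A) :
    chartMeasure e α (A ∩ e.source) = chartMeasure e α A := by
  rw [chartMeasure_apply hA, chartMeasure_apply (hA.inter e.open_source.measurableSet)]
  congr 2
  ext y
  simp only [mem_inter_iff, mem_preimage]
  exact ⟨fun h => ⟨h.1, h.2.1⟩, fun h => ⟨h.1, h.2, e.map_target h.1⟩⟩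

variable [IsManifold 𝓘(ℂ, E) ω M]

/-- Change of variables for the local Monge–Ampère measures. -/
lemma chartMeasure_image (he : e ∈ atlas E M) (he' : e' ∈ atlas E M) (G : M ≃ₜ M)
    (hG : MDifferentiable 𝓘(ℝ, E) 𝓘(ℝ, E) G) (hαβ : pullback G α = β) {A : Set M}
    (hA : MeasurableSet A) (hAe : A ⊆ e.source) (hAe' : A ⊆ G ⁻¹' e'.source) :
    chartMeasure e' α (G '' A) = chartMeasure e β A := by
  have : FiniteDimensional ℝ E := FiniteDimensional.complexToReal E
  set f : E → E := e' ∘ G ∘ e.symm with hf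
  set s := e.target ∩ e.symm ⁻¹' A with hs
  have hsm : MeasurableSet s := measurableSet_chart e hA
  have hfs : f '' s = e'.target ∩ e'.symm ⁻¹' (G '' A) := by
    ext y
    constructor
    · rintro ⟨z, hz, rfl⟩
      refine ⟨e'.map_source (hAe' hz.2), ?_⟩
      refine ⟨e.symm z, hz.2, ?_⟩
      simp only [hf, Function.comp]
      rw [e'.left_inv (hAe' hz.2)]
    · rintro ⟨hy, x, hx, hxy⟩
      refine ⟨e x, ⟨e.map_source (hAe hx), by simpa [e.left_inv (hAe hx)] using hx⟩, ?_⟩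
      simp only [hf, Function.comp]
      rw [e.left_inv (hAe hx), hxy, e'.right_inv hy]
  have hinj : InjOn f s := by
    intro z hz w hw h
    have h1 : G (e.symm z) = G (e.symm w) := e'.injOn (hAe' hz.2) (hAe' hw.2) h
    exact e.symm.injOn hz.1 hw.1 (G.injective h1)
  have hder : ∀ y ∈ s, HasFDerivWithinAt f (fderiv ℝ f y) s y := by
    intro y hy
    have h1 : MDifferentiableAt 𝓘(ℝ, E) 𝓘(ℝ, E) (e' ∘ G) (e.symm y) :=
      MDifferentiableAt.comp _ ((contMDiffAt_chart (𝕜 := ℝ) he' (hAe' hy.2)).mdifferentiableAt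
        (by simp)) (hG _)
    exact (differentiableAt_comp_symm (𝕜 := ℝ) he hy.1 h1).hasFDerivAt.hasFDerivWithinAt
  rw [chartMeasure_apply hA, chartMeasure_apply (G.measurableEmbedding.measurableSet_image.2 hA),
    ← hfs, lintegral_image_eq_lintegral_abs_det_fderiv_mul _ hsm hder hinj]
  refine setLIntegral_congr_fun hsm fun y hy => ?_
  simp only [chartDensity]
  -- The Jacobian in the change of variables is the absolute value of the determinant by which the
  -- top power transforms.
  rw [← hαβ, inChart_pullback he he' hy.1 (hG _) (hAe' hy.2), wedgePow_compContinuousLinearMap,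
    enorm_mul, ← Real.enorm_abs (ContinuousLinearMap.det _), Real.enorm_of_nonneg (abs_nonneg _)]
  rfl

/-- A change of charts is a change of variables for the identity map. -/
lemma chartMeasure_congr_chart (he : e ∈ atlas E M) (he' : e' ∈ atlas E M) {A : Set M}
    (hA : MeasurableSet A) (hAe : A ⊆ e.source) (hAe' : A ⊆ e'.source) :
    chartMeasure e' α A = chartMeasure e α A := by
  have h := chartMeasure_image (α := α) he he' (Homeomorph.refl M) mdifferentiable_id
    (pullback_id α) hA hAe hAe'
  simpa using h

/-- The supremum is at least each local measure. Conversely, the local measures agree on overlaps,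
so none of them puts more mass on `e.source` than the measure of `e` does, and neither does the
supremum. -/
lemma topMeasure_restrict (he : e ∈ atlas E M) :
    (topMeasure α).restrict e.source = chartMeasure e α := by
  have hS := e.open_source.measurableSet
  have hle : ∀ e' ∈ atlas E M, chartMeasure e' α ≤ topMeasure α := fun e' he' =>
    le_iSup₂ (f := fun (e : OpenPartialHomeomorph M E) (_ : e ∈ atlas E M) => chartMeasure e α) e' he'
  have hres : (chartMeasure e α).restrict e.source = chartMeasure e α := by
    ext A hA
    rw [Measure.restrict_apply hA, chartMeasure_inter_source hA]
  -- To bound the supremum it is enough to exhibit one measure dominating all local ones. Inside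
  -- `e.source` this is the local measure of `e`, outside it is the supremum itself.
  have hub : topMeasure α ≤ chartMeasure e α + (topMeasure α).restrict e.sourceᶜ := by
    refine iSup₂_le fun e' he' => Measure.le_iff.2 fun A hA => ?_
    change chartMeasure e' α A ≤ _
    rw [← measure_inter_add_sdiff A hS, Measure.add_apply, Measure.restrict_apply hA]
    refine add_le_add ?_ ?_
    · rw [← chartMeasure_inter_source (hA.inter hS), chartMeasure_congr_chart he he'
        ((hA.inter hS).inter e'.open_source.measurableSet)
        (inter_subset_left.trans inter_subset_right) inter_subset_right]
      exact measure_mono (inter_subset_left.trans inter_subset_left)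
    · rw [← sdiff_eq]
      exact hle e' he' _
  refine le_antisymm ?_ ?_
  · refine (Measure.restrict_mono le_rfl hub).trans ?_
    rw [Measure.restrict_add, hres, Measure.restrict_restrict hS, inter_compl_self,
      Measure.restrict_empty, add_zero]
  · rw [← hres]
    exact Measure.restrict_mono le_rfl (hle e he)

lemma topMeasure_apply_of_subset (he : e ∈ atlas E M) {A : Set M} (hA : MeasurableSet A)
    (hAe : A ⊆ e.source) : topMeasure α A = chartMeasure e α A := by
  rw [← topMeasure_restrict he, Measure.restrict_apply hA, inter_eq_left.2 hAe]

/-- If `G` pulls `α` back to `β`, it pulls the measure of `αⁿ` back to the measure of `βⁿ`. -/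
theorem topMeasure_comap [CompactSpace M] (G : M ≃ₜ M)
    (hG : MDifferentiable 𝓘(ℝ, E) 𝓘(ℝ, E) G) (hαβ : pullback G α = β) :
    (topMeasure α).comap G = topMeasure β := by
  let S : M → Set M := fun x => (chartAt E x).source ∩ G ⁻¹' (chartAt E (G x)).source
  have hSo : ∀ x, IsOpen (S x) := fun x =>
    (chartAt E x).open_source.inter ((chartAt E (G x)).open_source.preimage G.continuous)
  -- Measures can be compared on the members of a countable cover, and compactness supplies a finite
  -- one whose members each lie in a chart together with their image.
  obtain ⟨t, ht⟩ := isCompact_univ.elim_finite_subcover S hSo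
    (fun x _ => mem_iUnion.2 ⟨x, mem_chart_source E x, mem_chart_source E (G x)⟩)
  have hcov : ⋃ x : t, S x = univ := by
    refine eq_univ_of_univ_subset (ht.trans ?_)
    intro y hy
    simp only [mem_iUnion] at hy ⊢
    obtain ⟨x, hx, hy⟩ := hy
    exact ⟨⟨x, hx⟩, hy⟩
  refine (Measure.ext_iff_of_iUnion_eq_univ hcov).2 fun x => ?_
  ext A hA
  have hAS : MeasurableSet (A ∩ S x) := hA.inter (hSo x).measurableSet
  rw [Measure.restrict_apply hA, Measure.restrict_apply hA, G.measurableEmbedding.comap_apply,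
    topMeasure_apply_of_subset (chart_mem_atlas E (G x))
      (G.measurableEmbedding.measurableSet_image.2 hAS)
      (image_subset_iff.2 (inter_subset_right.trans inter_subset_right)),
    topMeasure_apply_of_subset (chart_mem_atlas E (x : M)) hAS
      (inter_subset_right.trans inter_subset_left)]
  exact chartMeasure_image (chart_mem_atlas E _) (chart_mem_atlas E _) G hG hαβ hAS
    (inter_subset_right.trans inter_subset_left) (inter_subset_right.trans inter_subset_right)

end Measure

/-! ### Positive forms and convexity in a vector space -/

section Flat

variable {E : Type*} [NormedAddCommGroup E] [NormedSpace ℂ E]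

/-- The function `v ↦ α (v, Jv)` is homogeneous of degree 2 and attains a positive minimum on the
compact unit sphere. -/
lemma exists_pos_le_form [FiniteDimensional ℂ E] (α : E [⋀^Fin 2]→L[ℝ] ℝ)
    (h : ∀ v, v ≠ 0 → 0 < α ![v, J v]) : ∃ c > 0, ∀ v, c * ‖v‖ ^ 2 ≤ α ![v, J v] := by
  have : FiniteDimensional ℝ E := FiniteDimensional.complexToReal E
  have : ProperSpace E := FiniteDimensional.proper ℝ E
  have hcont : Continuous fun v : E => α ![v, J v] := by
    refine α.cont.comp (continuous_pi fun i => ?_)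
    fin_cases i
    · exact continuous_id
    · exact J.continuous
  have hhom (t : ℝ) (v : E) : α ![t • v, J (t • v)] = t ^ 2 * α ![v, J v] := by
    have h1 := α.map_smul_univ (fun _ => t) ![v, J v]
    have h2 : (fun i => (fun _ : Fin 2 => t) i • (![v, J v] : Fin 2 → E) i) =
        ![t • v, J (t • v)] := by
      ext i
      fin_cases i
      · rfl
      · exact (J.map_smul t v).symm
    rw [h2] at h1
    simpa using h1
  obtain ⟨c, hc, hcs⟩ : ∃ c > 0, ∀ v ∈ Metric.sphere (0 : E) 1, c ≤ α ![v, J v] := by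
    rcases (Metric.sphere (0 : E) 1).eq_empty_or_nonempty with he | hne
    · exact ⟨1, one_pos, by simp [he]⟩
    · obtain ⟨v, hv, hmin⟩ := (isCompact_sphere (0 : E) 1).exists_isMinOn hne hcont.continuousOn
      refine ⟨_, h v ?_, fun w hw => hmin hw⟩
      rintro rfl
      simp at hv
  refine ⟨c, hc, fun v => ?_⟩
  rcases eq_or_ne v 0 with rfl | hv
  · have := hhom 0 0
    simp at this
    simp [this]
  · have hn : ‖v‖ ≠ 0 := norm_ne_zero_iff.2 hv
    have h1 := hcs (‖v‖⁻¹ • v) (by simp [norm_smul, hn])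
    have h2 := hhom ‖v‖ (‖v‖⁻¹ • v)
    rw [smul_smul, mul_inv_cancel₀ hn, one_smul] at h2
    rw [h2, mul_comm]
    gcongr

lemma lt_of_fderiv_pos {g : E → ℝ} {a b : E}
    (hd : ∀ t ∈ Icc (0 : ℝ) 1, DifferentiableAt ℝ g (a + t • (b - a)))
    (hpos : ∀ t ∈ Ioo (0 : ℝ) 1, 0 < fderiv ℝ g (a + t • (b - a)) (b - a)) : g a < g b := by
  have hl (t : ℝ) : HasDerivAt (fun t : ℝ => a + t • (b - a)) (b - a) t := by
    simpa using ((hasDerivAt_id t).smul_const (b - a)).const_add a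
  have hder (t : ℝ) (ht : t ∈ Icc (0 : ℝ) 1) : HasDerivAt (fun t : ℝ => g (a + t • (b - a)))
      (fderiv ℝ g (a + t • (b - a)) (b - a)) t :=
    (hd t ht).hasFDerivAt.comp_hasDerivAt t (hl t)
  have hmono : StrictMonoOn (fun t : ℝ => g (a + t • (b - a))) (Icc 0 1) := by
    refine strictMonoOn_of_deriv_pos (convex_Icc 0 1)
      (fun t ht => (hder t ht).continuousAt.continuousWithinAt) fun t ht => ?_
    rw [interior_Icc] at ht
    rw [(hder t (Ioo_subset_Icc_self ht)).deriv]
    exact hpos t ht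
  simpa using hmono (by simp) (by simp) one_pos

lemma segment_mem {B : Set E} (hB : Convex ℝ B) {a b : E} (ha : a ∈ B) (hb : b ∈ B) {t : ℝ}
    (ht : t ∈ Icc (0 : ℝ) 1) : a + t • (b - a) ∈ B :=
  hB.add_smul_sub_mem ha hb ht

/-! ### Families of convex functions -/

section Convex

variable {B : Set E} {f : E × E → ℝ}

lemma hasFDerivAt_partial_left {y y' : E} (hf : ContDiffAt ℝ 2 f (y, y')) (η : E × E) :
    HasFDerivAt (fun z => fderiv ℝ f (z, y') η)
      ((fderiv ℝ (fderiv ℝ f) (y, y')).flip η ∘L ContinuousLinearMap.inl ℝ E E) y := by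
  have h1 := (differentiableAt_fderiv_of_contDiffAt hf).hasFDerivAt
  have h2 : HasFDerivAt (fun p => fderiv ℝ f p η) ((fderiv ℝ (fderiv ℝ f) (y, y')).flip η) (y, y') := by
    refine (h1.clm_apply (hasFDerivAt_const η (y, y'))).congr_fderiv ?_
    ext <;> simp
  exact HasFDerivAt.comp y (f := fun z : E => (z, y')) h2 (hasFDerivAt_prodMk_left y y')

lemma hasFDerivAt_partial_right {y y' : E} (hf : ContDiffAt ℝ 2 f (y, y')) (η : E × E) :
    HasFDerivAt (fun z => fderiv ℝ f (y, z) η)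
      ((fderiv ℝ (fderiv ℝ f) (y, y')).flip η ∘L ContinuousLinearMap.inr ℝ E E) y' := by
  have h1 := (differentiableAt_fderiv_of_contDiffAt hf).hasFDerivAt
  have h2 : HasFDerivAt (fun p => fderiv ℝ f p η) ((fderiv ℝ (fderiv ℝ f) (y, y')).flip η) (y, y') := by
    refine (h1.clm_apply (hasFDerivAt_const η (y, y'))).congr_fderiv ?_
    ext <;> simp
  exact HasFDerivAt.comp y' (f := fun z : E => (y, z)) h2 (hasFDerivAt_prodMk_right y y')

/-- The gradient of a strictly convex function is strictly monotone: along the segment from `a` to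
`b` its component in the direction `b - a` has positive derivative. -/
lemma partial_lt_of_ne (hB : Convex ℝ B) (hf : ∀ p ∈ B ×ˢ B, ContDiffAt ℝ 2 f p)
    (hpos : ∀ p ∈ B ×ˢ B, ∀ v : E, v ≠ 0 → 0 < fderiv ℝ (fderiv ℝ f) p (v, 0) (v, 0))
    {a b w : E} (ha : a ∈ B) (hb : b ∈ B) (hw : w ∈ B) (hab : a ≠ b) :
    fderiv ℝ f (a, w) (b - a, 0) < fderiv ℝ f (b, w) (b - a, 0) := by
  refine lt_of_fderiv_pos (g := fun z => fderiv ℝ f (z, w) (b - a, 0)) (fun t ht => ?_)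
    fun t ht => ?_
  · exact (hasFDerivAt_partial_left (hf (_, w) ⟨segment_mem hB ha hb ht, hw⟩) _).differentiableAt
  · have hm := segment_mem hB ha hb (Ioo_subset_Icc_self ht)
    rw [(hasFDerivAt_partial_left (hf (_, w) ⟨hm, hw⟩) _).fderiv]
    simpa using hpos (_, w) ⟨hm, hw⟩ (b - a) (sub_ne_zero.2 hab.symm)

/-- Two critical points of a strictly convex function coincide. -/
lemma eq_of_partial_eq_zero (hB : Convex ℝ B) (hf : ∀ p ∈ B ×ˢ B, ContDiffAt ℝ 2 f p)
    (hpos : ∀ p ∈ B ×ˢ B, ∀ v : E, v ≠ 0 → 0 < fderiv ℝ (fderiv ℝ f) p (v, 0) (v, 0))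
    {a b w : E} (ha : a ∈ B) (hb : b ∈ B) (hw : w ∈ B) (ha0 : ∀ v, fderiv ℝ f (a, w) (v, 0) = 0)
    (hb0 : ∀ v, fderiv ℝ f (b, w) (v, 0) = 0) : a = b := by
  by_contra hab
  have := partial_lt_of_ne hB hf hpos ha hb hw hab
  rw [ha0, hb0] at this
  exact lt_irrefl _ this

/-- Nondegeneracy of the mixed second derivatives: the parameter is determined by the critical
point. -/
lemma eq_of_partial_eq (hB : Convex ℝ B) (hf : ∀ p ∈ B ×ˢ B, ContDiffAt ℝ 2 f p)
    (hneg : ∀ p ∈ B ×ˢ B, ∀ v : E, v ≠ 0 → fderiv ℝ (fderiv ℝ f) p (v, 0) (0, v) < 0)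
    {a b w : E} (ha : a ∈ B) (hb : b ∈ B) (hw : w ∈ B)
    (h : ∀ v, fderiv ℝ f (w, a) (v, 0) = fderiv ℝ f (w, b) (v, 0)) : a = b := by
  by_contra hab
  -- The direction of the first derivative is taken to be `b - a`, the displacement of the
  -- parameter, so that only the values `(v, 0), (0, v)` of the mixed derivative enter.
  have := lt_of_fderiv_pos (g := fun z => -fderiv ℝ f (w, z) (b - a, 0)) (a := a) (b := b)
    (fun t ht => ?_) fun t ht => ?_
  · simp only [h] at this
    exact lt_irrefl _ this
  · exact (hasFDerivAt_partial_right (hf (w, _) ⟨hw, segment_mem hB ha hb ht⟩) _).neg.differentiableAt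
  · have hm := segment_mem hB ha hb (Ioo_subset_Icc_self ht)
    have e : fderiv ℝ (fun z => -fderiv ℝ f (w, z) (b - a, 0)) (a + t • (b - a)) = _ :=
      (hasFDerivAt_partial_right (hf (w, _) ⟨hw, hm⟩) _).neg.fderiv
    rw [e]
    have h2 := hneg (w, _) ⟨hw, hm⟩ (b - a) (sub_ne_zero.2 (Ne.symm hab))
    have h3 := ((hf (w, _) ⟨hw, hm⟩).isSymmSndFDerivAt minSmoothness_real_two)
      (b - a, 0) (0, b - a)
    rw [h3] at h2
    simpa using h2

/-- The gradient of `f (·, a)` vanishes at `a` and is strictly monotone, so `f (·, a)` increases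
strictly along every segment starting at `a`. -/
lemma pos_of_convex (hB : Convex ℝ B) (hf : ∀ p ∈ B ×ˢ B, ContDiffAt ℝ 2 f p)
    (hpos : ∀ p ∈ B ×ˢ B, ∀ v : E, v ≠ 0 → 0 < fderiv ℝ (fderiv ℝ f) p (v, 0) (v, 0))
    {a b : E} (ha : a ∈ B) (hb : b ∈ B) (h0 : f (a, a) = 0) (h1 : ∀ v, fderiv ℝ f (a, a) (v, 0) = 0)
    (hab : a ≠ b) : 0 < f (b, a) := by
  have hd : ∀ z ∈ B, HasFDerivAt (fun z => f (z, a)) (fderiv ℝ f (z, a) ∘L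
      ContinuousLinearMap.inl ℝ E E) z := fun z hz =>
    HasFDerivAt.comp z (f := fun z : E => (z, a))
      ((hf (z, a) ⟨hz, ha⟩).differentiableAt (by simp)).hasFDerivAt (hasFDerivAt_prodMk_left z a)
  have := lt_of_fderiv_pos (g := fun z => f (z, a)) (a := a) (b := b)
    (fun t ht => (hd _ (segment_mem hB ha hb ht)).differentiableAt) fun t ht => ?_
  · simpa [h0] using this
  · have hm := segment_mem hB ha hb (Ioo_subset_Icc_self ht)
    rw [(hd _ hm).fderiv]
    have hne : a ≠ a + t • (b - a) := by
      intro h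
      have h2 : t • (b - a) = 0 := by simpa using h
      rcases smul_eq_zero.1 h2 with h3 | h3
      · exact ht.1.ne' h3
      · exact hab (sub_eq_zero.1 h3).symm
    have h3 := partial_lt_of_ne hB hf hpos ha hm ha hne
    rw [h1] at h3
    -- Monotonicity is known in the direction `t (b - a)`; the factor `t > 0` is divided out.
    have h4 : ((a + t • (b - a) - a, 0) : E × E) = t • (b - a, 0) := by simp
    rw [h4, map_smul, smul_eq_mul] at h3
    simpa using pos_of_mul_pos_right h3 ht.1.le

end Convex

lemma fderiv_fderiv_comp {f : E → ℝ} {τ : E → E} {y : E} (hf : ContDiffAt ℝ 2 f (τ y))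
    (hτ : ContDiffAt ℝ 2 τ y) (v w : E) :
    fderiv ℝ (fderiv ℝ (f ∘ τ)) y v w =
      fderiv ℝ (fderiv ℝ f) (τ y) (fderiv ℝ τ y v) (fderiv ℝ τ y w) +
        fderiv ℝ f (τ y) (fderiv ℝ (fderiv ℝ τ) y v w) := by
  have e : fderiv ℝ (f ∘ τ) =ᶠ[𝓝 y] fun z => (fderiv ℝ f (τ z)).comp (fderiv ℝ τ z) := by
    filter_upwards [hτ.continuousAt.eventually (hf.eventually (by simp)),
      hτ.eventually (by simp)] with z hz hz'
    exact fderiv_comp z (hz.differentiableAt (by simp)) (hz'.differentiableAt (by simp))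
  have h1 : HasFDerivAt (fun z => fderiv ℝ f (τ z))
      (fderiv ℝ (fderiv ℝ f) (τ y) ∘L fderiv ℝ τ y) y :=
    (differentiableAt_fderiv_of_contDiffAt hf).hasFDerivAt.comp y
      (hτ.differentiableAt (by simp)).hasFDerivAt
  have h2 := h1.clm_comp (differentiableAt_fderiv_of_contDiffAt hτ).hasFDerivAt
  rw [e.fderiv_eq, h2.fderiv]
  simp [add_comm]

/-- Under a change of coordinates the second derivative picks up the first derivative of `f` applied
to the second derivative of `τ`, so smallness of both orders is needed. -/
lemma abs_fderiv_fderiv_comp_le {f : E → ℝ} {τ : E → E} {y : E} (hf : ContDiffAt ℝ 2 f (τ y))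
    (hτ : ContDiffAt ℝ 2 τ y) {ε K : ℝ} (hε : 0 ≤ ε) (h1 : ‖iteratedFDeriv ℝ 1 f (τ y)‖ ≤ ε)
    (h2 : ‖iteratedFDeriv ℝ 2 f (τ y)‖ ≤ ε)
    (hK : ‖fderiv ℝ τ y‖ ^ 2 + ‖fderiv ℝ (fderiv ℝ τ) y‖ ≤ K) (v : E) :
    |fderiv ℝ (fderiv ℝ (f ∘ τ)) y v v| ≤ K * ε * ‖v‖ ^ 2 := by
  rw [norm_iteratedFDeriv_one] at h1
  rw [← norm_iteratedFDeriv_fderiv, norm_iteratedFDeriv_one] at h2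
  rw [fderiv_fderiv_comp hf hτ]
  have a1 : ‖fderiv ℝ (fderiv ℝ f) (τ y) (fderiv ℝ τ y v) (fderiv ℝ τ y v)‖ ≤
      ε * (‖fderiv ℝ τ y‖ * ‖v‖) * (‖fderiv ℝ τ y‖ * ‖v‖) := by
    refine (ContinuousLinearMap.le_opNorm₂ _ _ _).trans ?_
    gcongr
    · exact ContinuousLinearMap.le_opNorm _ _
    · exact ContinuousLinearMap.le_opNorm _ _
  have a2 : ‖fderiv ℝ f (τ y) (fderiv ℝ (fderiv ℝ τ) y v v)‖ ≤
      ε * (‖fderiv ℝ (fderiv ℝ τ) y‖ * ‖v‖ * ‖v‖) := by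
    refine (ContinuousLinearMap.le_opNorm _ _).trans ?_
    gcongr
    exact ContinuousLinearMap.le_opNorm₂ _ _ _
  calc _ ≤ ε * (‖fderiv ℝ τ y‖ * ‖v‖) * (‖fderiv ℝ τ y‖ * ‖v‖) +
        ε * (‖fderiv ℝ (fderiv ℝ τ) y‖ * ‖v‖ * ‖v‖) := (norm_add_le _ _).trans (add_le_add a1 a2)
    _ = (‖fderiv ℝ τ y‖ ^ 2 + ‖fderiv ℝ (fderiv ℝ τ) y‖) * ε * ‖v‖ ^ 2 := by ring
    _ ≤ K * ε * ‖v‖ ^ 2 := by gcongr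

end Flat

/-! ### Consequences of a small `C²` norm -/

section Manifold

variable {E : Type*} [NormedAddCommGroup E] [NormedSpace ℂ E]
  {M : Type*} [TopologicalSpace M] [ChartedSpace E M]

lemma norm_iteratedFDeriv_lt_of_c2Norm_lt {𝒜 : FiniteAtlas E M} {ψ : M → ℝ} {ε : ℝ}
    (h : c2Norm 𝒜 ψ < ENNReal.ofReal ε) {i : Fin 𝒜.size} {x : M} (hx : x ∈ 𝒜.piece i) (j : Fin 3) :
    ‖iteratedFDeriv ℝ (j : ℕ) (ψ ∘ (𝒜.chart i).symm) (𝒜.chart i x)‖ < ε := by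
  have h1 : ‖iteratedFDeriv ℝ (j : ℕ) (ψ ∘ (𝒜.chart i).symm) (𝒜.chart i x)‖ₑ ≤ c2Norm 𝒜 ψ :=
    le_iSup_of_le i (le_iSup_of_le x (le_iSup_of_le hx (le_iSup
      (fun j : Fin 3 => ‖iteratedFDeriv ℝ (j : ℕ) (ψ ∘ (𝒜.chart i).symm) (𝒜.chart i x)‖ₑ) j)))
  have h2 := h1.trans_lt h
  rw [← ofReal_norm, ENNReal.ofReal_lt_ofReal_iff'] at h2
  exact h2.1

lemma abs_lt_of_c2Norm_lt {𝒜 : FiniteAtlas E M} {ψ : M → ℝ} {ε : ℝ}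
    (h : c2Norm 𝒜 ψ < ENNReal.ofReal ε) (x : M) : |ψ x| < ε := by
  obtain ⟨i, hi⟩ : ∃ i, x ∈ 𝒜.piece i := by
    have : x ∈ ⋃ i, 𝒜.piece i := by rw [𝒜.cover]; trivial
    simpa using this
  have := norm_iteratedFDeriv_lt_of_c2Norm_lt h hi 0
  simpa [(𝒜.chart i).left_inv (𝒜.piece_subset i hi)] using this

variable [IsManifold 𝓘(ℂ, E) ω M] [T2Space M]

/-- The `C²` norm controls the second derivatives in the preferred charts. -/
lemma exists_abs_fderiv_fderiv_le (𝒜 : FiniteAtlas E M) (x : M) :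
    ∃ K > 0, ∀ᶠ y in 𝓝 (chartAt E x x), ∀ (ψ : M → ℝ) (ε : ℝ), 0 ≤ ε →
      ContMDiff 𝓘(ℝ, E) 𝓘(ℝ, ℝ) ∞ ψ → c2Norm 𝒜 ψ < ENNReal.ofReal ε →
        ∀ v, |fderiv ℝ (fderiv ℝ (ψ ∘ (chartAt E x).symm)) y v v| ≤ K * ε * ‖v‖ ^ 2 := by
  set e := chartAt E x with he
  have hem : e ∈ atlas E M := chart_mem_atlas E x
  have hxs : x ∈ e.source := mem_chart_source E x
  have hcont : ContinuousAt e.symm (e x) := e.continuousAt_symm (e.map_source hxs)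
  -- If `x` lies in the piece `j`, continuity bounds the first two derivatives of the transition map
  -- near `x`. Otherwise the piece, being closed, misses a neighbourhood of `x`, and any constant
  -- will do. The sum over `j` of these constants serves all pieces at once.
  have key : ∀ j, ∃ K : ℝ, 0 < K ∧ ∀ᶠ y in 𝓝 (e x), e.symm y ∈ 𝒜.piece j →
      ‖fderiv ℝ (𝒜.chart j ∘ e.symm) y‖ ^ 2 +
        ‖fderiv ℝ (fderiv ℝ (𝒜.chart j ∘ e.symm)) y‖ ≤ K := by
    intro j
    by_cases hj : x ∈ 𝒜.piece j
    · have hτ : ContDiffAt ℝ ω (𝒜.chart j ∘ e.symm) (e x) :=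
        contDiffAt_transition hem (𝒜.chart_mem j) (e.map_source hxs)
          (by rw [e.left_inv hxs]; exact 𝒜.piece_subset j hj)
      have h1 : ContinuousAt (fderiv ℝ (𝒜.chart j ∘ e.symm)) (e x) :=
        (hτ.fderiv_right (m := ω) (by simp)).continuousAt
      have h2 : ContinuousAt (fderiv ℝ (fderiv ℝ (𝒜.chart j ∘ e.symm))) (e x) :=
        ((hτ.fderiv_right (m := ω) (by simp)).fderiv_right (m := ω) (by simp)).continuousAt
      have h3 := (h1.norm.pow 2).add h2.norm
      refine ⟨‖fderiv ℝ (𝒜.chart j ∘ e.symm) (e x)‖ ^ 2 +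
        ‖fderiv ℝ (fderiv ℝ (𝒜.chart j ∘ e.symm)) (e x)‖ + 1, by positivity, ?_⟩
      filter_upwards [h3.eventually (gt_mem_nhds (lt_add_one _))] with y hy _
      exact hy.le
    · refine ⟨1, one_pos, ?_⟩
      have : ∀ᶠ z in 𝓝 (e.symm (e x)), z ∉ 𝒜.piece j :=
        (𝒜.piece_compact j).isClosed.isOpen_compl.mem_nhds (by rwa [e.left_inv hxs])
      filter_upwards [hcont.eventually this] with y hy hy'
      exact absurd hy' hy
  choose K hK0 hK using key
  refine ⟨∑ j, K j + 1, by have := Finset.sum_nonneg (fun j (_ : j ∈ Finset.univ) => (hK0 j).le); positivity, ?_⟩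
  filter_upwards [eventually_all.2 hK, e.open_target.mem_nhds (e.map_source hxs)]
    with y hy hyt ψ ε hε hψ hc v
  obtain ⟨j, hj⟩ : ∃ j, e.symm y ∈ 𝒜.piece j := by
    have : e.symm y ∈ ⋃ i, 𝒜.piece i := by rw [𝒜.cover]; trivial
    simpa using this
  have hjs := 𝒜.piece_subset j hj
  have e1 : ψ ∘ e.symm =ᶠ[𝓝 y] (ψ ∘ (𝒜.chart j).symm) ∘ (𝒜.chart j ∘ e.symm) := by
    filter_upwards [(e.isOpen_inter_preimage_symm (𝒜.chart j).open_source).mem_nhds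
      ⟨hyt, hjs⟩] with z hz
    simp [(𝒜.chart j).left_inv hz.2]
  rw [(e1.fderiv (𝕜 := ℝ)).fderiv_eq]
  refine abs_fderiv_fderiv_comp_le ?_ ?_ hε ?_ ?_ ((hy j hj).trans ?_) v
  · refine contDiffAt_comp_symm (𝒜.chart_mem j) ((𝒜.chart j).map_source hjs) ?_
    exact (hψ _).of_le two_le_smooth
  · exact (contDiffAt_transition hem (𝒜.chart_mem j) hyt hjs).of_le le_top
  · exact (norm_iteratedFDeriv_lt_of_c2Norm_lt hc hj 1).le
  · exact (norm_iteratedFDeriv_lt_of_c2Norm_lt hc hj 2).le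
  · have := Finset.single_le_sum (f := K) (fun i _ => (hK0 i).le) (Finset.mem_univ j)
    linarith

end Manifold

lemma eventually_norm_sub_lt {X F : Type*} [TopologicalSpace X] [NormedAddCommGroup F] {H : X → F}
    {p₀ : X} (hc : ContinuousAt H p₀) {ε : ℝ} (hε : 0 < ε) : ∀ᶠ p in 𝓝 p₀, ‖H p - H p₀‖ < ε := by
  filter_upwards [Metric.tendsto_nhds.1 hc ε hε] with p hp
  rwa [dist_eq_norm] at hp

lemma eventually_abs_fderiv_fderiv_sub_le {F : Type*} [NormedAddCommGroup F] [NormedSpace ℝ F]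
    {f : F → ℝ} {p₀ : F} (hf : ContDiffAt ℝ 2 f p₀) {ε : ℝ} (hε : 0 < ε) :
    ∀ᶠ p in 𝓝 p₀, ∀ ξ η, |fderiv ℝ (fderiv ℝ f) p ξ η - fderiv ℝ (fderiv ℝ f) p₀ ξ η| ≤
      ε * (‖ξ‖ * ‖η‖) := by
  have hc : ContinuousAt (fderiv ℝ (fderiv ℝ f)) p₀ :=
    ((hf.fderiv_right (m := 1) (by norm_num)).fderiv_right (m := 0) (by norm_num)).continuousAt
  filter_upwards [eventually_norm_sub_lt (F := F →L[ℝ] F →L[ℝ] ℝ) hc hε] with p hp ξ η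
  have := (fderiv ℝ (fderiv ℝ f) p - fderiv ℝ (fderiv ℝ f) p₀).le_opNorm₂ ξ η
  refine this.trans ?_
  rw [mul_assoc]
  exact mul_le_mul_of_nonneg_right hp.le (by positivity)

/-! ### Convexity of the diastasis in charts; local diffeomorphisms -/

section Manifold

variable {E : Type*} [NormedAddCommGroup E] [NormedSpace ℂ E]
  {M : Type*} [TopologicalSpace M] [ChartedSpace E M]

/-- A function of two points of `M`, in the preferred chart at `x`. -/
def inChartAt₂ (D : M → M → ℝ) (x : M) (p : E × E) : ℝ :=
  D ((chartAt E x).symm p.1) ((chartAt E x).symm p.2)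

variable (E) in
/-- On the ball of radius `r` about `x` in the preferred chart, `D` is smooth and uniformly convex in
the first variable, vanishes to second order on the diagonal, and has nondegenerate mixed second
derivatives. -/
structure IsConvexBall (D : M → M → ℝ) (x : M) (r c : ℝ) : Prop where
  pos : 0 < c
  subset : Metric.ball (chartAt E x x) r ⊆ (chartAt E x).target
  smooth : ∀ p ∈ Metric.ball (chartAt E x x) r ×ˢ Metric.ball (chartAt E x x) r,
    ContDiffAt ℝ ∞ (inChartAt₂ D x) p
  diag : ∀ y ∈ Metric.ball (chartAt E x x) r, inChartAt₂ D x (y, y) = 0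
  crit : ∀ y ∈ Metric.ball (chartAt E x x) r, ∀ v, fderiv ℝ (inChartAt₂ D x) (y, y) (v, 0) = 0
  convex : ∀ p ∈ Metric.ball (chartAt E x x) r ×ˢ Metric.ball (chartAt E x x) r, ∀ v : E,
    c * ‖v‖ ^ 2 ≤ fderiv ℝ (fderiv ℝ (inChartAt₂ D x)) p (v, 0) (v, 0)
  mixed : ∀ p ∈ Metric.ball (chartAt E x x) r ×ˢ Metric.ball (chartAt E x x) r, ∀ v : E,
    fderiv ℝ (fderiv ℝ (inChartAt₂ D x)) p (v, 0) (0, v) ≤ -(c * ‖v‖ ^ 2)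

lemma IsConvexBall.mono {D : M → M → ℝ} {x : M} {r r' c : ℝ} (h : IsConvexBall E D x r c)
    (hr : r' ≤ r) : IsConvexBall E D x r' c := by
  have hb := Metric.ball_subset_ball (x := chartAt E x x) hr
  have hbb := prod_mono hb hb
  exact ⟨h.pos, hb.trans h.subset, fun p hp => h.smooth p (hbb hp), fun y hy => h.diag y (hb hy),
    fun y hy => h.crit y (hb hy), fun p hp => h.convex p (hbb hp), fun p hp => h.mixed p (hbb hp)⟩

variable {κ : TwoForm E M} {U : Set M} {u : M → ℝ} {uC : M → M → ℂ}

lemma IsPolarizedPotential.ddbarFlat_chartAt (h : IsPolarizedPotential κ U u uC) {x : M}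
    (hx : x ∈ U) :
    ddbarFlat (u ∘ (chartAt E x).symm) (chartAt E x x) = (κ x : E [⋀^Fin 2]→L[ℝ] ℝ) :=
  h.potential x hx

variable [FiniteDimensional ℂ E] [IsManifold 𝓘(ℂ, E) ω M]

/-- At `(x, x)` the two second derivatives along `v` are `κ (v, Jv)` and `-κ (v, Jv)`, with `κ (v,
Jv) ≥ c ‖v‖²`. Continuity of the second derivative costs at most half of `c` on a small ball. -/
lemma IsPolarizedPotential.exists_isConvexBall (h : IsPolarizedPotential κ U u uC) (hU : IsOpen U)
    (hκ : IsPositive κ) {D : M → M → ℝ}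
    (hD : ∀ z ∈ U, ∀ w ∈ U, D z w = u z + u w - 2 * (uC z w).re) {x : M} (hx : x ∈ U) :
    ∃ r > 0, ∃ c, IsConvexBall E D x r c ∧
      Metric.ball (chartAt E x x) r ⊆ chartDomain (chartAt E x) U := by
  set e := chartAt E x with he
  have hem : e ∈ atlas E M := chart_mem_atlas E x
  have hxs : x ∈ e.source := mem_chart_source E x
  set g : E × E → ℂ := fun p => uC (e.symm p.1) (e.symm p.2) with hg
  set Ω := chartDomain e U with hΩ
  have hΩo : IsOpen Ω := isOpen_chartDomain e hU
  have hxΩ : e x ∈ Ω := mem_chartDomain hxs hx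
  have hses : IsSesqui g (Ω ×ˢ Ω) := h.isSesqui hU hem hem
  have hSo : IsOpen (Ω ×ˢ Ω) := hΩo.prod hΩo
  have hu : ∀ z ∈ Ω, ∀ᶠ y in 𝓝 z, g (y, y) = (u ∘ e.symm) y := fun z hz => by
    filter_upwards [hΩo.mem_nhds hz] with y hy using h.diag _ hy.2
  have husm : ∀ z ∈ Ω, ContDiffAt ℝ ∞ (u ∘ e.symm) z := fun z hz =>
    contDiffAt_comp_symm hem hz.1 (h.contMDiffAt hU hz.2)
  have hDF : ∀ p ∈ Ω ×ˢ Ω, inChartAt₂ D x p = flatDiastasis (u ∘ e.symm) g p := fun p hp =>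
    hD _ hp.1.2 _ hp.2.2
  have hev : ∀ p ∈ Ω ×ˢ Ω, inChartAt₂ D x =ᶠ[𝓝 p] flatDiastasis (u ∘ e.symm) g := fun p hp => by
    filter_upwards [hSo.mem_nhds hp] with q hq using hDF q hq
  have hsm : ∀ p ∈ Ω ×ˢ Ω, ContDiffAt ℝ ∞ (inChartAt₂ D x) p := by
    intro p hp
    refine ContDiffAt.congr_of_eventuallyEq ?_ (hev p hp)
    exact ((ContDiffAt.comp p (husm _ hp.1) contDiffAt_fst).add
      (ContDiffAt.comp p (husm _ hp.2) contDiffAt_snd)).sub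
      (contDiffAt_const.mul (Complex.reCLM.contDiff.contDiffAt.comp p (hses.contDiffAt hSo hp)))
  obtain ⟨α, hα⟩ : ∃ α : E [⋀^Fin 2]→L[ℝ] ℝ, α = κ x := ⟨κ x, rfl⟩
  obtain ⟨c, hc, hcκ⟩ := exists_pos_le_form α fun v hv => by rw [hα]; exact hκ x v hv
  set H := fderiv ℝ (fderiv ℝ (inChartAt₂ (E := E) D x)) with hH
  have hH0 : H (e x, e x) = fderiv ℝ (fderiv ℝ (flatDiastasis (u ∘ e.symm) g)) (e x, e x) :=
    ((hev _ ⟨hxΩ, hxΩ⟩).fderiv (𝕜 := ℝ)).fderiv_eq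
  have hform : ddbarFlat (u ∘ e.symm) (e x) = α := (h.ddbarFlat_chartAt hx).trans hα.symm
  have h1 (v : E) : c * ‖v‖ ^ 2 ≤ H (e x, e x) (v, 0) (v, 0) := by
    rw [hH0, fderiv_fderiv_flatDiastasis_left (x := e x) hses hSo ⟨hxΩ, hxΩ⟩ (hu _ hxΩ), hform]
    exact hcκ v
  have h2 (v : E) : H (e x, e x) (v, 0) (0, v) ≤ -(c * ‖v‖ ^ 2) := by
    rw [hH0, fderiv_fderiv_flatDiastasis_mixed (x := e x) hses hSo ⟨hxΩ, hxΩ⟩ (hu _ hxΩ), hform]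
    exact neg_le_neg (hcκ v)
  obtain ⟨r₁, hr₁, hb₁⟩ := Metric.eventually_nhds_iff_ball.1
    (eventually_abs_fderiv_fderiv_sub_le ((hsm (e x, e x) ⟨hxΩ, hxΩ⟩).of_le two_le_smooth) (half_pos hc))
  obtain ⟨r₂, hr₂, hb₂⟩ := Metric.isOpen_iff.1 hΩo _ hxΩ
  have hb : Metric.ball (e x) (min r₁ r₂) ⊆ Ω :=
    (Metric.ball_subset_ball (min_le_right _ _)).trans hb₂
  have hdiff : ∀ p ∈ Metric.ball (e x) (min r₁ r₂) ×ˢ Metric.ball (e x) (min r₁ r₂), ∀ ξ η : E × E,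
      |H p ξ η - H (e x, e x) ξ η| ≤ c / 2 * (‖ξ‖ * ‖η‖) := by
    intro p hp ξ η
    rw [ball_prod_same] at hp
    exact hb₁ p (Metric.ball_subset_ball (min_le_left _ _) hp) ξ η
  refine ⟨min r₁ r₂, lt_min hr₁ hr₂, c / 2, ⟨by positivity, fun y hy => (hb hy).1,
    fun p hp => hsm p ⟨hb hp.1, hb hp.2⟩, fun y hy => ?_, fun y hy v => ?_, fun p hp v => ?_,
    fun p hp v => ?_⟩, hb⟩
  · rw [hDF _ ⟨hb hy, hb hy⟩, flatDiastasis, (hu y (hb hy)).self_of_nhds]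
    simp; ring
  · rw [(hev (y, y) ⟨hb hy, hb hy⟩).fderiv_eq]
    exact fderiv_flatDiastasis_diag hses hSo ⟨hb hy, hb hy⟩ (hu y (hb hy)) v
  · have h3 := (abs_le.1 (hdiff p hp (v, 0) (v, 0))).1
    have h4 := h1 v
    simp only [Prod.norm_mk, norm_zero, max_eq_left (norm_nonneg v)] at h3
    nlinarith
  · have h3 := (abs_le.1 (hdiff p hp (v, 0) (0, v))).2
    have h4 := h2 v
    simp only [Prod.norm_mk, norm_zero, max_eq_left (norm_nonneg v),
      max_eq_right (norm_nonneg v)] at h3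
    nlinarith

/-! ### Maps that are local diffeomorphisms in charts -/

/-- `G` is smooth near `q` with injective differential, in a chart that contains `q` and `G q`. -/
def IsChartDiffeoAt (E : Type*) [NormedAddCommGroup E] [NormedSpace ℂ E]
    {M : Type*} [TopologicalSpace M] [ChartedSpace E M] (G : M → M) (q : M) : Prop :=
  ∃ e ∈ atlas E M, q ∈ e.source ∧ G q ∈ e.source ∧ ContinuousAt G q ∧
    ContDiffAt ℝ ∞ (e ∘ G ∘ e.symm) (e q) ∧
    ∀ v, fderiv ℝ (e ∘ G ∘ e.symm) (e q) v = 0 → v = 0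

lemma contMDiffAt_of_chart {G : M → M} {q : M} {e : OpenPartialHomeomorph M E} (he : e ∈ atlas E M)
    (hq : q ∈ e.source) (hGq : G q ∈ e.source) (hc : ContinuousAt G q)
    (hs : ContDiffAt ℝ ∞ (e ∘ G ∘ e.symm) (e q)) : ContMDiffAt 𝓘(ℝ, E) 𝓘(ℝ, E) ∞ G q := by
  have h1 : ContMDiffAt 𝓘(ℝ, E) 𝓘(ℝ, E) ∞ e.symm ((e ∘ G ∘ e.symm) (e q)) := by
    refine (contMDiffAt_chart_symm (𝕜 := ℝ) he ?_).of_le le_top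
    simp only [Function.comp, e.left_inv hq]
    exact e.map_source hGq
  have h2 : ContMDiffAt 𝓘(ℝ, E) 𝓘(ℝ, E) ∞ (e.symm ∘ (e ∘ G ∘ e.symm) ∘ e) q :=
    ContMDiffAt.comp q h1 (ContMDiffAt.comp q (contMDiffAt_iff_contDiffAt.2 hs)
      ((contMDiffAt_chart (𝕜 := ℝ) he hq).of_le le_top))
  refine h2.congr_of_eventuallyEq ?_
  filter_upwards [e.open_source.mem_nhds hq, hc.eventually (e.open_source.mem_nhds hGq)] with z hz hz'
  simp [e.left_inv hz, e.left_inv hz']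

lemma exists_equiv_of_injective {L : E →L[ℝ] E} (h : ∀ v, L v = 0 → v = 0) :
    ∃ A : E ≃L[ℝ] E, (A : E →L[ℝ] E) = L := by
  have : FiniteDimensional ℝ E := FiniteDimensional.complexToReal E
  refine ⟨(LinearEquiv.ofInjectiveEndo (L : E →ₗ[ℝ] E)
    ((injective_iff_map_eq_zero _).2 h)).toContinuousLinearEquiv, ?_⟩
  ext v
  rfl

/-- The inverse function theorem in a chart. One inclusion of filters is continuity of `G` at `q`,
the other is openness. -/
lemma map_nhds_eq_of_isChartDiffeoAt {G : M → M} {q : M} (h : IsChartDiffeoAt E G q) :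
    map G (𝓝 q) = 𝓝 (G q) := by
  have : FiniteDimensional ℝ E := FiniteDimensional.complexToReal E
  have : CompleteSpace E := FiniteDimensional.complete ℝ E
  obtain ⟨e, he, hq, hGq, hc, hs, hi⟩ := h
  obtain ⟨A, hA⟩ := exists_equiv_of_injective hi
  have h1 : HasStrictFDerivAt (e ∘ G ∘ e.symm) (A : E →L[ℝ] E) (e q) := by
    rw [hA]; exact hs.hasStrictFDerivAt (by simp)
  have h2 := h1.map_nhds_eq_of_equiv
  have h3 : map e.symm (𝓝 (e q)) = 𝓝 q := by
    have := e.symm.map_nhds_eq (x := e q) (e.map_source hq)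
    rwa [e.left_inv hq] at this
  have h4 : (e ∘ G ∘ e.symm) (e q) = e (G q) := by simp [e.left_inv hq]
  have h5 : map e.symm (𝓝 (e (G q))) = 𝓝 (G q) := by
    have := e.symm.map_nhds_eq (x := e (G q)) (e.map_source hGq)
    rwa [e.left_inv hGq] at this
  have h6 : G =ᶠ[𝓝 q] e.symm ∘ (e ∘ G) := by
    filter_upwards [hc.eventually (e.open_source.mem_nhds hGq)] with z hz
    exact (e.left_inv hz).symm
  rw [map_congr h6, ← h3, map_map]
  rw [h4] at h2
  rw [← h5, ← h2, map_map]
  rfl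

/-- A bijective map that is a local diffeomorphism in charts is a diffeomorphism. -/
lemma exists_diffeomorph_of_bijective {G : M → M} (h : ∀ q, IsChartDiffeoAt E G q)
    (hG : Function.Bijective G) : ∃ Φ : M ≃ₘ^∞⟮𝓘(ℝ, E), 𝓘(ℝ, E)⟯ M, ∀ q, Φ q = G q := by
  have : FiniteDimensional ℝ E := FiniteDimensional.complexToReal E
  have : CompleteSpace E := FiniteDimensional.complete ℝ E
  have hcont : Continuous G := continuous_iff_continuousAt.2 fun q =>
    (map_nhds_eq_of_isChartDiffeoAt (h q)).le
  have hopen : IsOpenMap G := isOpenMap_iff_nhds_le.2 fun q =>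
    (map_nhds_eq_of_isChartDiffeoAt (h q)).ge
  let Γ : M ≃ₜ M := (Equiv.ofBijective G hG).toHomeomorphOfContinuousOpen hcont hopen
  have hΓ : ∀ q, Γ q = G q := fun q => rfl
  have hsm : ContMDiff 𝓘(ℝ, E) 𝓘(ℝ, E) ∞ G := fun q => by
    obtain ⟨e, he, hq, hGq, hc, hs, -⟩ := h q
    exact contMDiffAt_of_chart he hq hGq hc hs
  have hsm' : ContMDiff 𝓘(ℝ, E) 𝓘(ℝ, E) ∞ Γ.symm := fun p => by
    obtain ⟨q, rfl⟩ := hG.surjective p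
    obtain ⟨e, he, hq, hGq, hc, hs, hi⟩ := h q
    obtain ⟨A, hA⟩ := exists_equiv_of_injective hi
    have hq' : Γ.symm (G q) = q := Γ.symm_apply_apply q
    refine contMDiffAt_of_chart he hGq (by rwa [hq']) Γ.symm.continuous.continuousAt ?_
    -- The global homeomorphism, read in the chart, is a local homeomorphism whose derivative is
    -- invertible, so its inverse is smooth as well.
    let P : OpenPartialHomeomorph E E := (e.symm.trans Γ.toOpenPartialHomeomorph).trans e
    have hP : ∀ y, P y = (e ∘ G ∘ e.symm) y := fun y => rfl
    have hPs : ∀ y, P.symm y = (e ∘ Γ.symm ∘ e.symm) y := fun y => rfl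
    have hP0 : P.symm (e (G q)) = e q := by rw [hPs]; simp [e.left_inv hGq, hq']
    have ht : e (G q) ∈ P.target := by
      have h0 : e q ∈ P.source := by
        simp only [P, OpenPartialHomeomorph.trans_source, mem_inter_iff, mem_preimage]
        simp [e.map_source hq, e.left_inv hq, hΓ, hGq]
      have := P.map_source h0
      rwa [hP, show (e ∘ G ∘ e.symm) (e q) = e (G q) by simp [e.left_inv hq]] at this
    refine P.contDiffAt_symm (f₀' := A) ht ?_ ?_
    · rw [hP0, hA]
      exact (hs.differentiableAt (by simp)).hasFDerivAt
    · rw [hP0]; exact hs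
  exact ⟨⟨Γ.toEquiv, hsm, hsm'⟩, fun q => rfl⟩

end Manifold

/-! ### Smooth dependence of critical points on parameters -/

section Implicit

variable {E : Type*} [NormedAddCommGroup E] [NormedSpace ℝ E] [FiniteDimensional ℝ E]

lemma isInvertible_of_injective {L : E →L[ℝ] E →L[ℝ] ℝ} (h : ∀ v, L v = 0 → v = 0) :
    L.IsInvertible := by
  have hr : Module.finrank ℝ E = Module.finrank ℝ (E →L[ℝ] ℝ) :=
    Subspace.dual_finrank_eq.symm.trans
      (LinearMap.toContinuousLinearMap (𝕜 := ℝ) (E := E) (F' := ℝ)).finrank_eq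
  refine ⟨(LinearEquiv.ofInjectiveOfFinrankEq (L : E →ₗ[ℝ] E →L[ℝ] ℝ)
    ((injective_iff_map_eq_zero _).2 h) hr).toContinuousLinearEquiv, ?_⟩
  ext v
  rfl

/-- The critical points in the first variable of a function of two variables that is convex in the
first variable depend smoothly on the second variable. -/
lemma exists_contDiffAt_critical {f : E × E → ℝ} {y w : E} (hf : ContDiffAt ℝ ∞ f (y, w))
    (hpos : ∀ v : E, v ≠ 0 → 0 < fderiv ℝ (fderiv ℝ f) (y, w) (v, 0) (v, 0))
    (h0 : ∀ v, fderiv ℝ f (y, w) (v, 0) = 0) :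
    ∃ φ : E → E, φ w = y ∧ ContDiffAt ℝ ∞ φ w ∧ ∀ᶠ z in 𝓝 w, ∀ v, fderiv ℝ f (φ z, z) (v, 0) = 0 := by
  have : CompleteSpace E := FiniteDimensional.complete ℝ E
  have hsw : ContDiffAt ℝ ∞ (Prod.swap : E × E → E × E) (w, y) :=
    (contDiff_snd.prodMk contDiff_fst).contDiffAt
  -- The implicit function solves for the second variable of `F`, whereas the critical point is the
  -- first variable of `f`. This accounts for the swap.
  let F : E × E → E →L[ℝ] ℝ := fun p => (fderiv ℝ f p.swap).comp (ContinuousLinearMap.inl ℝ E E)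
  have hfd : ContDiffAt ℝ ∞ (fderiv ℝ f) (Prod.swap (w, y)) :=
    ContDiffAt.fderiv_right (n := ∞) (m := ∞) hf (by simp)
  have hF : ContDiffAt ℝ ∞ F (w, y) :=
    ContDiffAt.clm_comp (ContDiffAt.comp (w, y) hfd hsw) contDiffAt_const
  have hder : ∀ v v' : E, fderiv ℝ F (w, y) (0, v) v' =
      fderiv ℝ (fderiv ℝ f) (y, w) (v, 0) (v', 0) := by
    intro v v'
    have h1 : HasFDerivAt (Prod.swap : E × E → E × E)
        ((ContinuousLinearMap.snd ℝ E E).prod (ContinuousLinearMap.fst ℝ E E)) (w, y) :=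
      hasFDerivAt_snd.prodMk hasFDerivAt_fst
    have h2 := (HasFDerivAt.comp (w, y) (hfd.differentiableAt (by simp)).hasFDerivAt h1).clm_comp
      (hasFDerivAt_const (ContinuousLinearMap.inl ℝ E E) (w, y))
    have h3 : fderiv ℝ F (w, y) = _ := h2.fderiv
    rw [h3]
    simp
  -- A positive definite Hessian is an injective map from `E` to its dual, and the dimensions agree.
  have hinv : (fderiv ℝ F (w, y) ∘L .inr ℝ E E).IsInvertible := by
    refine isInvertible_of_injective fun v hv => ?_
    by_contra hne
    have h1 := hpos v hne
    rw [← hder] at h1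
    have h2 : fderiv ℝ F (w, y) (0, v) = 0 := hv
    rw [h2] at h1
    exact lt_irrefl _ h1
  refine ⟨hF.implicitFunction (by simp) hinv, hF.implicitFunction_apply_self (by simp) hinv,
    hF.contDiffAt_implicitFunction (by simp) hinv, ?_⟩
  filter_upwards [hF.eventually_apply_implicitFunction (by simp) hinv] with z hz v
  have h1 := congrArg (fun L : E →L[ℝ] ℝ => L v) hz
  simpa [F, h0] using h1

/-- Differentiating the critical point equation, tested on `v`, in the direction `v` gives `D²f
((φ'v, v), (v, 0)) = 0`. If `φ'v = 0`, only the mixed derivative remains, and that is nonzero for `v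
≠ 0`. -/
lemma eq_zero_of_fderiv_critical {f : E × E → ℝ} {φ : E → E} {w : E} (hf : ContDiffAt ℝ 2 f (φ w, w))
    (hφ : DifferentiableAt ℝ φ w) (hz : ∀ᶠ z in 𝓝 w, ∀ v, fderiv ℝ f (φ z, z) (v, 0) = 0)
    (hneg : ∀ v : E, v ≠ 0 → fderiv ℝ (fderiv ℝ f) (φ w, w) (v, 0) (0, v) < 0) {v : E}
    (hv : fderiv ℝ φ w v = 0) : v = 0 := by
  by_contra hne
  have h1 : HasFDerivAt (fun z => (φ z, z)) ((fderiv ℝ φ w).prod (.id ℝ E)) w :=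
    hφ.hasFDerivAt.prodMk (hasFDerivAt_id w)
  have h2 := (HasFDerivAt.comp w (f := fun z => (φ z, z))
    (differentiableAt_fderiv_of_contDiffAt hf).hasFDerivAt h1).clm_apply
      (hasFDerivAt_const ((v, 0) : E × E) w)
  have h3 : (fun z => fderiv ℝ f (φ z, z) (v, 0)) =ᶠ[𝓝 w] fun _ => 0 := by
    filter_upwards [hz] with z hz using hz v
  have h4 := (h2.congr_of_eventuallyEq (f₁ := fun _ => 0) h3.symm).unique (hasFDerivAt_const (0 : ℝ) w)
  have h5 := congrArg (fun L : E →L[ℝ] ℝ => L v) h4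
  simp [hv] at h5
  have hs := hf.isSymmSndFDerivAt minSmoothness_real_two
  have := hneg v hne
  rw [hs, h5] at this
  exact lt_irrefl _ this

end Implicit

/-! ### Minimizers inside a single convex chart ball -/

section Manifold

variable {E : Type*} [NormedAddCommGroup E] [NormedSpace ℂ E]
  {M : Type*} [TopologicalSpace M] [ChartedSpace E M]

variable (E) in
/-- The ball of radius `r` about `x`, in the preferred chart at `x`. -/
def chartBall (x : M) (r : ℝ) : Set M :=
  (chartAt E x).source ∩ chartAt E x ⁻¹' Metric.ball (chartAt E x x) r

lemma isOpen_chartBall (x : M) (r : ℝ) : IsOpen (chartBall E x r) :=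
  (chartAt E x).isOpen_inter_preimage Metric.isOpen_ball

variable (E) in
/-- `ψ` is a maximization problem for `-D (p, q) - ψ (p)` on `V` that is uniformly concave in the
preferred chart at `x`. -/
structure IsAdapted (D : M → M → ℝ) (V : Set (M × M)) (ψ : M → ℝ) (x : M) (r : ℝ) : Prop where
  subset : Metric.ball (chartAt E x x) r ⊆ (chartAt E x).target
  mem : ∀ p ∈ chartBall E x r, ∀ q ∈ chartBall E x r, (p, q) ∈ V
  smooth : ∀ p ∈ Metric.ball (chartAt E x x) r ×ˢ Metric.ball (chartAt E x x) r,
    ContDiffAt ℝ ∞ (inChartAt₂ (E := E) (fun p q => D p q + ψ p) x) p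
  pos : ∀ p ∈ Metric.ball (chartAt E x x) r ×ˢ Metric.ball (chartAt E x x) r, ∀ v : E, v ≠ 0 →
    0 < fderiv ℝ (fderiv ℝ (inChartAt₂ (fun p q => D p q + ψ p) x)) p (v, 0) (v, 0)
  neg : ∀ p ∈ Metric.ball (chartAt E x x) r ×ˢ Metric.ball (chartAt E x x) r, ∀ v : E, v ≠ 0 →
    fderiv ℝ (fderiv ℝ (inChartAt₂ (fun p q => D p q + ψ p) x)) p (v, 0) (0, v) < 0

/-- `z` minimizes `D (p, q) + ψ (p)` over `(p, q) ∈ V`. -/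
def IsMinimizer (D : M → M → ℝ) (V : Set (M × M)) (ψ : M → ℝ) (q z : M) : Prop :=
  (z, q) ∈ V ∧ ∀ p, (p, q) ∈ V → D z q + ψ z ≤ D p q + ψ p

variable {D : M → M → ℝ} {V : Set (M × M)} {ψ : M → ℝ} {x : M} {r : ℝ}

/-- The whole ball is available to competitors because its square lies in `V`. A minimizer over the
slice of `V` is therefore an interior local minimum in the chart. -/
lemma IsAdapted.critical (h : IsAdapted E D V ψ x r) {q z : M} (hq : q ∈ chartBall E x r)
    (hz : z ∈ chartBall E x r) (hm : IsMinimizer D V ψ q z) (v : E) :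
    fderiv ℝ (inChartAt₂ (fun p q => D p q + ψ p) x) (chartAt E x z, chartAt E x q) (v, 0) = 0 := by
  set f := inChartAt₂ (E := E) (fun p q => D p q + ψ p) x with hf
  set e := chartAt E x with he
  have hmin : IsLocalMin (fun y => f (y, e q)) (e z) := by
    filter_upwards [Metric.isOpen_ball.mem_nhds hz.2] with y hy
    have h1 : e.symm y ∈ chartBall E x r :=
      ⟨e.map_target (h.subset hy), by rw [mem_preimage, e.right_inv (h.subset hy)]; exact hy⟩
    have h2 := hm.2 _ (h.mem _ h1 _ hq)
    simpa [hf, inChartAt₂, ← he, e.left_inv hq.1, e.left_inv hz.1] using h2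
  have h1 := HasFDerivAt.comp (e z) (f := fun y : E => (y, e q))
    ((h.smooth (e z, e q) ⟨hz.2, hq.2⟩).differentiableAt (by simp)).hasFDerivAt
    (hasFDerivAt_prodMk_left (e z) (e q))
  have h2 := hmin.hasFDerivAt_eq_zero h1
  simpa using congrArg (fun L : E →L[ℝ] ℝ => L v) h2

lemma IsAdapted.eq_left (h : IsAdapted E D V ψ x r) {q z z' : M} (hq : q ∈ chartBall E x r)
    (hz : z ∈ chartBall E x r) (hz' : z' ∈ chartBall E x r) (hm : IsMinimizer D V ψ q z)
    (hm' : IsMinimizer D V ψ q z') : z = z' :=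
  (chartAt E x).injOn hz.1 hz'.1 <| eq_of_partial_eq_zero (convex_ball _ _)
    (fun p hp => (h.smooth p hp).of_le two_le_smooth) h.pos hz.2 hz'.2 hq.2
    (h.critical hq hz hm) (h.critical hq hz' hm')

lemma IsAdapted.eq_right (h : IsAdapted E D V ψ x r) {q q' z : M} (hq : q ∈ chartBall E x r)
    (hq' : q' ∈ chartBall E x r) (hz : z ∈ chartBall E x r) (hm : IsMinimizer D V ψ q z)
    (hm' : IsMinimizer D V ψ q' z) : q = q' :=
  (chartAt E x).injOn hq.1 hq'.1 <| eq_of_partial_eq (convex_ball _ _)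
    (fun p hp => (h.smooth p hp).of_le two_le_smooth) h.neg hq.2 hq'.2 hz.2 fun v => by
      rw [h.critical hq hz hm, h.critical hq' hz hm']

variable [FiniteDimensional ℂ E]

/-- `G` is not assumed continuous. Near `q`, its chart expression and the implicit function through
`G q` both give critical points of the same strictly convex function in the same ball, so they
coincide, and `G` inherits smoothness. The mixed derivative makes its differential injective. -/
lemma IsAdapted.isChartDiffeoAt (h : IsAdapted E D V ψ x r) {G : M → M} {q : M}
    (hq : ∀ᶠ q' in 𝓝 q, q' ∈ chartBall E x r ∧ G q' ∈ chartBall E x r ∧ IsMinimizer D V ψ q' (G q')) :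
    IsChartDiffeoAt E G q ∧ ContDiffAt ℝ ∞ ((fun q => D (G q) q + ψ (G q)) ∘ (chartAt E x).symm)
      (chartAt E x q) := by
  have : FiniteDimensional ℝ E := FiniteDimensional.complexToReal E
  set f := inChartAt₂ (E := E) (fun p q => D p q + ψ p) x with hf
  set e := chartAt E x with he
  obtain ⟨hqB, hGB, hm⟩ := hq.self_of_nhds
  have hmem : (e (G q), e q) ∈ Metric.ball (e x) r ×ˢ Metric.ball (e x) r := ⟨hGB.2, hqB.2⟩
  obtain ⟨φ, hφ0, hφs, hφ⟩ := exists_contDiffAt_critical (h.smooth _ hmem) (h.pos _ hmem)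
    (h.critical hqB hGB hm)
  have hsymm : Tendsto e.symm (𝓝 (e q)) (𝓝 q) := by
    have := e.continuousAt_symm (e.map_source hqB.1)
    rwa [ContinuousAt, e.left_inv hqB.1] at this
  have hφB : ∀ᶠ y in 𝓝 (e q), φ y ∈ Metric.ball (e x) r :=
    hφs.continuousAt.eventually (Metric.isOpen_ball.mem_nhds (by rw [hφ0]; exact hGB.2))
  -- Uniqueness of the critical point in the ball identifies the pointwise chosen minimizer with the
  -- smooth branch.
  have hev : ∀ᶠ y in 𝓝 (e q), e (G (e.symm y)) = φ y := by
    filter_upwards [hφ, hφB, hsymm.eventually hq, e.open_target.mem_nhds (e.map_source hqB.1)]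
      with y hy hyB hyq hyt
    have hc := h.critical hyq.1 hyq.2.1 hyq.2.2
    have h1 := hyq.1.2
    rw [mem_preimage] at h1
    simp only [← he, ← hf, e.right_inv hyt] at hc h1
    exact eq_of_partial_eq_zero (convex_ball _ _)
      (fun p hp => (h.smooth p hp).of_le two_le_smooth) h.pos hyq.2.1.2 hyB h1 hc hy
  have heq : e ∘ G ∘ e.symm =ᶠ[𝓝 (e q)] φ := hev
  have hG : G =ᶠ[𝓝 q] e.symm ∘ φ ∘ e := by
    filter_upwards [(e.continuousAt hqB.1).eventually hev, hq, e.open_source.mem_nhds hqB.1]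
      with q' h1 h2 h3
    rw [e.left_inv h3] at h1
    simp only [Function.comp, ← h1]
    exact (e.left_inv h2.2.1.1).symm
  have hcont : ContinuousAt G q := by
    refine ContinuousAt.congr ?_ hG.symm
    refine ContinuousAt.comp ?_ (hφs.continuousAt.comp (e.continuousAt hqB.1))
    simp only [Function.comp, hφ0]
    exact e.continuousAt_symm (e.map_source hGB.1)
  have hmem' : (φ (e q), e q) ∈ Metric.ball (e x) r ×ˢ Metric.ball (e x) r := by rw [hφ0]; exact hmem
  refine ⟨⟨e, chart_mem_atlas E x, hqB.1, hGB.1, hcont, hφs.congr_of_eventuallyEq heq, fun v hv => ?_⟩,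
    ?_⟩
  · rw [heq.fderiv_eq] at hv
    exact eq_zero_of_fderiv_critical ((h.smooth _ hmem').of_le two_le_smooth)
      (hφs.differentiableAt (by simp)) hφ (h.neg _ hmem') hv
  · have h1 : ContDiffAt ℝ ∞ (fun y => f (φ y, y)) (e q) :=
      ContDiffAt.comp (e q) (f := fun y => (φ y, y)) (h.smooth _ hmem') (hφs.prodMk contDiffAt_id)
    refine h1.congr_of_eventuallyEq ?_
    filter_upwards [hev, hsymm.eventually hq] with y hy hyq
    simp only [hf, inChartAt₂, ← hy, ← he, Function.comp, e.left_inv hyq.2.1.1]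

end Manifold

/-! ### The global map of minimizers and the pullback formula -/

section Manifold

variable {E : Type*} [NormedAddCommGroup E] [NormedSpace ℂ E]
  {M : Type*} [TopologicalSpace M] [ChartedSpace E M]

variable (E) in
/-- The function `D (p, q) + ψ (p)` has minimizers in the first variable, which stay in charts in
which it is uniformly convex. -/
structure IsAdmissible (D : M → M → ℝ) (V : Set (M × M)) (ψ : M → ℝ) : Prop where
  exists_minimizer : ∀ q, ∃ z, IsMinimizer D V ψ q z
  adapted_left : ∀ q, ∃ x r, IsAdapted E D V ψ x r ∧
    ∀ᶠ q' in 𝓝 q, q' ∈ chartBall E x r ∧ ∀ z, IsMinimizer D V ψ q' z → z ∈ chartBall E x r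
  adapted_right : ∀ z, ∃ x r, IsAdapted E D V ψ x r ∧ z ∈ chartBall E x r ∧
    ∀ q, IsMinimizer D V ψ q z → q ∈ chartBall E x r

variable {κ : TwoForm E M} {D : M → M → ℝ} {V : Set (M × M)} {ψ : M → ℝ} {G : M → M}

lemma IsAdmissible.unique (h : IsAdmissible E D V ψ) {q z z' : M} (hz : IsMinimizer D V ψ q z)
    (hz' : IsMinimizer D V ψ q z') : z = z' := by
  obtain ⟨x, r, ha, hb⟩ := h.adapted_left q
  obtain ⟨hq, hb⟩ := hb.self_of_nhds
  exact ha.eq_left hq (hb z hz) (hb z' hz') hz hz'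

/-- At a minimizer `z` the derivative of `D (·, q)` at `z` is `-dψ (z)`, whatever `q` is. By the
definite mixed derivative this determines `q`, since all parameters with minimizer `z` lie in one
convex ball around which `adapted_right` is formulated. -/
lemma IsAdmissible.injective (h : IsAdmissible E D V ψ) (hG : ∀ q, IsMinimizer D V ψ q (G q)) :
    Function.Injective G := by
  intro q q' hqq
  obtain ⟨x, r, ha, hz, hb⟩ := h.adapted_right (G q)
  have h1 : IsMinimizer D V ψ q' (G q) := by rw [hqq]; exact hG q'
  exact ha.eq_right (hb q (hG q)) (hb q' h1) hz (hG q) h1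

lemma IsCalabiDiastasis.self_eq_zero (hD : IsCalabiDiastasis κ V D) (q : M) : D q q = 0 := by
  obtain ⟨U, -, -, hq, -, -, u, uC, hu, hDu⟩ := hD.local_form q q (hD.diag_subset q)
  rw [hDu q hq q hq, hu.diag q hq]
  simp; ring

variable [FiniteDimensional ℂ E]

lemma IsAdmissible.isChartDiffeoAt (h : IsAdmissible E D V ψ) (hG : ∀ q, IsMinimizer D V ψ q (G q))
    (q : M) : IsChartDiffeoAt E G q := by
  obtain ⟨x, r, ha, hb⟩ := h.adapted_left q
  refine (ha.isChartDiffeoAt ?_).1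
  filter_upwards [hb] with q' hq'
  exact ⟨hq'.1, hq'.2 _ (hG q'), hG q'⟩

/-- The range is open, since `G` is a local diffeomorphism, and closed by compactness. `M` need not
be connected: `(G p, p) ∈ V` puts `p` and the image point `G p` in one connected open set. -/
lemma IsAdmissible.surjective [CompactSpace M] [T2Space M] [IsManifold 𝓘(ℂ, E) ω M]
    (h : IsAdmissible E D V ψ)
    (hD : IsCalabiDiastasis κ V D) (hG : ∀ q, IsMinimizer D V ψ q (G q)) :
    Function.Surjective G := by
  have hcont : Continuous G := continuous_iff_continuousAt.2 fun q =>
    (map_nhds_eq_of_isChartDiffeoAt (h.isChartDiffeoAt hG q)).le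
  have hopen : IsOpenMap G := isOpenMap_iff_nhds_le.2 fun q =>
    (map_nhds_eq_of_isChartDiffeoAt (h.isChartDiffeoAt hG q)).ge
  have hclopen : IsClopen (range G) := ⟨(isCompact_range hcont).isClosed, hopen.isOpen_range⟩
  intro p
  obtain ⟨U, -, hU, hGp, hp, -⟩ := hD.local_form (G p) p (hG p).1
  exact hU.isPreconnected.subset_isClopen hclopen ⟨G p, hGp, mem_range_self p⟩ hp

variable [IsManifold 𝓘(ℂ, E) ω M]

lemma IsAdmissible.contMDiff_value (h : IsAdmissible E D V ψ) (hG : ∀ q, IsMinimizer D V ψ q (G q)) :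
    ContMDiff 𝓘(ℝ, E) 𝓘(ℝ, ℝ) ∞ (fun q => D (G q) q + ψ (G q)) := by
  intro q
  obtain ⟨x, r, ha, hb⟩ := h.adapted_left q
  refine contMDiffAt_of_comp_symm (chart_mem_atlas E x) hb.self_of_nhds.1.1
    (ha.isChartDiffeoAt ?_).2
  filter_upwards [hb] with q' hq'
  exact ⟨hq'.1, hq'.2 _ (hG q'), hG q'⟩

lemma contDiffAt_charts {G : M → M} {q : M} (hG : ContMDiffAt 𝓘(ℝ, E) 𝓘(ℝ, E) ∞ G q) :
    ContDiffAt ℝ ∞ (chartAt E (G q) ∘ G ∘ (chartAt E q).symm) (chartAt E q q) := by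
  have hq : (chartAt E q).symm (chartAt E q q) = q := (chartAt E q).left_inv (mem_chart_source E q)
  have h1 := ((contMDiffAt_chart_symm (𝕜 := ℝ) (chart_mem_atlas E q) (mem_chart_target E q)).of_le
    (le_top : (∞ : WithTop ℕ∞) ≤ ω))
  have h2 : ContMDiffAt 𝓘(ℝ, E) 𝓘(ℝ, E) ∞ G ((chartAt E q).symm (chartAt E q q)) := by rwa [hq]
  have h3 : ContMDiffAt 𝓘(ℝ, E) 𝓘(ℝ, E) ∞ (chartAt E (G q)) (G ((chartAt E q).symm (chartAt E q q))) := by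
    rw [hq]
    exact (contMDiffAt_chart (𝕜 := ℝ) (chart_mem_atlas E _) (mem_chart_source E _)).of_le le_top
  exact contMDiffAt_iff_contDiffAt.1 (ContMDiffAt.comp _ h3 (ContMDiffAt.comp _ h2 h1))

lemma perturb_eq_ddbarFlat {U : Set M} {u : M → ℝ} {uC : M → M → ℂ}
    (hu : IsPolarizedPotential κ U u uC) (hU : IsOpen U) {ψ : M → ℝ}
    (hψ : ContMDiff 𝓘(ℝ, E) 𝓘(ℝ, ℝ) ∞ ψ) {x : M} (hx : x ∈ U) :
    (perturb κ ψ x : E [⋀^Fin 2]→L[ℝ] ℝ) =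
      ddbarFlat ((fun p => u p + ψ p) ∘ (chartAt E x).symm) (chartAt E x x) := by
  have hxs : (chartAt E x).symm (chartAt E x x) = x := (chartAt E x).left_inv (mem_chart_source E x)
  have h1 : ContDiffAt ℝ ∞ (u ∘ (chartAt E x).symm) (chartAt E x x) :=
    contDiffAt_comp_symm (chart_mem_atlas E x) (mem_chart_target E x)
      (by rw [hxs]; exact hu.contMDiffAt hU hx)
  have h2 : ContDiffAt ℝ ∞ (ψ ∘ (chartAt E x).symm) (chartAt E x x) :=
    contDiffAt_comp_symm (chart_mem_atlas E x) (mem_chart_target E x) (hψ _)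
  have h3 := ddbarFlat_add (h1.of_le two_le_smooth) (h2.of_le two_le_smooth)
  have h4 := hu.ddbarFlat_chartAt hx
  refine Eq.trans ?_ h3.symm
  rw [h4]
  rfl

/-- The gradient map pulls back `κ_ψ` to the form `κ_φ` of the conjugate function. -/
lemma pullback_perturb (hD : IsCalabiDiastasis κ V D) (hG : ∀ q, IsMinimizer D V ψ q (G q))
    (hGs : ContMDiff 𝓘(ℝ, E) 𝓘(ℝ, E) ∞ G) (hψ : ContMDiff 𝓘(ℝ, E) 𝓘(ℝ, ℝ) ∞ ψ) {φ : M → ℝ}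
    (hφ : ∀ q, φ q = -(D (G q) q + ψ (G q))) (hφs : ContMDiff 𝓘(ℝ, E) 𝓘(ℝ, ℝ) ∞ φ) :
    pullback G (perturb κ ψ) = perturb κ φ := by
  funext q
  obtain ⟨U, hU, -, hGU, hqU, hUV, u, uC, hu, hDu⟩ := hD.local_form (G q) q (hG q).1
  set e₁ := chartAt E (G q) with he₁
  set e₂ := chartAt E q with he₂
  have hm₁ : e₁ ∈ atlas E M := chart_mem_atlas E (G q)
  have hm₂ : e₂ ∈ atlas E M := chart_mem_atlas E q
  have hs₁ : G q ∈ e₁.source := mem_chart_source E (G q)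
  have hs₂ : q ∈ e₂.source := mem_chart_source E q
  have hq : e₂.symm (e₂ q) = q := e₂.left_inv hs₂
  set G' : E → E := e₁ ∘ G ∘ e₂.symm with hG'
  have hGq : G' (e₂ q) = e₁ (G q) := by simp [hG', hq]
  have hG's : ContDiffAt ℝ ∞ G' (e₂ q) := contDiffAt_charts (hGs q)
  have hS := (isOpen_chartDomain e₁ hU).prod (isOpen_chartDomain e₂ hU)
  have hses := hu.isSesqui hU hm₁ hm₂
  set g : E × E → ℂ := fun p => uC (e₁.symm p.1) (e₂.symm p.2) with hg
  have hmem : (G' (e₂ q), e₂ q) ∈ chartDomain e₁ U ×ˢ chartDomain e₂ U := by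
    rw [hGq]; exact ⟨mem_chartDomain hs₁ hGU, mem_chartDomain hs₂ hqU⟩
  have hb (y : E) (hy : y ∈ chartDomain e₁ U) :
      ContDiffAt ℝ 2 ((fun p => u p + ψ p) ∘ e₁.symm) y :=
    (contDiffAt_comp_symm hm₁ hy.1 ((hu.contMDiffAt hU hy.2).add (hψ _))).of_le two_le_smooth
  have ha (y : E) (hy : y ∈ chartDomain e₂ U) :
      ContDiffAt ℝ 2 ((fun p => u p + φ p) ∘ e₂.symm) y :=
    (contDiffAt_comp_symm hm₂ hy.1 ((hu.contMDiffAt hU hy.2).add (hφs _))).of_le two_le_smooth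
  have hsymm : Tendsto (G ∘ e₂.symm) (𝓝 (e₂ q)) (𝓝 (G q)) := by
    have h1 := e₂.continuousAt_symm (e₂.map_source hs₂)
    rw [ContinuousAt, hq] at h1
    exact hGs.continuous.continuousAt.tendsto.comp h1
  have hev : ∀ᶠ y in 𝓝 (e₂ q), y ∈ chartDomain e₂ U ∧ G (e₂.symm y) ∈ e₁.source ∧
      G (e₂.symm y) ∈ U := by
    filter_upwards [(isOpen_chartDomain e₂ hU).mem_nhds hmem.2,
      hsymm.eventually (e₁.open_source.mem_nhds hs₁), hsymm.eventually (hU.mem_nhds hGU)]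
      with y h1 h2 h3 using ⟨h1, h2, h3⟩
  have key := ddbarFlat_comp_gradient hses hS hmem (hG's.of_le two_le_smooth) (ha _ hmem.2)
    (hb _ hmem.1) ?_ ?_
  · rw [hGq] at key
    have k1 := perturb_eq_ddbarFlat hu hU hψ hGU
    have k2 := perturb_eq_ddbarFlat hu hU hφs hqU
    have k3 := mfderiv_eq_fderiv_charts (𝕜 := ℝ) ((hGs q).mdifferentiableAt (by simp))
    refine Eq.trans ?_ (key.trans k2.symm)
    rw [← k1]
    unfold pullback
    rw [k3]
    rfl
  · filter_upwards [hev] with y hy v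
    set p := e₂.symm y with hp
    have hyD : (G' y, y) ∈ chartDomain e₁ U ×ˢ chartDomain e₂ U :=
      ⟨mem_chartDomain hy.2.1 hy.2.2, hy.1⟩
    have hG'y : e₁.symm (G' y) = G p := e₁.left_inv hy.2.1
    -- With `y` fixed, minimality of `G p` becomes a local minimum in the first variable; the term
    -- `u` at the second point is constant.
    have hmin : IsLocalMin (fun z => ((fun p => u p + ψ p) ∘ e₁.symm) z - 2 * (g (z, y)).re)
        (G' y) := by
      filter_upwards [(isOpen_chartDomain e₁ hU).mem_nhds hyD.1] with z hz
      have h1 := (hG p).2 (e₁.symm z) (hUV ⟨hz.2, hy.1.2⟩)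
      rw [hDu _ hy.2.2 _ hy.1.2, hDu _ hz.2 _ hy.1.2] at h1
      simp only [hg, Function.comp, hG'y, ← hp] at h1 ⊢
      linarith
    have h2 := ((hb _ hyD.1).differentiableAt (by simp)).hasFDerivAt.sub
      ((Complex.reCLM.hasFDerivAt.comp (G' y) (HasFDerivAt.comp (G' y) (f := fun z => (z, y))
        (hses.differentiableAt hS hyD).hasFDerivAt (hasFDerivAt_prodMk_left (G' y) y))).const_mul
          (2 : ℝ))
    have h3 := congrArg (fun L : E →L[ℝ] ℝ => L v) (hmin.hasFDerivAt_eq_zero h2)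
    simp at h3
    linarith
  · filter_upwards [hev] with y hy v
    set p := e₂.symm y with hp
    have hyD : (G' y, y) ∈ chartDomain e₁ U ×ˢ chartDomain e₂ U :=
      ⟨mem_chartDomain hy.2.1 hy.2.2, hy.1⟩
    have hG'y : e₁.symm (G' y) = G p := e₁.left_inv hy.2.1
    -- Envelope principle: the fixed point `G p` is a competitor for every parameter near `p` and is
    -- optimal at `p` itself. This gives the derivative of `u + φ` without differentiating `G`.
    have hmin : IsLocalMin (fun z => ((fun p => u p + φ p) ∘ e₂.symm) z - 2 * (g (G' y, z)).re)
        y := by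
      filter_upwards [(isOpen_chartDomain e₂ hU).mem_nhds hyD.2] with z hz
      have h1 := (hG (e₂.symm z)).2 (G p) (hUV ⟨hy.2.2, hz.2⟩)
      have h4 := hφ p
      have h5 := hφ (e₂.symm z)
      rw [hDu _ hy.2.2 _ hz.2] at h1
      rw [hDu _ hy.2.2 _ hy.1.2] at h4
      simp only [hg, Function.comp, hG'y, ← hp] at h1 ⊢
      linarith
    have h2 := ((ha _ hyD.2).differentiableAt (by simp)).hasFDerivAt.sub
      ((Complex.reCLM.hasFDerivAt.comp y (HasFDerivAt.comp y (f := fun z => (G' y, z))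
        (hses.differentiableAt hS hyD).hasFDerivAt (hasFDerivAt_prodMk_right (G' y) y))).const_mul
          (2 : ℝ))
    have h3 := congrArg (fun L : E →L[ℝ] ℝ => L v) (hmin.hasFDerivAt_eq_zero h2)
    simp at h3
    linarith

end Manifold

lemma fderiv_fderiv_comp_fst {E : Type*} [NormedAddCommGroup E] [NormedSpace ℝ E] {h : E → ℝ}
    {p : E × E} (hh : ContDiffAt ℝ 2 h p.1) (ξ η : E × E) :
    fderiv ℝ (fderiv ℝ (fun p : E × E => h p.1)) p ξ η = fderiv ℝ (fderiv ℝ h) p.1 ξ.1 η.1 := by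
  have h1 : fderiv ℝ (fun p : E × E => h p.1) =ᶠ[𝓝 p]
      fun p => (fderiv ℝ h p.1).comp (ContinuousLinearMap.fst ℝ E E) := by
    filter_upwards [continuousAt_fst.eventually (hh.eventually (by simp))] with z hz
    exact (HasFDerivAt.comp z (hz.differentiableAt (by simp)).hasFDerivAt hasFDerivAt_fst).fderiv
  have h2 := (HasFDerivAt.comp p (differentiableAt_fderiv_of_contDiffAt hh).hasFDerivAt
    hasFDerivAt_fst).clm_comp (hasFDerivAt_const (ContinuousLinearMap.fst ℝ E E) p)
  have h3 : fderiv ℝ (fun p : E × E => (fderiv ℝ h p.1).comp (ContinuousLinearMap.fst ℝ E E)) p = _ :=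
    h2.fderiv
  rw [h1.fderiv_eq, h3]
  simp

/-! ### Functions with small `C²` norm are admissible -/

section Manifold

variable {E : Type*} [NormedAddCommGroup E] [NormedSpace ℂ E]
  {M : Type*} [TopologicalSpace M] [ChartedSpace E M]

variable {κ : TwoForm E M} {D : M → M → ℝ} {V : Set (M × M)} {ψ : M → ℝ} {x : M} {r c : ℝ}

lemma chartBall_mono {r' : ℝ} (h : r' ≤ r) : chartBall E x r' ⊆ chartBall E x r := fun _ hp =>
  ⟨hp.1, Metric.ball_subset_ball h hp.2⟩

variable (E) in
/-- The closed ball of radius `r` about `x`, in the preferred chart at `x`. -/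
def closedChartBall (x : M) (r : ℝ) : Set M :=
  (chartAt E x).symm '' Metric.closedBall (chartAt E x x) r

lemma chartBall_subset_closedChartBall : chartBall E x r ⊆ closedChartBall E x r := fun p hp =>
  ⟨chartAt E x p, Metric.ball_subset_closedBall hp.2, (chartAt E x).left_inv hp.1⟩

lemma closedChartBall_subset {r' : ℝ} (hr : r < r')
    (h : Metric.ball (chartAt E x x) r' ⊆ (chartAt E x).target) :
    closedChartBall E x r ⊆ chartBall E x r' := by
  rintro _ ⟨y, hy, rfl⟩
  have hy' := Metric.closedBall_subset_ball hr hy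
  exact ⟨(chartAt E x).map_target (h hy'), by rwa [mem_preimage, (chartAt E x).right_inv (h hy')]⟩

lemma mem_chartBall_self (hr : 0 < r) : x ∈ chartBall E x r :=
  ⟨mem_chart_source E x, Metric.mem_ball_self hr⟩

variable [FiniteDimensional ℂ E]

lemma isCompact_closedChartBall {r' : ℝ} (hr : r < r')
    (h : Metric.ball (chartAt E x x) r' ⊆ (chartAt E x).target) :
    IsCompact (closedChartBall E x r) := by
  have : FiniteDimensional ℝ E := FiniteDimensional.complexToReal E
  have : ProperSpace E := FiniteDimensional.proper ℝ E
  exact (isCompact_closedBall _ _).image_of_continuousOn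
    ((chartAt E x).continuousOn_symm.mono ((Metric.closedBall_subset_ball hr).trans h))

variable [IsManifold 𝓘(ℂ, E) ω M]

/-- The function `ψ` depends on the first variable only. It perturbs the Hessian in that variable by
less than `c` and does not affect the mixed derivative. -/
lemma IsConvexBall.isAdapted (h : IsConvexBall E D x r c)
    (hV : ∀ p ∈ chartBall E x r, ∀ q ∈ chartBall E x r, (p, q) ∈ V)
    (hψ : ContMDiff 𝓘(ℝ, E) 𝓘(ℝ, ℝ) ∞ ψ) {K : ℝ} (hK : K < c)
    (hb : ∀ y ∈ Metric.ball (chartAt E x x) r, ∀ v,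
      |fderiv ℝ (fderiv ℝ (ψ ∘ (chartAt E x).symm)) y v v| ≤ K * ‖v‖ ^ 2) :
    IsAdapted E D V ψ x r := by
  set e := chartAt E x with he
  have hψe : ∀ y ∈ Metric.ball (e x) r, ContDiffAt ℝ ∞ (ψ ∘ e.symm) y := fun y hy =>
    contDiffAt_comp_symm (chart_mem_atlas E x) (h.subset hy) (hψ _)
  have hF : inChartAt₂ (E := E) (fun p q => D p q + ψ p) x =
      fun p => inChartAt₂ D x p + (ψ ∘ e.symm) p.1 := rfl
  have hs1 : ∀ p ∈ Metric.ball (e x) r ×ˢ Metric.ball (e x) r,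
      ContDiffAt ℝ ∞ (fun p : E × E => (ψ ∘ e.symm) p.1) p := fun p hp =>
    ContDiffAt.comp (g := ψ ∘ e.symm) p (hψe _ hp.1) contDiffAt_fst
  have hD2 : ∀ p ∈ Metric.ball (e x) r ×ˢ Metric.ball (e x) r, ∀ ξ η : E × E,
      fderiv ℝ (fderiv ℝ (inChartAt₂ (fun p q => D p q + ψ p) x)) p ξ η =
        fderiv ℝ (fderiv ℝ (inChartAt₂ D x)) p ξ η +
          fderiv ℝ (fderiv ℝ (ψ ∘ e.symm)) p.1 ξ.1 η.1 := by
    intro p hp ξ η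
    have k1 := (h.smooth p hp).of_le two_le_smooth
    have k2 := (hs1 p hp).of_le two_le_smooth
    have h1 : fderiv ℝ (inChartAt₂ (E := E) (fun p q => D p q + ψ p) x) =ᶠ[𝓝 p]
        fun p => fderiv ℝ (inChartAt₂ D x) p + fderiv ℝ (fun p : E × E => (ψ ∘ e.symm) p.1) p := by
      filter_upwards [k1.eventually (by simp), k2.eventually (by simp)] with z hz hz'
      exact ((hz.differentiableAt (by simp)).hasFDerivAt.add
        (hz'.differentiableAt (by simp)).hasFDerivAt).fderiv
    have h2 : fderiv ℝ (fun p => fderiv ℝ (inChartAt₂ D x) p +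
        fderiv ℝ (fun p : E × E => (ψ ∘ e.symm) p.1) p) p = _ :=
      ((differentiableAt_fderiv_of_contDiffAt k1).hasFDerivAt.add
        (differentiableAt_fderiv_of_contDiffAt k2).hasFDerivAt).fderiv
    rw [h1.fderiv_eq, h2, ← fderiv_fderiv_comp_fst ((hψe _ hp.1).of_le two_le_smooth)]
    rfl
  refine ⟨h.subset, hV, fun p hp => ?_, fun p hp v hv => ?_, fun p hp v hv => ?_⟩
  · rw [hF]
    exact (h.smooth p hp).add (hs1 p hp)
  · rw [hD2 p hp]
    have h1 := h.convex p hp v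
    have h2 := (abs_le.1 (hb _ hp.1 v)).1
    have h3 : 0 < ‖v‖ ^ 2 := by have := norm_pos_iff.2 hv; positivity
    simp only
    nlinarith
  · rw [hD2 p hp]
    have h1 := h.mixed p hp v
    have h3 : 0 < ‖v‖ ^ 2 := by have := norm_pos_iff.2 hv; positivity
    have := h.pos
    simp only [map_zero, add_zero]
    nlinarith

lemma IsCalabiDiastasis.exists_isConvexBall [T2Space M] (hD : IsCalabiDiastasis κ V D) (hκ : IsPositive κ)
    (𝒜 : FiniteAtlas E M) (x : M) :
    ∃ r > 0, ∃ c, ∃ K > 0, IsConvexBall E D x r c ∧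
      (∀ p ∈ chartBall E x r, ∀ q ∈ chartBall E x r, (p, q) ∈ V) ∧
      ∀ y ∈ Metric.ball (chartAt E x x) r, ∀ (ψ : M → ℝ) (ε : ℝ), 0 ≤ ε →
        ContMDiff 𝓘(ℝ, E) 𝓘(ℝ, ℝ) ∞ ψ → c2Norm 𝒜 ψ < ENNReal.ofReal ε →
          ∀ v, |fderiv ℝ (fderiv ℝ (ψ ∘ (chartAt E x).symm)) y v v| ≤ K * ε * ‖v‖ ^ 2 := by
  obtain ⟨U, hU, -, hxU, -, hUV, u, uC, hu, hDu⟩ := hD.local_form x x (hD.diag_subset x)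
  obtain ⟨r, hr, c, hc, hrU⟩ := hu.exists_isConvexBall hU hκ hDu hxU
  obtain ⟨K, hK, hev⟩ := exists_abs_fderiv_fderiv_le 𝒜 x
  obtain ⟨r', hr', hb⟩ := Metric.eventually_nhds_iff_ball.1 hev
  refine ⟨min r r', lt_min hr hr', c, K, hK, hc.mono (min_le_left _ _), fun p hp q hq => ?_,
    fun y hy => hb y (Metric.ball_subset_ball (min_le_right _ _) hy)⟩
  have hm : ∀ p ∈ chartBall E x (min r r'), p ∈ U := fun p hp => by
    have := (hrU (Metric.ball_subset_ball (min_le_left _ _) hp.2)).2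
    rwa [mem_preimage, (chartAt E x).left_inv hp.1] at this
  exact hUV ⟨hm p hp, hm q hq⟩

/-- Functions that are small in the `C²` norm are admissible. -/
lemma IsCalabiDiastasis.exists_isAdmissible [CompactSpace M] [T2Space M]
    (hD : IsCalabiDiastasis κ V D) (hκ : IsPositive κ) (𝒜 : FiniteAtlas E M) :
    ∃ ε : ℝ, 0 < ε ∧ ∀ ψ : M → ℝ, ContMDiff 𝓘(ℝ, E) 𝓘(ℝ, ℝ) ∞ ψ →
      c2Norm 𝒜 ψ < ENNReal.ofReal ε → IsAdmissible E D V ψ := by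
  choose r hr c K hK hc hV hb using hD.exists_isConvexBall hκ 𝒜
  have h4 : ∀ x, r x / 4 < r x := fun x => by linarith [hr x]
  have h2 : ∀ x, r x / 2 < r x := fun x => by linarith [hr x]
  have h42 : ∀ x, r x / 4 < r x / 2 := fun x => by linarith [hr x]
  obtain ⟨t, -, ht⟩ := isCompact_univ.elim_nhds_subcover (fun x : M => chartBall E x (r x / 4))
    fun x _ => (isOpen_chartBall x _).mem_nhds (mem_chartBall_self (by linarith [hr x]))
  have hcov : ∀ q : M, ∃ x ∈ t, q ∈ chartBall E x (r x / 4) := fun q => by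
    simpa using ht (mem_univ q)
  have hAcl : ∀ x, IsClosed (closedChartBall E x (r x / 4)) := fun x =>
    (isCompact_closedChartBall (h4 x) (hc x).subset).isClosed
  have hAB : ∀ x, closedChartBall E x (r x / 4) ⊆ chartBall E x (r x / 2) := fun x =>
    closedChartBall_subset (h42 x) ((Metric.ball_subset_ball (h2 x).le).trans (hc x).subset)
  -- `N` is a neighbourhood of the diagonal such that, for pairs in it, whenever one point lies in a
  -- small ball of the finite cover, the other one lies in the concentric ball of twice the radius.
  -- The closed quarter balls keep it open.
  set N : Set (M × M) := ⋂ x ∈ t,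
    ((univ ×ˢ (closedChartBall E x (r x / 4))ᶜ ∪ chartBall E x (r x / 2) ×ˢ univ) ∩
      ((closedChartBall E x (r x / 4))ᶜ ×ˢ univ ∪ univ ×ˢ chartBall E x (r x / 2))) with hN
  have hNo : IsOpen N := by
    refine isOpen_biInter_finset fun x _ => ?_
    exact ((isOpen_univ.prod (hAcl x).isOpen_compl).union ((isOpen_chartBall x _).prod isOpen_univ)).inter
      (((hAcl x).isOpen_compl.prod isOpen_univ).union (isOpen_univ.prod (isOpen_chartBall x _)))
  have hNmem : ∀ p q, (p, q) ∈ N ↔ ∀ x ∈ t,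
      (q ∈ closedChartBall E x (r x / 4) → p ∈ chartBall E x (r x / 2)) ∧
      (p ∈ closedChartBall E x (r x / 4) → q ∈ chartBall E x (r x / 2)) := by
    intro p q
    simp only [hN, mem_iInter, mem_inter_iff, mem_union, mem_prod, mem_univ, true_and, and_true,
      mem_compl_iff, imp_iff_not_or]
  obtain ⟨c₀, hc₀, hbd⟩ := hD.bounded_below N hNo fun p =>
    (hNmem p p).2 fun x _ => ⟨fun h => hAB x h, fun h => hAB x h⟩
  -- The bound `2 ε < c₀` makes points far from `q` worse competitors than `q` itself, as `ψ`
  -- oscillates by less than `2 ε`. The bounds `K x * ε < c x` preserve convexity in the finitely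
  -- many balls.
  obtain ⟨ε, hε, hε₀, hεt⟩ : ∃ ε : ℝ, 0 < ε ∧ 2 * ε < c₀ ∧ ∀ x ∈ t, K x * ε < c x := by
    have hev : ∀ᶠ ε in 𝓝[>] (0 : ℝ), 0 < ε ∧ 2 * ε < c₀ ∧ ∀ x ∈ t, K x * ε < c x := by
      have hlin : ∀ a b : ℝ, 0 < b → ∀ᶠ ε in 𝓝[>] (0 : ℝ), a * ε < b := fun a b hb => by
        have : Tendsto (fun ε : ℝ => a * ε) (𝓝[>] 0) (𝓝 (a * 0)) :=
          ((continuous_const.mul continuous_id).tendsto 0).mono_left nhdsWithin_le_nhds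
        rw [mul_zero] at this
        exact this.eventually (gt_mem_nhds hb)
      refine (eventually_mem_nhdsWithin).and ((hlin 2 c₀ hc₀).and ?_)
      exact (t.eventually_all).2 fun x _ => hlin _ _ (hc x).pos
    exact hev.exists
  refine ⟨ε, hε, fun ψ hψ hψε => ?_⟩
  have hlt : ∀ x, |ψ x| < ε := abs_lt_of_c2Norm_lt hψε
  have had : ∀ x ∈ t, IsAdapted E D V ψ x (r x) := fun x hx =>
    (hc x).isAdapted (hV x) hψ (hεt x hx) fun y hy => hb x y hy ψ ε hε.le hψ hψε
  have hfar : ∀ p q, (p, q) ∈ V → (p, q) ∉ N → D q q + ψ q < D p q + ψ p := fun p q h h' => by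
    rw [hD.self_eq_zero q]
    linarith [hbd p q h h', (abs_lt.1 (hlt p)).1, (abs_lt.1 (hlt q)).2]
  have hminN : ∀ q z, IsMinimizer D V ψ q z → (z, q) ∈ N := fun q z h => by
    by_contra h'
    exact absurd (h.2 q (hD.diag_subset q)) (not_le.2 (hfar z q h.1 h'))
  refine ⟨fun q => ?_, fun q => ?_, fun z => ?_⟩
  · obtain ⟨x, hx, hq⟩ := hcov q
    set e := chartAt E x with he
    have : FiniteDimensional ℝ E := FiniteDimensional.complexToReal E
    have : ProperSpace E := FiniteDimensional.proper ℝ E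
    have hsub : Metric.closedBall (e x) (r x / 2) ⊆ Metric.ball (e x) (r x) :=
      Metric.closedBall_subset_ball (h2 x)
    have hqr : q ∈ chartBall E x (r x) := chartBall_mono (h4 x).le hq
    have hcont : ContinuousOn (fun y => inChartAt₂ (E := E) (fun p q => D p q + ψ p) x (y, e q))
        (Metric.closedBall (e x) (r x / 2)) := fun y hy =>
      (ContinuousAt.comp (f := fun y : E => (y, e q)) ((had x hx).smooth (y, e q)
        ⟨hsub hy, hqr.2⟩).continuousAt (by fun_prop)).continuousWithinAt
    obtain ⟨y, hy, hmin⟩ := (isCompact_closedBall (e x) (r x / 2)).exists_isMinOn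
      ⟨e x, Metric.mem_closedBall_self (by linarith [hr x])⟩ hcont
    have hval : ∀ p ∈ chartBall E x (r x / 2), D (e.symm y) q + ψ (e.symm y) ≤ D p q + ψ p := by
      intro p hp
      have := hmin (Metric.ball_subset_closedBall hp.2)
      simpa [inChartAt₂, ← he, e.left_inv hp.1, e.left_inv hq.1] using this
    refine ⟨e.symm y, hV x _ ?_ q hqr, fun p hp => ?_⟩
    · exact closedChartBall_subset (h2 x) (hc x).subset ⟨y, hy, rfl⟩
    · by_cases hpN : (p, q) ∈ N
      · exact hval p (((hNmem p q).1 hpN x hx).1 (chartBall_subset_closedChartBall hq))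
      · exact (hval q (chartBall_mono (h42 x).le hq)).trans (hfar p q hp hpN).le
  · obtain ⟨x, hx, hq⟩ := hcov q
    refine ⟨x, r x, had x hx, ?_⟩
    filter_upwards [(isOpen_chartBall x _).mem_nhds hq] with q' hq'
    exact ⟨chartBall_mono (h4 x).le hq', fun z hz => chartBall_mono (h2 x).le
      (((hNmem z q').1 (hminN q' z hz) x hx).1 (chartBall_subset_closedChartBall hq'))⟩
  · obtain ⟨x, hx, hz⟩ := hcov z
    exact ⟨x, r x, had x hx, chartBall_mono (h4 x).le hz, fun q hq => chartBall_mono (h2 x).le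
      (((hNmem z q).1 (hminN q z hq) x hx).2 (chartBall_subset_closedChartBall hz))⟩

end Manifold

lemma wedgePow_comp_apply {E : Type*} [NormedAddCommGroup E] [NormedSpace ℂ E]
    (α : E [⋀^Fin 2]→L[ℝ] ℝ) (L : E →L[ℝ] E) (k : ℕ) (v : Fin k × Fin 2 → E) :
    wedgePow (α.compContinuousLinearMap L) k v = wedgePow α k (fun i => L (v i)) := by
  unfold wedgePow
  refine congrArg _ (Finset.sum_congr rfl fun σ _ => congrArg _ (Finset.prod_congr rfl fun i _ => ?_))
  rw [ContinuousAlternatingMap.compContinuousLinearMap_apply]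
  congr 1
  ext j
  fin_cases j <;> rfl

/-! ### The Legendre transform of an admissible function -/

section Manifold

variable {E : Type*} [NormedAddCommGroup E] [NormedSpace ℂ E]
  {M : Type*} [TopologicalSpace M] [ChartedSpace E M]
  {κ : TwoForm E M} {V : Set (M × M)} {ψ : M → ℝ}

lemma IsCalabiNhd.isCalabiDiastasis (h : IsCalabiNhd κ V) : IsCalabiDiastasis κ V (diastasis κ V) := by
  unfold diastasis
  rw [dif_pos h]
  exact h.choose_spec

lemma isAttainedAt_iff {q z : M} :
    IsAttainedAt κ V ψ q z ↔ IsMinimizer (diastasis κ V) V ψ q z :=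
  and_congr_right fun _ => forall₂_congr fun _ _ => by
    constructor <;> intro h <;> linarith

lemma isAttainedAt_gradientMap {q : M} (h : ∃ z, IsAttainedAt κ V ψ q z) :
    IsAttainedAt κ V ψ q (gradientMap κ V ψ q) := by
  unfold gradientMap
  rw [dif_pos h]
  exact h.choose_spec

/-- The supremum is attained everywhere and equals the continuous function `φ`, which its upper
semicontinuous regularization leaves unchanged. -/
lemma legendre_eq {φ : M → ℝ} {G : M → M} (hG : ∀ q, IsAttainedAt κ V ψ q (G q))
    (hφ : ∀ q, φ q = -(diastasis κ V (G q) q + ψ (G q))) (hc : Continuous φ) (q : M) :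
    legendre κ V (fun p => (ψ p : EReal)) q = (φ q : EReal) := by
  have h1 : (fun q' => ⨆ (p : M) (_ : (p, q') ∈ V), ((-diastasis κ V p q' : ℝ) : EReal) - (ψ p : EReal))
      = fun q' => (φ q' : EReal) := by
    funext q'
    refine le_antisymm (iSup₂_le fun p hp => ?_) ?_
    · have := (hG q').2 p hp
      rw [hφ, ← EReal.coe_sub, EReal.coe_le_coe_iff]
      linarith
    · refine le_iSup₂_of_le (G q') (hG q').1 ?_
      rw [hφ, ← EReal.coe_sub, EReal.coe_le_coe_iff]
      linarith
  unfold legendre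
  rw [h1]
  exact ((continuous_coe_real_ereal.comp hc).tendsto q).limsup_eq

variable [FiniteDimensional ℂ E] [MeasurableSpace E] [BorelSpace E]
  [T2Space M] [CompactSpace M] [MeasurableSpace M] [BorelSpace M] [IsManifold 𝓘(ℂ, E) ω M]

/-- The regularity and the transformation rule of the complex Legendre transform of an admissible
function. -/
lemma IsAdmissible.legendre_transform (hV : IsCalabiNhd κ V)
    (h : IsAdmissible E (diastasis κ V) V ψ) (hψ : ContMDiff 𝓘(ℝ, E) 𝓘(ℝ, ℝ) ∞ ψ) :
    (∀ q : M, ∃! z : M, IsAttainedAt κ V ψ q z) ∧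
      (∃ Φ : M ≃ₘ^∞⟮𝓘(ℝ, E), 𝓘(ℝ, E)⟯ M, ∀ q : M, Φ q = gradientMap κ V ψ q) ∧
      ∃ φ : M → ℝ, (∀ q : M, legendre κ V (fun p => (ψ p : EReal)) q = (φ q : EReal)) ∧
        ContMDiff 𝓘(ℝ, E) 𝓘(ℝ, ℝ) ∞ φ ∧
        pullback (gradientMap κ V ψ) (perturb κ ψ) = perturb κ φ ∧
        (∀ (q : M) (v : Fin (Module.finrank ℂ E) × Fin 2 → TangentSpace 𝓘(ℝ, E) q),
          wedgePow (E := E) (perturb κ ψ (gradientMap κ V ψ q)) (Module.finrank ℂ E)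
              (fun i => mfderiv 𝓘(ℝ, E) 𝓘(ℝ, E) (gradientMap κ V ψ) q (v i)) =
            wedgePow (E := E) (perturb κ φ q) (Module.finrank ℂ E) v) ∧
        (topMeasure (perturb κ ψ)).comap (gradientMap κ V ψ) = topMeasure (perturb κ φ) := by
  have hD := hV.isCalabiDiastasis
  have hex : ∀ q, ∃ z, IsAttainedAt κ V ψ q z := fun q =>
    (h.exists_minimizer q).imp fun _ => isAttainedAt_iff.2
  have hGa : ∀ q, IsAttainedAt κ V ψ q (gradientMap κ V ψ q) := fun q =>
    isAttainedAt_gradientMap (hex q)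
  set G := gradientMap κ V ψ
  have hG : ∀ q, IsMinimizer (diastasis κ V) V ψ q (G q) := fun q => isAttainedAt_iff.1 (hGa q)
  obtain ⟨Φ, hΦ⟩ := exists_diffeomorph_of_bijective (h.isChartDiffeoAt hG)
    ⟨h.injective hG, h.surjective hD hG⟩
  have hΦG : ⇑Φ = G := funext hΦ
  have hGs : ContMDiff 𝓘(ℝ, E) 𝓘(ℝ, E) ∞ G := hΦG ▸ Φ.contMDiff
  set φ : M → ℝ := fun q => -(diastasis κ V (G q) q + ψ (G q)) with hφ
  have hφs : ContMDiff 𝓘(ℝ, E) 𝓘(ℝ, ℝ) ∞ φ := (h.contMDiff_value hG).neg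
  have hpull : pullback G (perturb κ ψ) = perturb κ φ :=
    pullback_perturb hD hG hGs hψ (fun q => rfl) hφs
  refine ⟨fun q => ⟨G q, hGa q, fun z hz => h.unique (isAttainedAt_iff.1 hz) (hG q)⟩, ⟨Φ, hΦ⟩, φ,
    legendre_eq hGa (fun q => rfl) hφs.continuous, hφs, hpull, fun q v => ?_, ?_⟩
  · rw [← hpull]
    exact (wedgePow_comp_apply (E := E) (perturb κ ψ (G q))
      (mfderiv 𝓘(ℝ, E) 𝓘(ℝ, E) G q) _ v).symm
  · rw [← hΦG] at hpull hGs ⊢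
    exact topMeasure_comap Φ.toHomeomorph (hGs.mdifferentiable (by simp)) hpull

end Manifold

/-! ### Complexification of real-analytic functions -/

section Complexification

variable {X : Type*} [NormedAddCommGroup X] [NormedSpace ℂ X]
  {F : Type*} [NormedAddCommGroup F] [NormedSpace ℂ F]

/-- Twice the complex-linear part `v ↦ L v - i L (i v)` of a real-linear map. -/
def holoPart : (X →L[ℝ] F) →L[ℝ] (X →L[ℂ] F) :=
  LinearMap.mkContinuous
    { toFun := fun L =>
        { toFun := fun v => L v - Complex.I • L (Complex.I • v)
          map_add' := fun v w => by simp only [smul_add, map_add]; abel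
          map_smul' := fun a v => by
            have h1 : ∀ w : X, a • w = a.re • w + a.im • (Complex.I • w) := fun w => by
              conv_lhs => rw [← Complex.re_add_im a, add_smul, mul_smul]
              simp
            have h2 : ∀ w : F, a • w = a.re • w + a.im • (Complex.I • w) := fun w => by
              conv_lhs => rw [← Complex.re_add_im a, add_smul, mul_smul]
              simp
            have h3 : Complex.I • a • v = a.re • (Complex.I • v) - a.im • v := by
              rw [smul_comm, h1, ← mul_smul Complex.I Complex.I, Complex.I_mul_I]
              simp [sub_eq_add_neg]
            have h4 : L (a • v) = a.re • L v + a.im • L (Complex.I • v) := by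
              rw [h1, map_add, L.map_smul, L.map_smul]
            have h5 : L (Complex.I • a • v) = a.re • L (Complex.I • v) - a.im • L v := by
              rw [h3, map_sub, L.map_smul, L.map_smul]
            rw [h4, h5, RingHom.id_apply, h2, smul_sub, smul_sub, smul_sub, smul_comm Complex.I a.re,
              smul_comm Complex.I a.im, smul_sub, smul_smul Complex.I Complex.I, Complex.I_mul_I]
            simp only [neg_smul, one_smul, smul_neg]
            abel
          cont := by fun_prop }
      map_add' := fun L L' => by ext v; simp; abel
      map_smul' := fun a L => by
        ext v
        simp [smul_sub, smul_comm a Complex.I] }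
    2 fun L => by
      refine ContinuousLinearMap.opNorm_le_bound _ (by positivity) fun v => ?_
      refine (norm_sub_le _ _).trans ?_
      have h1 := L.le_opNorm v
      have h2 := L.le_opNorm (Complex.I • v)
      rw [norm_smul, Complex.norm_I, one_mul] at h2 ⊢
      linarith

lemma holoPart_apply (L : X →L[ℝ] F) (v : X) : holoPart L v = L v - Complex.I • L (Complex.I • v) :=
  rfl

lemma norm_holoPart_le (L : X →L[ℝ] F) : ‖holoPart L‖ ≤ 2 * ‖L‖ := by
  refine ContinuousLinearMap.opNorm_le_bound _ (by positivity) fun v => ?_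
  rw [holoPart_apply]
  refine (norm_sub_le _ _).trans ?_
  have h1 := L.le_opNorm v
  have h2 := L.le_opNorm (Complex.I • v)
  rw [norm_smul, Complex.norm_I, one_mul] at h2 ⊢
  linarith

variable {E : Type*} [NormedAddCommGroup E] [NormedSpace ℝ E] {a : X →L[ℝ] E} {δ : E →L[ℝ] X}

/-- The map `δ` embeds `E` as a totally real subspace of `X`, and `a` is a real projection onto it
that kills `i δ (E)`. Each slot is precomposed with `a` and made complex linear by `holoPart`. On `δ
(E)` the second term of `holoPart` vanishes, so the values there are the original ones. The
geometric bound on the norm preserves convergence of power series. -/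
lemma exists_complexify_multilinear (h1 : ∀ y, a (δ y) = y) (h2 : ∀ y, a (Complex.I • δ y) = 0)
    (n : ℕ) : ∃ C : (E [×n]→L[ℝ] F) →L[ℝ] (X [×n]→L[ℂ] F),
      (∀ p, ‖C p‖ ≤ (2 * ‖a‖) ^ n * ‖p‖) ∧ ∀ p y, C p (fun i => δ (y i)) = p y := by
  induction n with
  | zero =>
    refine ⟨(((continuousMultilinearCurryFin0 ℂ X F).symm.toContinuousLinearEquiv :
      F →L[ℂ] (X [×0]→L[ℂ] F)).restrictScalars ℝ).comp
      ((continuousMultilinearCurryFin0 ℝ E F).toContinuousLinearEquiv : (E [×0]→L[ℝ] F) →L[ℝ] F),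
      fun p => ?_, fun p y => ?_⟩
    · simp
    · simp
      congr 1
      exact Subsingleton.elim _ _
  | succ n ih =>
    obtain ⟨C, hC, hCδ⟩ := ih
    let T : (E →L[ℝ] (E [×n]→L[ℝ] F)) →L[ℝ] (X →L[ℝ] (X [×n]→L[ℂ] F)) :=
      ((ContinuousLinearMap.compL ℝ X E (X [×n]→L[ℂ] F)).flip a).comp
        (ContinuousLinearMap.compL ℝ E (E [×n]→L[ℝ] F) (X [×n]→L[ℂ] F) C)
    have hT : ∀ S ξ, T S ξ = C (S (a ξ)) := fun S ξ => rfl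
    refine ⟨(((continuousMultilinearCurryLeftEquiv ℂ (fun _ : Fin (n + 1) => X)
      F).symm.toContinuousLinearEquiv : _ →L[ℂ] (X [×(n + 1)]→L[ℂ] F)).restrictScalars ℝ).comp
      (holoPart.comp (T.comp ((continuousMultilinearCurryLeftEquiv ℝ (fun _ : Fin (n + 1) => E)
        F).toContinuousLinearEquiv : (E [×(n + 1)]→L[ℝ] F) →L[ℝ] _))), fun p => ?_, fun p y => ?_⟩
    · have h3 : ‖T p.curryLeft‖ ≤ (2 * ‖a‖) ^ n * ‖p‖ * ‖a‖ := by
        refine ContinuousLinearMap.opNorm_le_bound _ (by positivity) fun ξ => ?_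
        rw [hT]
        refine (hC _).trans ?_
        have h4 : ‖p.curryLeft (a ξ)‖ ≤ ‖p‖ * (‖a‖ * ‖ξ‖) := by
          refine (p.curryLeft.le_opNorm _).trans ?_
          rw [ContinuousMultilinearMap.curryLeft_norm]
          gcongr
          exact a.le_opNorm ξ
        calc (2 * ‖a‖) ^ n * ‖p.curryLeft (a ξ)‖ ≤ (2 * ‖a‖) ^ n * (‖p‖ * (‖a‖ * ‖ξ‖)) := by gcongr
          _ = _ := by ring
      have h5 := norm_holoPart_le (T p.curryLeft)
      simp only [ContinuousLinearMap.comp_apply]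
      calc _ = ‖holoPart (T p.curryLeft)‖ :=
            (continuousMultilinearCurryLeftEquiv ℂ (fun _ : Fin (n + 1) => X) F).symm.norm_map _
        _ ≤ _ := h5
        _ ≤ 2 * ((2 * ‖a‖) ^ n * ‖p‖ * ‖a‖) := by gcongr
        _ = _ := by ring
    · change holoPart (T p.curryLeft) (δ (y 0)) (Fin.tail fun i => δ (y i)) = _
      rw [holoPart_apply, hT, hT, h1, h2, map_zero, map_zero, smul_zero, sub_zero]
      have := hCδ (p.curryLeft (y 0)) (Fin.tail y)
      refine this.trans ?_
      rw [ContinuousMultilinearMap.curryLeft_apply, Fin.cons_self_tail]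

/-- A real-analytic function has a complex-analytic extension. -/
lemma exists_complexify [CompleteSpace F] (h1 : ∀ y, a (δ y) = y) (h2 : ∀ y, a (Complex.I • δ y) = 0)
    {f : E → F} (hf : AnalyticAt ℝ f 0) :
    ∃ g : X → F, AnalyticAt ℂ g 0 ∧ ∀ᶠ y in 𝓝 0, g (δ y) = f y := by
  obtain ⟨p, hp⟩ := hf
  choose C hC hCδ using exists_complexify_multilinear (F := F) h1 h2
  let P : FormalMultilinearSeries ℂ X F := fun n => C n (p n)
  have hP : 0 < P.radius := by
    obtain ⟨R, hR⟩ := hp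
    obtain ⟨r, hr0, hr⟩ := ENNReal.lt_iff_exists_nnreal_btwn.1 (hR.r_pos.trans_le hR.r_le)
    obtain ⟨B, hB, hb⟩ := p.norm_mul_pow_le_of_lt_radius hr
    have hr0' : 0 < (r : ℝ) := by exact_mod_cast hr0
    -- The summand `1` keeps `K` positive even if `a = 0`, so that the radius `r / K` makes sense.
    set K : ℝ := 2 * ‖a‖ + 1 with hK
    have hK0 : 0 < K := by positivity
    have hρ : 0 < (r : ℝ) / K := by positivity
    refine lt_of_lt_of_le ?_ (P.le_radius_of_bound (r := ⟨r / K, hρ.le⟩) B fun n => ?_)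
    · exact ENNReal.coe_pos.2 hρ
    · change ‖P n‖ * ((r : ℝ) / K) ^ n ≤ B
      calc ‖P n‖ * ((r : ℝ) / K) ^ n ≤ ((2 * ‖a‖) ^ n * ‖p n‖) * ((r : ℝ) / K) ^ n := by
            gcongr; exact hC n (p n)
        _ ≤ (K ^ n * ‖p n‖) * ((r : ℝ) / K) ^ n := by gcongr; linarith
        _ = ‖p n‖ * (r : ℝ) ^ n := by rw [div_pow]; field_simp
        _ ≤ B := hb n
  refine ⟨P.sum, (P.hasFPowerSeriesOnBall hP).analyticAt, ?_⟩
  filter_upwards [hp.eventually_hasSum] with y hy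
  rw [zero_add] at hy
  rw [← hy.tsum_eq]
  exact tsum_congr fun n => hCδ n (p n) fun _ => y

end Complexification

/-! ### Primitives of holomorphic families of closed forms -/

section Primitive

variable {X : Type*} [NormedAddCommGroup X] [NormedSpace ℂ X]
  {F : Type*} [NormedAddCommGroup F] [NormedSpace ℂ F] [CompleteSpace F]

/-- The mean of a complex-analytic function over a family of linear contractions is analytic. -/
lemma analyticAt_integral {f : X → F} (hf : AnalyticAt ℂ f 0) {L : ℝ → X →L[ℂ] X}
    (hL : Continuous L) (hL1 : ∀ s ∈ Icc (0 : ℝ) 1, ‖L s‖ ≤ 1) :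
    AnalyticAt ℂ (fun ξ => ∫ s in (0 : ℝ)..1, f (L s ξ)) 0 := by
  obtain ⟨p, R, hp⟩ := hf
  obtain ⟨r, hr0, hr⟩ := ENNReal.lt_iff_exists_nnreal_btwn.1 hp.r_pos
  have hcont : ∀ n, Continuous fun s => (p n).compContinuousLinearMap fun _ => L s := fun n =>
    (ContinuousMultilinearMap.compContinuousLinearMapLRight (E := fun _ : Fin n => X) (p n)).cont.comp
      (continuous_pi fun _ => hL)
  have hnorm : ∀ n, ∀ s ∈ Icc (0 : ℝ) 1, ‖(p n).compContinuousLinearMap fun _ => L s‖ ≤ ‖p n‖ := by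
    intro n s hs
    refine ((p n).norm_compContinuousLinearMap_le _).trans ?_
    rw [Finset.prod_const, Finset.card_univ, Fintype.card_fin]
    exact mul_le_of_le_one_right (norm_nonneg _) (pow_le_one₀ (norm_nonneg _) (hL1 s hs))
  -- Composition with contractions does not increase the norms of the coefficients. The series can
  -- be integrated term by term and keeps the convergence bounds of `p`.
  let Q : FormalMultilinearSeries ℂ X F := fun n =>
    ∫ s in (0 : ℝ)..1, (p n).compContinuousLinearMap fun _ => L s
  have hQ : ∀ n, ‖Q n‖ ≤ ‖p n‖ := fun n => by
    have := intervalIntegral.norm_integral_le_of_norm_le_const (a := (0 : ℝ)) (b := 1) (C := ‖p n‖)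
      (f := fun s => (p n).compContinuousLinearMap fun _ => L s) fun s hs => by
        rw [uIoc_of_le zero_le_one] at hs
        exact hnorm n s (Ioc_subset_Icc_self hs)
    simpa using this
  have hQa : ∀ n ξ, Q n (fun _ => ξ) = ∫ s in (0 : ℝ)..1, p n fun _ => L s ξ := fun n ξ =>
    ((ContinuousMultilinearMap.apply ℂ (fun _ : Fin n => X) F fun _ => ξ).intervalIntegral_comp_comm
      ((hcont n).intervalIntegrable 0 1)).symm
  refine ⟨Q, r, ?_, hr0, fun {ξ} hξ => ?_⟩
  · obtain ⟨B, -, hb⟩ := p.norm_mul_pow_le_of_lt_radius (hr.trans_le hp.r_le)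
    exact Q.le_radius_of_bound B fun n =>
      (mul_le_mul_of_nonneg_right (hQ n) (by positivity)).trans (hb n)
  · simp only [hQa, zero_add]
    have hξr : ‖ξ‖ < r := by
      simpa [edist_zero_right, enorm_eq_nnnorm] using hξ
    have hLξ : ∀ s ∈ Icc (0 : ℝ) 1, ‖L s ξ‖ ≤ ‖ξ‖ := fun s hs =>
      ((L s).le_opNorm ξ).trans (mul_le_of_le_one_left (norm_nonneg _) (hL1 s hs))
    have hLmem : ∀ s ∈ Icc (0 : ℝ) 1, L s ξ ∈ Metric.eball (0 : X) R := fun s hs => by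
      refine Metric.eball_subset_eball hr.le ?_
      simpa [edist_zero_right, enorm_eq_nnnorm] using (hLξ s hs).trans_lt hξr
    refine intervalIntegral.hasSum_integral_of_dominated_convergence
      (fun n _ => ‖p n‖ * (r : ℝ) ^ n) (fun n => ?_) (fun n => ?_) ?_ ?_ ?_
    · exact ((p n).cont.comp (continuous_pi fun _ => hL.clm_apply continuous_const)
        : Continuous fun s => p n fun _ => L s ξ).aestronglyMeasurable
    · refine Eventually.of_forall fun s hs => ?_
      rw [uIoc_of_le zero_le_one] at hs
      refine ((p n).le_opNorm _).trans ?_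
      rw [Finset.prod_const, Finset.card_univ, Fintype.card_fin]
      gcongr
      exact (hLξ s (Ioc_subset_Icc_self hs)).trans hξr.le
    · exact Eventually.of_forall fun s _ => p.summable_norm_mul_pow (hr.trans_le hp.r_le)
    · exact intervalIntegrable_const
    · refine Eventually.of_forall fun s hs => ?_
      rw [uIoc_of_le zero_le_one] at hs
      have := hp.hasSum (hLmem s (Ioc_subset_Icc_self hs))
      rwa [zero_add] at this

variable {Y Z : Type*} [NormedAddCommGroup Y] [NormedSpace ℂ Y] [NormedAddCommGroup Z] [NormedSpace ℂ Z]

/-- A family of closed holomorphic 1-forms in the first variable, which depends holomorphically on the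
second one, has a primitive that is holomorphic in both. -/
lemma exists_partial_primitive {η : Y × Z → Y →L[ℂ] F} (hη : AnalyticAt ℂ η 0)
    (hs : ∀ᶠ ξ in 𝓝 (0 : Y × Z), ∀ u v, fderiv ℂ η ξ (u, 0) v = fderiv ℂ η ξ (v, 0) u) :
    ∃ f : Y × Z → F, AnalyticAt ℂ f 0 ∧ (∀ w, f (0, w) = 0) ∧
      ∀ᶠ ξ in 𝓝 (0 : Y × Z), ∀ u, fderiv ℂ f ξ (u, 0) = η ξ u := by
  -- `L s` contracts the first variable only, so `f` below is the Poincaré primitive along rays in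
  -- `Y`, with the second variable as a parameter.
  let L : ℝ → (Y × Z) →L[ℂ] (Y × Z) := fun s =>
    (s : ℂ) • (ContinuousLinearMap.fst ℂ Y Z).prod 0 +
      (0 : (Y × Z) →L[ℂ] Y).prod (ContinuousLinearMap.snd ℂ Y Z)
  have hLa : ∀ s ξ, L s ξ = ((s : ℂ) • ξ.1, ξ.2) := fun s ξ => by simp [L]
  have hL : Continuous L := by fun_prop
  have hL1 : ∀ s ∈ Icc (0 : ℝ) 1, ‖L s‖ ≤ 1 := fun s hs => by
    refine ContinuousLinearMap.opNorm_le_bound _ zero_le_one fun ξ => ?_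
    rw [hLa, one_mul, Prod.norm_def, Prod.norm_def, norm_smul, Complex.norm_real,
      Real.norm_of_nonneg hs.1]
    exact max_le_max (mul_le_of_le_one_left (norm_nonneg _) hs.2) le_rfl
  let f : Y × Z → F := fun ξ => (∫ s in (0 : ℝ)..1, η (L s ξ)) ξ.1
  have hfa : AnalyticAt ℂ f 0 :=
    ((ContinuousLinearMap.id ℂ (Y →L[ℂ] F)).analyticAt_bilinear _).comp
      ((analyticAt_integral hη hL hL1).prod analyticAt_fst)
  refine ⟨f, hfa, fun w => by simp [f], ?_⟩
  obtain ⟨r, hr, hb⟩ := Metric.eventually_nhds_iff_ball.1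
    (hs.and (hη.eventually_analyticAt.and hfa.eventually_analyticAt))
  filter_upwards [Metric.ball_mem_nhds _ hr] with ξ hξ u
  obtain ⟨z, w⟩ := ξ
  have hmem : ∀ y ∈ Metric.ball (0 : Y) r, (y, w) ∈ Metric.ball (0 : Y × Z) r := fun y hy => by
    simp only [mem_ball_zero_iff, Prod.norm_def, max_lt_iff] at hξ hy ⊢
    exact ⟨hy, hξ.2⟩
  have hz : z ∈ Metric.ball (0 : Y) r := by
    simp only [mem_ball_zero_iff, Prod.norm_def, max_lt_iff] at hξ ⊢
    exact hξ.1
  let dη : Y → Y →L[ℂ] Y →L[ℂ] F := fun y => fderiv ℂ η (y, w) ∘L ContinuousLinearMap.inl ℂ Y Z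
  have hder : ∀ y ∈ Metric.ball (0 : Y) r, HasFDerivAt (fun y => η (y, w)) (dη y) y := fun y hy =>
    HasFDerivAt.comp y (f := fun y : Y => (y, w)) (hb _ (hmem y hy)).2.1.differentiableAt.hasFDerivAt
      (hasFDerivAt_prodMk_left y w)
  have hder' : ∀ y ∈ Metric.ball (0 : Y) r, HasFDerivWithinAt (fun y => η (y, w))
      ((fun y => (dη y).restrictScalars ℝ) y) (Metric.ball (0 : Y) r) y := fun y hy =>
    ((hder y hy).restrictScalars ℝ).hasFDerivWithinAt
  have hprim := (convex_ball (0 : Y)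
    r).hasFDerivWithinAt_curveIntegral_segment_of_hasFDerivWithinAt_symmetric hder' (fun y hy u _ v _ => (hb _ (hmem y hy)).1 u v) (Metric.mem_ball_self hr) hz
  -- For fixed `w` the formula is the integral over the segment from `0` to `y`. Closedness of the
  -- 1-form then makes it a primitive, while analyticity in both variables is known from `hfa`.
  have hfz : ∀ y ∈ Metric.ball (0 : Y) r, f (y, w) = curveIntegral (fun y => η (y, w)) (.segment 0 y) := by
    intro y hy
    rw [curveIntegral_segment]
    have hint : IntervalIntegrable (fun s => η (L s (y, w))) volume 0 1 := by
      refine ContinuousOn.intervalIntegrable fun s hs => ?_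
      rw [uIcc_of_le zero_le_one] at hs
      have hm : L s (y, w) ∈ Metric.ball (0 : Y × Z) r := by
        have := hmem y hy
        rw [mem_ball_zero_iff] at this ⊢
        exact (((L s).le_opNorm _).trans (mul_le_of_le_one_left (norm_nonneg _) (hL1 s hs))).trans_lt this
      exact (ContinuousAt.comp (f := fun s => L s (y, w)) (hb _ hm).2.1.continuousAt
        (hL.clm_apply continuous_const).continuousAt).continuousWithinAt
    have h1 := (ContinuousLinearMap.apply ℂ F y).intervalIntegral_comp_comm hint
    refine h1.symm.trans (intervalIntegral.integral_congr fun s _ => ?_)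
    simp [hLa, AffineMap.lineMap_apply]
  have h1 : HasFDerivAt (fun y => f (y, w)) (η (z, w)) z := by
    have h0 := hprim.hasFDerivAt (Metric.isOpen_ball.mem_nhds hz)
    refine h0.congr_of_eventuallyEq ?_
    filter_upwards [Metric.isOpen_ball.mem_nhds hz] with y hy using hfz y hy
  have h2 := HasFDerivAt.comp z (f := fun y : Y => (y, w))
    (hb _ hξ).2.2.differentiableAt.hasFDerivAt (hasFDerivAt_prodMk_left z w)
  have h3 := congrArg (fun T : Y →L[ℂ] F => T u) (h2.unique h1)
  simpa using h3

end Primitive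

/-! ### Polarization -/

section Polarization

variable {E : Type*} [NormedAddCommGroup E] [NormedSpace ℂ E]

/-- `c` is a complex conjugation on `E`. -/
structure IsConj (c : E →L[ℝ] E) : Prop where
  involutive : ∀ v, c (c v) = v
  map_J : ∀ v, c (J v) = -J (c v)

variable (E) in
lemma exists_isConj [FiniteDimensional ℂ E] : ∃ c : E →L[ℝ] E, IsConj c := by
  have : FiniteDimensional ℝ E := FiniteDimensional.complexToReal E
  let b := Module.finBasis ℂ E
  let c₀ : E →ₗ[ℝ] E :=
    { toFun := fun v => b.equivFun.symm fun i => starRingEnd ℂ (b.equivFun v i)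
      map_add' := fun v w => by
        rw [← map_add]; congr 1; ext i; simp
      map_smul' := fun a v => by
        have h1 : ∀ w : E, a • w = (a : ℂ) • w := fun w => (Complex.coe_smul a w).symm
        rw [RingHom.id_apply, h1, h1, ← map_smul]
        refine congrArg _ (funext fun i => ?_)
        rw [map_smul]
        change starRingEnd ℂ ((a : ℂ) * b.equivFun v i) = (a : ℂ) * starRingEnd ℂ (b.equivFun v i)
        rw [map_mul, Complex.conj_ofReal] }
  have hc₀ : ∀ v, c₀ v = b.equivFun.symm fun i => starRingEnd ℂ (b.equivFun v i) := fun v => rfl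
  refine ⟨LinearMap.toContinuousLinearMap c₀, fun v => ?_, fun v => ?_⟩
  · simp only [LinearMap.coe_toContinuousLinearMap', hc₀]
    rw [LinearEquiv.apply_symm_apply]
    simp
  · simp only [LinearMap.coe_toContinuousLinearMap', hc₀, J_apply]
    rw [← map_smul, ← map_neg]
    congr 1; ext i; simp

/-- The totally real embedding of `E` on which a function on `E × E` restricts to its diagonal. -/
def realEmb (c : E →L[ℝ] E) : E →L[ℝ] E × E := (ContinuousLinearMap.id ℝ E).prod c

lemma realEmb_apply (c : E →L[ℝ] E) (y : E) : realEmb c y = (y, c y) := rfl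

/-- The affine map `(z, w) ↦ (z - x, c (w - x))`. -/
def conjShift (c : E →L[ℝ] E) (x : E) (p : E × E) : E × E := (p.1 - x, c (p.2 - x))

lemma conjShift_diag (c : E →L[ℝ] E) (x y : E) : conjShift c x (y, y) = realEmb c (y - x) := rfl

lemma contDiff_conjShift (c : E →L[ℝ] E) (x : E) : ContDiff ℝ ∞ (conjShift c x) :=
  (contDiff_fst.sub contDiff_const).prodMk (c.contDiff.comp (contDiff_snd.sub contDiff_const))

lemma hasFDerivAt_conjShift (c : E →L[ℝ] E) (x : E) (p : E × E) :
    HasFDerivAt (conjShift c x)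
      ((ContinuousLinearMap.fst ℝ E E).prod (c ∘L ContinuousLinearMap.snd ℝ E E)) p :=
  (hasFDerivAt_fst.sub_const x).prodMk (c.hasFDerivAt.comp p (hasFDerivAt_snd.sub_const x))

variable {F : Type*} [NormedAddCommGroup F] [NormedSpace ℂ F]

lemma hasFDerivAt_comp_conjShift {c : E →L[ℝ] E} {x : E} {p : E × E} {f : E × E → F}
    (hf : DifferentiableAt ℂ f (conjShift c x p)) :
    HasFDerivAt (f ∘ conjShift c x) ((fderiv ℂ f (conjShift c x p)).restrictScalars ℝ ∘L
      ((ContinuousLinearMap.fst ℝ E E).prod (c ∘L ContinuousLinearMap.snd ℝ E E))) p :=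
  HasFDerivAt.comp p (hf.hasFDerivAt.restrictScalars ℝ) (hasFDerivAt_conjShift c x p)

lemma fderiv_comp_conjShift {c : E →L[ℝ] E} {x : E} {p : E × E} {f : E × E → F}
    (hf : DifferentiableAt ℂ f (conjShift c x p)) (ξ : E × E) :
    fderiv ℝ (f ∘ conjShift c x) p ξ = fderiv ℂ f (conjShift c x p) (ξ.1, c ξ.2) := by
  rw [(hasFDerivAt_comp_conjShift hf).fderiv]
  rfl

/-- The conjugation `c` in the second component of `conjShift` turns holomorphy in the second
variable into antiholomorphy. -/
lemma isSesqui_comp_conjShift [CompleteSpace E] {c : E →L[ℝ] E} (hc : IsConj c) (x : E)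
    {f : E × E → ℂ} {T : Set (E × E)} (hf : AnalyticOnNhd ℂ f T) :
    IsSesqui (f ∘ conjShift c x) (conjShift c x ⁻¹' T) := by
  refine ⟨fun p hp => ?_, fun p hp v => ?_, fun p hp v => ?_⟩
  · exact ((((hf _ hp).contDiffAt (n := ∞)).restrict_scalars ℝ).comp p
      (contDiff_conjShift c x).contDiffAt).contDiffWithinAt
  · rw [fderiv_comp_conjShift (hf _ hp).differentiableAt, fderiv_comp_conjShift (hf _ hp).differentiableAt,
      ← smul_eq_mul, ← map_smul]
    simp
  · rw [fderiv_comp_conjShift (hf _ hp).differentiableAt, fderiv_comp_conjShift (hf _ hp).differentiableAt,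
      ← smul_eq_mul, ← map_smul]
    simp only [hc.map_J]
    simp

/-- A complex-analytic function that vanishes on the totally real subspace vanishes. -/
lemma exists_eq_zero_of_realEmb [CompleteSpace E] {c : E →L[ℝ] E} (hc : IsConj c) {r : ℝ} (hr : 0 < r) :
    ∃ r' > 0, ∀ f : E × E → ℂ, AnalyticOnNhd ℂ f (Metric.ball 0 r) →
      (∀ y, realEmb c y ∈ Metric.ball (0 : E × E) r → f (realEmb c y) = 0) →
        ∀ ξ ∈ Metric.ball (0 : E × E) r', f ξ = 0 := by
  have hcont : Continuous (conjShift c 0) := (contDiff_conjShift c 0).continuous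
  have h0 : conjShift c 0 0 = 0 := by simp [conjShift]
  have hinv : ∀ ξ, conjShift c 0 (conjShift c 0 ξ) = ξ := fun ξ => by
    simp [conjShift, hc.involutive]
  have hS : IsOpen (conjShift c 0 ⁻¹' Metric.ball 0 r) := Metric.isOpen_ball.preimage hcont
  -- The involution `conjShift c 0` exchanges the diagonal with the totally real subspace, so
  -- uniqueness near the diagonal for sesquiholomorphic functions applies.
  obtain ⟨ρ, hρ, hb⟩ := Metric.isOpen_iff.1 hS 0 (by simp [h0, hr])
  have h1 : ∀ᶠ ξ in 𝓝 (0 : E × E), conjShift c 0 ξ ∈ Metric.ball (0 : E × E) (ρ / 4) :=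
    hcont.continuousAt.eventually (by rw [h0]; exact Metric.ball_mem_nhds _ (by positivity))
  obtain ⟨r', hr', hb'⟩ := Metric.eventually_nhds_iff_ball.1 h1
  refine ⟨r', hr', fun f hf hf0 ξ hξ => ?_⟩
  have h2 := (isSesqui_comp_conjShift hc 0 hf).eq_zero_of_ball hS (x := 0) hb (fun z hz => ?_) (hb' ξ hξ)
  · simpa [hinv] using h2
  · have h3 : ((z, z) : E × E) ∈ Metric.ball 0 ρ := by
      simpa [mem_ball_zero_iff, Prod.norm_def] using hz
    have h4 := hf0 z (by have := hb h3; rwa [mem_preimage, conjShift_diag, sub_zero] at this)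
    simpa [conjShift_diag] using h4

/-- The projection `(z, w) ↦ (z + c w) / 2` inverts `y ↦ (y, c y)` and kills `i (y, c y)`, because
`c` anticommutes with `i`. -/
lemma exists_complexify_realEmb [CompleteSpace F] {c : E →L[ℝ] E} (hc : IsConj c) {f : E → F}
    (hf : AnalyticAt ℝ f 0) :
    ∃ g : E × E → F, AnalyticAt ℂ g 0 ∧ ∀ᶠ y in 𝓝 0, g (realEmb c y) = f y := by
  let a : E × E →L[ℝ] E := (1 / 2 : ℝ) • (ContinuousLinearMap.fst ℝ E E + c ∘L ContinuousLinearMap.snd ℝ E E)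
  refine exists_complexify (a := a) (δ := realEmb c) (fun y => ?_) (fun y => ?_) hf
  · simp only [a, realEmb_apply]
    change (1 / 2 : ℝ) • (y + c (c y)) = y
    rw [hc.involutive, ← two_smul ℝ y, smul_smul]
    norm_num
  · have := hc.map_J (c y)
    simp only [J_apply, hc.involutive] at this
    simp [a, realEmb_apply, this]

/-- The Hermitian form of a real `(1,1)`-form, made complex bilinear by conjugation. -/
lemma exists_hermitianForm [FiniteDimensional ℂ E] (c : E →L[ℝ] E) (hc : IsConj c) :
    ∃ Λ : (E [⋀^Fin 2]→L[ℝ] ℝ) →L[ℝ] (E →L[ℂ] E →L[ℂ] ℂ), ∀ α : E [⋀^Fin 2]→L[ℝ] ℝ,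
      (∀ v w, α ![J v, J w] = α ![v, w]) → ∀ v w,
        Λ α v (c w) = (α ![v, J w] - Complex.I * α ![v, w]) / 2 := by
  let K : (E [⋀^Fin 2]→L[ℝ] ℝ) →L[ℝ] (E →L[ℝ] E →L[ℝ] ℝ) :=
    (ContinuousLinearMap.compL ℝ E (E [×1]→L[ℝ] ℝ) (E →L[ℝ] ℝ)
      ((continuousMultilinearCurryFin1 ℝ E ℝ).toContinuousLinearEquiv : (E [×1]→L[ℝ] ℝ) →L[ℝ] _)) ∘L
      ((continuousMultilinearCurryLeftEquiv ℝ (fun _ : Fin 2 => E) ℝ).toContinuousLinearEquiv :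
        (E [×2]→L[ℝ] ℝ) →L[ℝ] _) ∘L
      (ContinuousAlternatingMap.toContinuousMultilinearMapCLM ℝ)
  have hK : ∀ α v w, K α v w = α ![v, w] := fun α v w => by
    refine congrArg α ?_
    ext i; fin_cases i <;> rfl
  let Φ : (E →L[ℝ] ℝ) →L[ℝ] (E →L[ℂ] ℂ) :=
    holoPart ∘L ((ContinuousLinearMap.compL ℝ E E ℂ).flip c) ∘L
      (ContinuousLinearMap.compL ℝ E ℝ ℂ Complex.ofRealCLM)
  have hΦ : ∀ ℓ w, Φ ℓ w = ℓ (c w) - Complex.I * ℓ (c (J w)) := fun ℓ w => rfl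
  -- `holoPart` is twice a projection and is applied in both slots, hence the `4`; the factor `i`
  -- normalizes the result to be Hermitian for a real `(1,1)`-form.
  let Λ : (E [⋀^Fin 2]→L[ℝ] ℝ) →L[ℝ] (E →L[ℂ] E →L[ℂ] ℂ) :=
    (1 / (4 * Complex.I) : ℂ) •
      (holoPart ∘L (ContinuousLinearMap.compL ℝ E (E →L[ℝ] ℝ) (E →L[ℂ] ℂ) Φ) ∘L K)
  have hΛ : ∀ α v w, Λ α v w = (1 / (4 * Complex.I) : ℂ) *
      (Φ (K α v) w - Complex.I * Φ (K α (J v)) w) := fun α v w => rfl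
  refine ⟨Λ, fun α hα v w => ?_⟩
  have h1 := hα v w
  have h2 : α ![J v, w] = -α ![v, J w] := by
    have h3 := hα v (J w)
    rw [J_J] at h3
    have h4 : α ![J v, -w] = -α ![J v, w] := by
      rw [← hK, ← hK, map_neg]
    linarith
  have h5 : ∀ v w, α ![v, -w] = -α ![v, w] := fun v w => by rw [← hK, ← hK, map_neg]
  rw [hΛ, hΦ, hΦ, hc.map_J, hc.involutive, hK, hK, hK, hK, h5, h5, h1, h2]
  push_cast
  field_simp
  ring_nf
  simp only [Complex.I_sq]
  ring

end Polarization

section Comp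

variable {𝕜 X F G : Type*} [NontriviallyNormedField 𝕜] [NormedAddCommGroup X] [NormedSpace 𝕜 X]
  [NormedAddCommGroup F] [NormedSpace 𝕜 F] [NormedAddCommGroup G] [NormedSpace 𝕜 G]

lemma _root_.AnalyticAt.clm_apply_const {f : X → F →L[𝕜] G} {x : X} (h : AnalyticAt 𝕜 f x) (v : F) :
    AnalyticAt 𝕜 (fun y => f y v) x :=
  ((ContinuousLinearMap.apply 𝕜 G v).analyticAt _).comp h

end Comp

/-! ### Closedness of the complexified coefficients -/

section Polarization

variable {E : Type*} [NormedAddCommGroup E] [NormedSpace ℂ E]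

lemma form_neg_right (α : E [⋀^Fin 2]→L[ℝ] ℝ) (v w : E) : α ![v, -w] = -α ![v, w] := by
  have e : ∀ x, Function.update ![v, w] 1 x = ![v, x] := fun x => by
    ext i; fin_cases i <;> simp
  have := α.map_update_smul ![v, w] 1 (-1 : ℝ) w
  rw [e, e] at this
  simpa using this

lemma form_swap (α : E [⋀^Fin 2]→L[ℝ] ℝ) (v w : E) : α ![v, w] = -α ![w, v] := by
  have h : α (![w, v] ∘ Equiv.swap 0 1) = -α ![w, v] :=
    α.toAlternatingMap.map_swap ![w, v] (i := 0) (j := 1) (by simp)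
  rw [← h]
  congr 1
  ext i; fin_cases i <;> simp

/-- `D u` stands for the derivative of the form in the direction `u`, and `D u - i D (Ju)` is twice
the `(1,0)`-derivative. The identity is the `(2,1)`-part of `dκ = 0`, assembled from the closedness
relation with `J` inserted in various arguments. -/
lemma closed_hermitian_symm {D : E → E [⋀^Fin 2]→L[ℝ] ℝ}
    (h11 : ∀ u v w, D u ![J v, J w] = D u ![v, w])
    (hcl : ∀ u v w, D u ![v, w] - D v ![u, w] + D w ![u, v] = 0) (u v w : E) :
    (D u ![v, J w] - Complex.I * D u ![v, w]) - Complex.I * (D (J u) ![v, J w] - Complex.I * D (J u) ![v, w])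
      = (D v ![u, J w] - Complex.I * D v ![u, w]) -
        Complex.I * (D (J v) ![u, J w] - Complex.I * D (J v) ![u, w]) := by
  have hJ : ∀ u v w, D u ![v, J w] = -D u ![J v, w] := fun u v w => by
    have := h11 u v (J w)
    rw [J_J, form_neg_right] at this
    linarith
  have e1 := hcl u v (J w)
  have e2 := hcl u v w
  have e3 := hcl (J u) (J v) w
  have e4 := hcl (J u) (J v) (J w)
  rw [h11] at e3 e4
  have e5 := h11 (J u) v w
  have e6 := h11 (J v) u w
  have e9 := h11 (J w) u v
  have e7 := hJ (J u) v w
  have e8 := hJ (J v) u w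
  apply Complex.ext
  · simp [-J_apply]
    linarith
  · simp [-J_apply]
    linarith

/-- The `(1,2)`-part of `dκ = 0`, obtained as the complex conjugate of the `(2,1)`-part by Hermitian
symmetry. -/
lemma closed_hermitian_symm' {D : E → E [⋀^Fin 2]→L[ℝ] ℝ}
    (h11 : ∀ u v w, D u ![J v, J w] = D u ![v, w])
    (hcl : ∀ u v w, D u ![v, w] - D v ![u, w] + D w ![u, v] = 0) (u v w : E) :
    (D u ![w, J v] - Complex.I * D u ![w, v]) + Complex.I * (D (J u) ![w, J v] - Complex.I * D (J u) ![w, v])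
      = (D v ![w, J u] - Complex.I * D v ![w, u]) +
        Complex.I * (D (J v) ![w, J u] - Complex.I * D (J v) ![w, u]) := by
  have h := closed_hermitian_symm h11 hcl u v w
  have hJ : ∀ u v w, D u ![v, J w] = -D u ![J v, w] := fun u v w => by
    have := h11 u v (J w)
    rw [J_J, form_neg_right] at this
    linarith
  have hh : ∀ u v w, D u ![w, J v] = D u ![v, J w] := fun u v w => by
    rw [form_swap, hJ u v w]
  rw [hh u v w, hh (J u) v w, hh v u w, hh (J v) u w, form_swap (D u) w v, form_swap (D (J u)) w v,
    form_swap (D v) w u, form_swap (D (J v)) w u]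
  have h1 := congrArg Complex.re h
  have h2 := congrArg Complex.im h
  simp [-J_apply] at h1 h2
  apply Complex.ext <;> simp [-J_apply] <;> linarith

lemma fderiv_form_apply {κ : E → E [⋀^Fin 2]→L[ℝ] ℝ} {y : E} (hκ : DifferentiableAt ℝ κ y)
    (m : Fin 2 → E) (b : E) : fderiv ℝ (fun y => κ y m) y b = fderiv ℝ κ y b m := by
  have h : fderiv ℝ (fun y => κ y m) y = _ :=
    ((ContinuousAlternatingMap.apply ℝ E ℝ m).hasFDerivAt.comp y hκ.hasFDerivAt).fderiv
  rw [h]; rfl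

lemma extDeriv_two_apply {κ : E → E [⋀^Fin 2]→L[ℝ] ℝ} {y : E} (u v w : E) :
    extDeriv κ y ![u, v, w] =
      fderiv ℝ κ y u ![v, w] - fderiv ℝ κ y v ![u, w] + fderiv ℝ κ y w ![u, v] := by
  have e0 : Fin.removeNth 0 ![u, v, w] = ![v, w] := by ext i; fin_cases i <;> rfl
  have e1 : Fin.removeNth 1 ![u, v, w] = ![u, w] := by ext i; fin_cases i <;> rfl
  have e2 : Fin.removeNth 2 ![u, v, w] = ![u, v] := by ext i; fin_cases i <;> rfl
  rw [extDeriv, ContinuousAlternatingMap.alternatizeUncurryFin_apply, Fin.sum_univ_three, e0, e1, e2]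
  simp [sub_eq_add_neg]

lemma fderiv_realEmb {A F : Type*} [NormedAddCommGroup A] [NormedSpace ℝ A] [NormedAddCommGroup F]
    [NormedSpace ℂ F] {c : E →L[ℝ] E} {H : E × E → F} {Λ : A →L[ℝ] F} {κ : E → A} {x y : E}
    (h : ∀ᶠ z in 𝓝 y, H (realEmb c z) = Λ (κ (x + z))) (hH : DifferentiableAt ℂ H (realEmb c y))
    (hκ : DifferentiableAt ℝ κ (x + y)) (b : E) :
    fderiv ℂ H (realEmb c y) (realEmb c b) = Λ (fderiv ℝ κ (x + y) b) := by
  have k1 : HasFDerivAt (fun y => H (realEmb c y))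
      ((fderiv ℂ H (realEmb c y)).restrictScalars ℝ ∘L realEmb c) y :=
    HasFDerivAt.comp y (hH.hasFDerivAt.restrictScalars ℝ) (realEmb c).hasFDerivAt
  have k2 : HasFDerivAt (fun y => Λ (κ (x + y))) (Λ ∘L fderiv ℝ κ (x + y)) y :=
    Λ.hasFDerivAt.comp y ((hasFDerivAt_comp_add_left x).2 hκ.hasFDerivAt)
  exact congrArg (fun T : E →L[ℝ] F => T b) (k1.unique (k2.congr_of_eventuallyEq h))

variable [FiniteDimensional ℂ E]

/-- The holomorphic extension of the coefficients of a closed real-analytic `(1,1)`-form. -/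
lemma exists_closed_polarization {c : E →L[ℝ] E} (hc : IsConj c) {κ : E → E [⋀^Fin 2]→L[ℝ] ℝ} {x : E}
    (hκ : AnalyticAt ℝ κ x) (h11 : ∀ᶠ y in 𝓝 x, ∀ v w, κ y ![J v, J w] = κ y ![v, w])
    (hcl : ∀ᶠ y in 𝓝 x, extDeriv κ y = 0) :
    ∃ H : E × E → E →L[ℂ] E →L[ℂ] ℂ, AnalyticAt ℂ H 0 ∧
      (∀ᶠ y in 𝓝 0, ∀ v w, H (realEmb c y) v (c w) =
        (κ (x + y) ![v, J w] - Complex.I * κ (x + y) ![v, w]) / 2) ∧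
      (∀ᶠ ξ in 𝓝 0, ∀ u v, fderiv ℂ H ξ (u, 0) v = fderiv ℂ H ξ (v, 0) u) ∧
      ∀ᶠ ξ in 𝓝 0, ∀ u v w, fderiv ℂ H ξ (0, u) w v = fderiv ℂ H ξ (0, v) w u := by
  have : CompleteSpace E := FiniteDimensional.complete ℂ E
  obtain ⟨Λ, hΛ⟩ := exists_hermitianForm c hc
  have hadd : AnalyticAt ℝ (fun y => x + y) (0 : E) := analyticAt_const.add analyticAt_id
  have hκ0 : AnalyticAt ℝ κ (x + 0) := by rwa [add_zero]
  have htend : Tendsto (fun y => x + y) (𝓝 (0 : E)) (𝓝 x) := by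
    have : ContinuousAt (fun y => x + y) (0 : E) := by fun_prop
    simpa [ContinuousAt] using this
  obtain ⟨H, hH, hHe⟩ := exists_complexify_realEmb hc
    (f := fun y => Λ (κ (x + y))) ((ContinuousLinearMap.analyticAt (𝕜 := ℝ)
      (E := E [⋀^Fin 2]→L[ℝ] ℝ) (F := E →L[ℂ] E →L[ℂ] ℂ) Λ (κ (x + 0))).comp (g := Λ)
        (AnalyticAt.comp (f := fun y => x + y) hκ0 hadd))
  have hemb : Tendsto (realEmb c) (𝓝 0) (𝓝 0) := by
    have := (realEmb c).continuous.tendsto 0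
    rwa [map_zero] at this
  have hreal : ∀ᶠ y in 𝓝 (0 : E), ∀ b v w,
      fderiv ℂ H (realEmb c y) (realEmb c b) v (c w) =
        (fderiv ℝ κ (x + y) b ![v, J w] - Complex.I * fderiv ℝ κ (x + y) b ![v, w]) / 2 ∧
      ∀ u v w, fderiv ℝ κ (x + y) u ![J v, J w] = fderiv ℝ κ (x + y) u ![v, w] := by
    filter_upwards [hHe.eventually_nhds, hemb.eventually hH.eventually_analyticAt,
      htend.eventually hκ.eventually_analyticAt, htend.eventually h11.eventually_nhds]
      with y h1 h2 h3 h4 b v w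
    have k6 := fderiv_realEmb (F := E →L[ℂ] E →L[ℂ] ℂ) (Λ := Λ) h1 h2.differentiableAt
      h3.differentiableAt b
    have k3 := congrArg (fun T : E →L[ℂ] E →L[ℂ] ℂ => T v (c w)) k6
    have k4 : ∀ u v w, fderiv ℝ κ (x + y) u ![J v, J w] = fderiv ℝ κ (x + y) u ![v, w] := by
      intro u v w
      rw [← fderiv_form_apply h3.differentiableAt, ← fderiv_form_apply h3.differentiableAt]
      have : (fun y => κ y ![J v, J w]) =ᶠ[𝓝 (x + y)] fun y => κ y ![v, w] := by
        filter_upwards [h4] with z hz using hz v w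
      rw [this.fderiv_eq]
    refine ⟨?_, k4⟩
    have k5 := hΛ (fderiv ℝ κ (x + y) b) (k4 b) v w
    rw [← k5]
    exact k3
  -- The vectors `(u, 0)` and `(0, c u)` are complex combinations of vectors tangent to the totally
  -- real subspace. Complex derivatives of `H` along them are therefore given by real derivatives of
  -- `κ`.
  have hleft : ∀ u : E, ((u, 0) : E × E) =
      (1 / 2 : ℂ) • (realEmb c u - Complex.I • realEmb c (J u)) := fun u => by
    have h1 : u - Complex.I • J u = (2 : ℂ) • u := by
      rw [← J_apply, J_J, sub_neg_eq_add, two_smul]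
    have h2 : c u - Complex.I • c (J u) = 0 := by
      rw [hc.map_J, smul_neg, ← J_apply, J_J]; simp
    simp only [realEmb_apply, Prod.smul_mk, Prod.mk_sub_mk, h1, h2, smul_smul]
    simp
  have hright : ∀ u : E, ((0, c u) : E × E) =
      (1 / 2 : ℂ) • (realEmb c u + Complex.I • realEmb c (J u)) := fun u => by
    have h1 : u + Complex.I • J u = 0 := by rw [← J_apply, J_J, add_neg_cancel]
    have h2 : c u + Complex.I • c (J u) = (2 : ℂ) • c u := by
      rw [hc.map_J, smul_neg, ← J_apply, J_J, neg_neg, two_smul]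
    simp only [realEmb_apply, Prod.smul_mk, Prod.mk_add_mk, h1, h2, smul_smul]
    simp
  have hclosed : ∀ᶠ y in 𝓝 (0 : E), ∀ u v w, fderiv ℝ κ (x + y) u ![v, w] -
      fderiv ℝ κ (x + y) v ![u, w] + fderiv ℝ κ (x + y) w ![u, v] = 0 := by
    filter_upwards [htend.eventually hcl] with y hy u v w
    rw [← extDeriv_two_apply, hy]
    rfl
  have hsymm : ∀ᶠ y in 𝓝 (0 : E), ∀ u v w,
      fderiv ℂ H (realEmb c y) (u, 0) v (c w) = fderiv ℂ H (realEmb c y) (v, 0) u (c w) ∧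
      fderiv ℂ H (realEmb c y) (0, c u) w (c v) = fderiv ℂ H (realEmb c y) (0, c v) w (c u) := by
    filter_upwards [hreal, hclosed] with y h1 h2 u v w
    have h3 := (h1 0 0 0).2
    constructor
    · have k := closed_hermitian_symm h3 h2 u v w
      rw [hleft u, hleft v]
      simp only [map_smul, map_sub, _root_.smul_apply, _root_.sub_apply, smul_eq_mul, (h1 _ _ _).1]
      linear_combination k / 4
    · have k := closed_hermitian_symm' h3 h2 u v w
      rw [hright u, hright v]
      simp only [map_smul, map_add, _root_.smul_apply, _root_.add_apply, smul_eq_mul, (h1 _ _ _).1]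
      linear_combination k / 4
  obtain ⟨r, hr, hb⟩ := Metric.eventually_nhds_iff_ball.1 hH.eventually_analyticAt
  obtain ⟨ρ, hρ, hbρ⟩ := Metric.eventually_nhds_iff_ball.1 hsymm
  -- The symmetries hold on the totally real subspace and are equations between analytic functions,
  -- so they extend to a full neighbourhood.
  obtain ⟨r', hr', hzero⟩ := exists_eq_zero_of_realEmb hc (lt_min hr hρ)
  have han : ∀ η₁ η₂ : E × E, ∀ u₁ u₂ w₁ w₂ : E, AnalyticOnNhd ℂ
      (fun ξ => fderiv ℂ H ξ η₁ u₁ w₁ - fderiv ℂ H ξ η₂ u₂ w₂) (Metric.ball 0 (min r ρ)) := by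
    intro η₁ η₂ u₁ u₂ w₁ w₂ ξ hξ
    have h1 := (hb ξ (Metric.ball_subset_ball (min_le_left _ _) hξ)).fderiv
    have h2 : ∀ (η : E × E) (u w : E), AnalyticAt ℂ (fun ξ => fderiv ℂ H ξ η u w) ξ := fun η u w =>
      ((h1.clm_apply_const η).clm_apply_const u).clm_apply_const w
    exact (h2 _ _ _).sub (h2 _ _ _)
  have hmem : ∀ y, realEmb c y ∈ Metric.ball (0 : E × E) (min r ρ) → y ∈ Metric.ball (0 : E) ρ := by
    intro y hy
    rw [mem_ball_zero_iff, realEmb_apply, Prod.norm_def] at hy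
    exact mem_ball_zero_iff.2 ((le_max_left _ _).trans_lt (hy.trans_le (min_le_right _ _)))
  refine ⟨H, hH, ?_, ?_, ?_⟩
  · filter_upwards [hHe, htend.eventually h11] with y h1 h2 v w
    rw [h1, hΛ _ h2]
  · filter_upwards [Metric.ball_mem_nhds _ hr'] with ξ hξ u v
    ext w
    refine sub_eq_zero.1 (hzero _ (han (u, 0) (v, 0) v u w w) (fun y hy => ?_) ξ hξ)
    have := (hbρ y (hmem y hy) u v (c w)).1
    rw [hc.involutive] at this
    exact sub_eq_zero.2 this
  · filter_upwards [Metric.ball_mem_nhds _ hr'] with ξ hξ u v w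
    refine sub_eq_zero.1 (hzero _ (han (0, u) (0, v) w w v u) (fun y hy => ?_) ξ hξ)
    have := (hbρ y (hmem y hy) (c u) (c v) w).2
    rw [hc.involutive, hc.involutive] at this
    exact sub_eq_zero.2 this

end Polarization

/-! ### Local potentials of closed analytic `(1,1)`-forms -/

section Potential

variable {E : Type*} [NormedAddCommGroup E] [NormedSpace ℂ E]

lemma fderiv_fderiv_apply_const {X F : Type*} [NormedAddCommGroup X] [NormedSpace ℂ X]
    [NormedAddCommGroup F] [NormedSpace ℂ F] [CompleteSpace F] {f : X → F} {ξ : X}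
    (hf : AnalyticAt ℂ f ξ) (a b : X) :
    fderiv ℂ (fun ζ => fderiv ℂ f ζ b) ξ a = fderiv ℂ (fderiv ℂ f) ξ a b := by
  rw [fderiv_clm_apply hf.fderiv.differentiableAt (by fun_prop)]
  simp

lemma fderiv_fderiv_comm {X F : Type*} [NormedAddCommGroup X] [NormedSpace ℂ X]
    [NormedAddCommGroup F] [NormedSpace ℂ F] [CompleteSpace F] {f : X → F} {ξ : X}
    (hf : AnalyticAt ℂ f ξ) (a b : X) :
    fderiv ℂ (fderiv ℂ f) ξ a b = fderiv ℂ (fderiv ℂ f) ξ b a :=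
  (hf.contDiffAt (n := ω)).isSymmSndFDerivAt le_top a b

/-- A holomorphic `∂_z∂_w`-closed bilinear form has a holomorphic potential. -/
lemma exists_mixed_potential [CompleteSpace E] {H : E × E → E →L[ℂ] E →L[ℂ] ℂ} (hH : AnalyticAt ℂ H 0)
    (h1 : ∀ᶠ ξ in 𝓝 0, ∀ u v, fderiv ℂ H ξ (u, 0) v = fderiv ℂ H ξ (v, 0) u)
    (h2 : ∀ᶠ ξ in 𝓝 0, ∀ u v w, fderiv ℂ H ξ (0, u) w v = fderiv ℂ H ξ (0, v) w u) :
    ∃ (U : E × E → ℂ) (A : E × E → E →L[ℂ] ℂ), AnalyticAt ℂ U 0 ∧ AnalyticAt ℂ A 0 ∧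
      ∀ᶠ ξ in 𝓝 0, ∀ u v, fderiv ℂ U ξ (0, v) = A ξ v ∧ fderiv ℂ A ξ (u, 0) v = H ξ u v := by
  obtain ⟨A, hA, hA0, hAd⟩ := exists_partial_primitive hH h1
  obtain ⟨r, hr, hb⟩ := Metric.eventually_nhds_iff_ball.1
    (h2.and (hAd.and (hA.eventually_analyticAt.and hH.eventually_analyticAt)))
  -- To integrate `A` in the second variable it must be closed there. The antisymmetric part of its
  -- `w`-derivative has zero `z`-derivative, by the closedness of `H` in `w`, and it vanishes at `z
  -- = 0`, where `A` was normalized to be zero.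
  have hsymm : ∀ ξ ∈ Metric.ball (0 : E × E) r, ∀ u v,
      fderiv ℂ A ξ (0, u) v = fderiv ℂ A ξ (0, v) u := by
    rintro ⟨z, w⟩ hξ u v
    have hmem : ∀ y ∈ Metric.ball (0 : E) r, (y, w) ∈ Metric.ball (0 : E × E) r := fun y hy => by
      simp only [mem_ball_zero_iff, Prod.norm_def, max_lt_iff] at hξ hy ⊢
      exact ⟨hy, hξ.2⟩
    have hz : z ∈ Metric.ball (0 : E) r := by
      simp only [mem_ball_zero_iff, Prod.norm_def, max_lt_iff] at hξ ⊢
      exact hξ.1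
    have hmix : ∀ ξ ∈ Metric.ball (0 : E × E) r, ∀ a u v,
        fderiv ℂ (fderiv ℂ A) ξ (a, 0) (0, u) v = fderiv ℂ H ξ (0, u) a v := by
      intro ξ hξ a u v
      have e : (fun ζ => fderiv ℂ A ζ (a, 0)) =ᶠ[𝓝 ξ] fun ζ => H ζ a := by
        filter_upwards [Metric.isOpen_ball.mem_nhds hξ] with ζ hζ using (hb ζ hζ).2.1 a
      rw [fderiv_fderiv_comm (hb ξ hξ).2.2.1, ← fderiv_fderiv_apply_const (hb ξ hξ).2.2.1, e.fderiv_eq,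
        fderiv_clm_apply (hb ξ hξ).2.2.2.differentiableAt (by fun_prop)]
      simp
    have hder : ∀ y ∈ Metric.ball (0 : E) r, ∀ u v, HasFDerivAt (fun y => fderiv ℂ A (y, w) (0, u) v)
        (((ContinuousLinearMap.apply ℂ ℂ v) ∘L (fderiv ℂ (fderiv ℂ A) (y, w)).flip (0, u)) ∘L
          ContinuousLinearMap.inl ℂ E E) y := by
      intro y hy u v
      have k1 := (hb _ (hmem y hy)).2.2.1
      have k2 : HasFDerivAt (fun ζ => fderiv ℂ A ζ (0, u))
          ((fderiv ℂ (fderiv ℂ A) (y, w)).flip (0, u)) (y, w) := by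
        have := k1.fderiv.differentiableAt.hasFDerivAt.clm_apply (hasFDerivAt_const ((0, u) : E × E) _)
        refine this.congr_fderiv ?_
        ext <;> simp
      exact HasFDerivAt.comp y (f := fun y : E => (y, w))
        (HasFDerivAt.comp (y, w) (ContinuousLinearMap.apply ℂ ℂ v).hasFDerivAt k2)
        (hasFDerivAt_prodMk_left y w)
    have hq : ∀ y ∈ Metric.ball (0 : E) r,
        HasFDerivAt (fun y => fderiv ℂ A (y, w) (0, u) v - fderiv ℂ A (y, w) (0, v) u)
          (0 : E →L[ℂ] ℂ) y := by
      intro y hy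
      refine ((hder y hy u v).sub (hder y hy v u)).congr_fderiv ?_
      ext a
      have k1 := hmix _ (hmem y hy) a u v
      have k2 := hmix _ (hmem y hy) a v u
      have k3 := (hb _ (hmem y hy)).1 u v a
      simp [k1, k2, k3]
    have hA0' : ∀ u, fderiv ℂ A (0, w) (0, u) = 0 := by
      intro u
      have k1 := HasFDerivAt.comp w (f := fun w : E => ((0 : E), w))
        (hb _ (hmem 0 (Metric.mem_ball_self hr))).2.2.1.differentiableAt.hasFDerivAt
        (hasFDerivAt_prodMk_right 0 w)
      have k2 : HasFDerivAt (A ∘ fun w : E => ((0 : E), w)) (0 : E →L[ℂ] E →L[ℂ] ℂ) w := by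
        have : (A ∘ fun w : E => ((0 : E), w)) = fun _ => 0 := funext hA0
        rw [this]
        exact hasFDerivAt_const _ _
      simpa using congrArg (fun T : E →L[ℂ] E →L[ℂ] ℂ => T u) (k1.unique k2)
    have hconst := (convex_ball (0 : E) r).is_const_of_fderivWithin_eq_zero (𝕜 := ℂ)
      (f := fun y => fderiv ℂ A (y, w) (0, u) v - fderiv ℂ A (y, w) (0, v) u)
      (fun y hy => (hq y hy).differentiableAt.differentiableWithinAt)
      (fun y hy => by
        rw [fderivWithin_of_isOpen Metric.isOpen_ball hy]; exact (hq y hy).fderiv)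
      hz (Metric.mem_ball_self hr)
    simp only [hA0', _root_.zero_apply, sub_zero] at hconst
    exact sub_eq_zero.1 hconst
  have hsw : ∀ ξ : E × E, HasFDerivAt (Prod.swap : E × E → E × E)
      ((ContinuousLinearEquiv.prodComm ℂ E E : E × E →L[ℂ] E × E)) ξ := fun ξ =>
    (ContinuousLinearEquiv.prodComm ℂ E E).hasFDerivAt
  have hswa : ∀ ξ : E × E, AnalyticAt ℂ (Prod.swap : E × E → E × E) ξ := fun ξ =>
    analyticAt_snd.prod analyticAt_fst
  have hswb : ∀ ξ ∈ Metric.ball (0 : E × E) r, ξ.swap ∈ Metric.ball (0 : E × E) r := fun ξ hξ => by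
    rw [mem_ball_zero_iff, Prod.norm_def] at hξ ⊢
    rwa [Prod.fst_swap, Prod.snd_swap, max_comm]
  have hAs : AnalyticAt ℂ (fun ξ : E × E => A ξ.swap) 0 :=
    AnalyticAt.comp (g := A) (f := Prod.swap) hA (hswa 0)
  have hAsd : ∀ ξ ∈ Metric.ball (0 : E × E) r, ∀ u v,
      fderiv ℂ (fun ξ : E × E => A ξ.swap) ξ (u, 0) v = fderiv ℂ A ξ.swap (0, u) v := by
    intro ξ hξ u v
    have k : fderiv ℂ (fun ξ : E × E => A ξ.swap) ξ = _ :=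
      (HasFDerivAt.comp ξ (hb _ (hswb ξ hξ)).2.2.1.differentiableAt.hasFDerivAt (hsw ξ)).fderiv
    rw [k]
    rfl
  -- After exchanging the variables, the primitive in the second variable is the same construction
  -- as in the first.
  obtain ⟨f, hf, -, hfd⟩ := exists_partial_primitive hAs (by
    filter_upwards [Metric.ball_mem_nhds _ hr] with ξ hξ u v
    rw [hAsd ξ hξ, hAsd ξ hξ]
    exact hsymm _ (hswb ξ hξ) u v)
  have ht : Tendsto (Prod.swap : E × E → E × E) (𝓝 0) (𝓝 0) := (hswa 0).continuousAt
  refine ⟨fun ξ => f ξ.swap, A, AnalyticAt.comp (g := f) (f := Prod.swap) hf (hswa 0), hA, ?_⟩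
  filter_upwards [ht.eventually hfd, ht.eventually hf.eventually_analyticAt, hAd] with ξ k1 k2 k3 u v
  refine ⟨?_, by rw [k3 u]⟩
  have k : fderiv ℂ (fun ξ : E × E => f ξ.swap) ξ = _ :=
    (HasFDerivAt.comp ξ k2.differentiableAt.hasFDerivAt (hsw ξ)).fderiv
  rw [k]
  exact k1 v

lemma IsSesqui.half_add {g g' : E × E → ℂ} {S : Set (E × E)} (h : IsSesqui g S) (h' : IsSesqui g' S)
    (hS : IsOpen S) : IsSesqui (fun p => (g p + g' p) / 2) S := by
  have e : ∀ p ∈ S, ∀ η, fderiv ℝ (fun p => (g p + g' p) / 2) p η =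
      (fderiv ℝ g p η + fderiv ℝ g' p η) / 2 := fun p hp η => by
    have k : fderiv ℝ (fun p => (g p + g' p) / 2) p = _ :=
      (((h.differentiableAt hS hp).hasFDerivAt.add
        (h'.differentiableAt hS hp).hasFDerivAt).mul_const (2 : ℂ)⁻¹).fderiv
    rw [k]
    simp; ring
  refine ⟨(h.contDiffOn.add h'.contDiffOn).div_const 2, fun p hp v => ?_, fun p hp v => ?_⟩
  · rw [e p hp, e p hp, h.left p hp, h'.left p hp]; ring
  · rw [e p hp, e p hp, h.right p hp, h'.right p hp]; ring

lemma IsSesqui.fderiv_fderiv_half_add {g g' : E × E → ℂ} {S : Set (E × E)} (h : IsSesqui g S)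
    (h' : IsSesqui g' S) (hS : IsOpen S) {p : E × E} (hp : p ∈ S) (ξ η : E × E) :
    fderiv ℝ (fderiv ℝ (fun p => (g p + g' p) / 2)) p ξ η =
      (fderiv ℝ (fderiv ℝ g) p ξ η + fderiv ℝ (fderiv ℝ g') p ξ η) / 2 := by
  have e : fderiv ℝ (fun p => (g p + g' p) / 2) =ᶠ[𝓝 p]
      fun p => (1 / 2 : ℝ) • (fderiv ℝ g p + fderiv ℝ g' p) := by
    filter_upwards [hS.mem_nhds hp] with q hq
    have k : fderiv ℝ (fun p => (g p + g' p) / 2) q = _ :=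
      (((h.differentiableAt hS hq).hasFDerivAt.add
        (h'.differentiableAt hS hq).hasFDerivAt).mul_const (2 : ℂ)⁻¹).fderiv
    rw [k]
    refine ContinuousLinearMap.ext fun η => ?_
    simp
  have k : fderiv ℝ (fun p => (1 / 2 : ℝ) • (fderiv ℝ g p + fderiv ℝ g' p)) p = _ :=
    (((h.differentiableAt_fderiv hS hp).hasFDerivAt.add
      (h'.differentiableAt_fderiv hS hp).hasFDerivAt).const_smul (1 / 2 : ℝ)).fderiv
  rw [e.fderiv_eq, k]
  simp; ring

lemma IsSesqui.fderiv_fderiv_conj_swap {g : E × E → ℂ} {S : Set (E × E)} (h : IsSesqui g S)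
    (hS : IsOpen S) {p : E × E} (hp : p.swap ∈ S) (ξ η : E × E) :
    fderiv ℝ (fderiv ℝ (fun p : E × E => starRingEnd ℂ (g p.swap))) p ξ η =
      starRingEnd ℂ (fderiv ℝ (fderiv ℝ g) p.swap ξ.swap η.swap) := by
  have hS' : IsOpen (Prod.swap ⁻¹' S) := hS.preimage continuous_swap
  have e : (fun p => fderiv ℝ (fun p : E × E => starRingEnd ℂ (g p.swap)) p η) =ᶠ[𝓝 p]
      fun p => starRingEnd ℂ ((fun q => fderiv ℝ g q η.swap) p.swap) := by
    filter_upwards [hS'.mem_nhds hp] with q hq using h.fderiv_conj_swap hS hq η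
  rw [← (h.conj_swap hS).fderiv_fderiv_apply hS' hp, e.fderiv_eq,
    (h.dir hS η.swap).fderiv_conj_swap hS hp, h.fderiv_fderiv_apply hS hp]

variable [FiniteDimensional ℂ E]

/-- A closed real-analytic `(1,1)`-form has a real-analytic potential, which has a polarization. -/
lemma exists_flat_potential {κ : E → E [⋀^Fin 2]→L[ℝ] ℝ} {x : E}
    (hκ : AnalyticAt ℝ κ x) (h11 : ∀ᶠ y in 𝓝 x, ∀ v w, κ y ![J v, J w] = κ y ![v, w])
    (hcl : ∀ᶠ y in 𝓝 x, extDeriv κ y = 0) :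
    ∃ r > 0, ∃ (g : E × E → ℂ) (u : E → ℝ), IsSesqui g (Metric.ball x r ×ˢ Metric.ball x r) ∧
      (∀ y ∈ Metric.ball x r, g (y, y) = u y) ∧ AnalyticOnNhd ℝ u (Metric.ball x r) ∧
      ∀ y ∈ Metric.ball x r, ddbarFlat u y = κ y := by
  have : CompleteSpace E := FiniteDimensional.complete ℂ E
  obtain ⟨c, hc⟩ := exists_isConj E
  obtain ⟨H, hH, hHκ, h1, h2⟩ := exists_closed_polarization hc hκ h11 hcl
  obtain ⟨U, A, hU, hA, hUA⟩ := exists_mixed_potential hH h1 h2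
  obtain ⟨ρ, hρ, hb⟩ := Metric.eventually_nhds_iff_ball.1
    (hUA.and (hU.eventually_analyticAt.and hA.eventually_analyticAt))
  have hτ : Continuous (conjShift c x) := (contDiff_conjShift c x).continuous
  set S := conjShift c x ⁻¹' Metric.ball 0 ρ with hS
  have hSo : IsOpen S := Metric.isOpen_ball.preimage hτ
  have hxS : (x, x) ∈ S := by simp [hS, conjShift, hρ]
  set g₀ : E × E → ℂ := U ∘ conjShift c x with hg₀
  have hs₀ : IsSesqui g₀ S := isSesqui_comp_conjShift hc x fun ξ hξ => (hb ξ hξ).2.1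
  have hmix : ∀ p ∈ S, ∀ v w, fderiv ℝ (fderiv ℝ g₀) p (v, 0) (0, w) = H (conjShift c x p) v (c w) := by
    intro p hp v w
    have e : (fun q => fderiv ℝ g₀ q (0, w)) =ᶠ[𝓝 p] (fun ξ => A ξ (c w)) ∘ conjShift c x := by
      filter_upwards [hSo.mem_nhds hp] with q hq
      rw [hg₀, fderiv_comp_conjShift (hb _ hq).2.1.differentiableAt]
      exact ((hb _ hq).1 0 (c w)).1
    have hA' : AnalyticAt ℂ (fun ξ => A ξ (c w)) (conjShift c x p) := (hb _ hp).2.2.clm_apply_const _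
    rw [← hs₀.fderiv_fderiv_apply hSo hp, e.fderiv_eq, fderiv_comp_conjShift hA'.differentiableAt,
      fderiv_clm_apply (hb _ hp).2.2.differentiableAt (by fun_prop)]
    simpa using ((hb _ hp).1 v (c w)).2
  have htend : Tendsto (fun y => y - x) (𝓝 x) (𝓝 0) := by
    have : ContinuousAt (fun y => y - x) x := by fun_prop
    simpa [ContinuousAt] using this
  obtain ⟨r₁, hr₁, hb₁⟩ := Metric.isOpen_iff.1 hSo _ hxS
  obtain ⟨r₂, hr₂, hb₂⟩ := Metric.eventually_nhds_iff_ball.1 ((htend.eventually hHκ).and h11)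
  set r := min r₁ r₂
  have hr : 0 < r := lt_min hr₁ hr₂
  set B := Metric.ball x r with hB
  have hBS : B ×ˢ B ⊆ S := by
    rw [hB, ball_prod_same]
    exact (Metric.ball_subset_ball (min_le_left _ _)).trans hb₁
  have hBo : IsOpen (B ×ˢ B) := Metric.isOpen_ball.prod Metric.isOpen_ball
  have hs₁ : IsSesqui g₀ (B ×ˢ B) := hs₀.mono hBS
  -- The potential must be real. Averaging `g₀` with its conjugate swap gives a function that is
  -- real on the diagonal, and Hermitian symmetry of `κ` leaves the mixed derivatives there
  -- unchanged.
  have hs₂ : IsSesqui (fun p => starRingEnd ℂ (g₀ p.swap)) (B ×ˢ B) :=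
    (hs₁.conj_swap hBo).mono fun p hp => ⟨hp.2, hp.1⟩
  have hs := hs₁.half_add hs₂ hBo
  have hdiag' : ∀ y : E, (g₀ (y, y) + starRingEnd ℂ (g₀ (Prod.swap (y, y)))) / 2 =
      ((g₀ (y, y)).re : ℂ) := fun y => by
    rw [Prod.swap_prod_mk, Complex.add_conj]
    push_cast; ring
  refine ⟨r, hr, _, fun y => (g₀ (y, y)).re, hs, fun y _ => hdiag' y, fun y hy => ?_, fun y hy => ?_⟩
  · have hyS : (y, y) ∈ S := hBS ⟨hy, hy⟩
    have k1 : AnalyticAt ℝ U (realEmb c (y - x)) :=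
      ((hb _ hyS).2.1).restrictScalars
    have k2 : AnalyticAt ℝ (fun y => realEmb c (y - x)) y :=
      AnalyticAt.comp (g := realEmb c) (f := fun y => y - x) ((realEmb c).analyticAt _)
        (analyticAt_id.sub analyticAt_const)
    exact AnalyticAt.comp (g := Complex.reCLM) (f := fun y => g₀ (y, y)) (Complex.reCLM.analyticAt _)
      (AnalyticAt.comp (g := U) (f := fun y => realEmb c (y - x)) k1 k2)
  · ext m
    have hm : m = ![m 0, m 1] := by ext i; fin_cases i <;> rfl
    have hyB : (y, y) ∈ B ×ˢ B := ⟨hy, hy⟩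
    obtain ⟨hκy, hy11⟩ := hb₂ y (Metric.ball_subset_ball (min_le_right _ _) hy)
    simp only [add_sub_cancel] at hκy
    have hJ : ∀ v w, κ y ![w, J v] = κ y ![v, J w] := fun v w => by
      have := hy11 v (J w)
      rw [J_J, form_neg_right, form_swap (κ y) (J v)] at this
      linarith
    have hmixy : ∀ v w, fderiv ℝ (fderiv ℝ (fun p => (g₀ p + starRingEnd ℂ (g₀ p.swap)) / 2)) (y, y)
        (0, w) (v, 0) = (κ y ![v, J w] - Complex.I * κ y ![v, w]) / 2 := by
      intro v w
      rw [hs₁.fderiv_fderiv_half_add hs₂ hBo hyB, hs₁.symm_fderiv hBo hyB (0, w) (v, 0),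
        hs₀.fderiv_fderiv_conj_swap hSo (p := (y, y)) (hBS hyB)]
      change (_ + starRingEnd ℂ (fderiv ℝ (fderiv ℝ g₀) (y, y) (w, 0) (0, v))) / 2 = _
      rw [hmix _ (hBS hyB), hmix _ (hBS hyB), conjShift_diag, hκy, hκy, hJ v w, form_swap (κ y) w v]
      simp only [map_div₀, map_sub, map_mul, Complex.conj_I, Complex.conj_ofReal, map_ofNat]
      push_cast
      ring
    have h01 := form_swap (κ y) (m 1) (m 0)
    rw [hm, hs.ddbarFlat_diag hBo hyB (Eventually.of_forall hdiag'), hmixy, hmixy]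
    simp
    linarith

end Potential

/-! ### Holomorphy from the Cauchy–Riemann relations -/

section Flat

variable {E F : Type*} [NormedAddCommGroup E] [NormedSpace ℂ E] [NormedAddCommGroup F] [NormedSpace ℂ F]

lemma differentiableAt_complex_of_J {f : E → F} {x : E} (hf : DifferentiableAt ℝ f x)
    (hJ : ∀ v, fderiv ℝ f x (J v) = Complex.I • fderiv ℝ f x v) : DifferentiableAt ℂ f x := by
  let L : E →L[ℂ] F :=
    { toFun := fderiv ℝ f x
      map_add' := fun v w => map_add _ v w
      map_smul' := fun c v => by
        have h1 : c • v = c.re • v + c.im • J v := by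
          conv_lhs => rw [← Complex.re_add_im c]
          rw [add_smul, mul_smul, J_apply, Complex.coe_smul, Complex.coe_smul]
        have h2 : ∀ z : F, c • z = c.re • z + c.im • (Complex.I • z) := fun z => by
          conv_lhs => rw [← Complex.re_add_im c]
          rw [add_smul, mul_smul, Complex.coe_smul, Complex.coe_smul]
        rw [h1, map_add, map_smul, map_smul, hJ]
        exact (h2 _).symm
      cont := (fderiv ℝ f x).continuous }
  refine (differentiableAt_iff_restrictScalars ℝ hf).2 ⟨L, ?_⟩
  ext v
  rfl

namespace IsSesqui

variable {g : E × E → ℂ} {S : Set (E × E)} {p : E × E}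

lemma differentiableAt_left (h : IsSesqui g S) (hS : IsOpen S) (hp : p ∈ S) :
    DifferentiableAt ℂ (fun z => g (z, p.2)) p.1 := by
  have h1 := HasFDerivAt.comp p.1 (f := fun z : E => (z, p.2))
    (h.differentiableAt hS hp).hasFDerivAt (hasFDerivAt_prodMk_left p.1 p.2)
  refine differentiableAt_complex_of_J h1.differentiableAt fun v => ?_
  have h2 : fderiv ℝ (fun z => g (z, p.2)) p.1 = _ := h1.fderiv
  rw [h2]
  exact h.left p hp v

lemma differentiableAt_right (h : IsSesqui g S) (hS : IsOpen S) (hp : p ∈ S) :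
    DifferentiableAt ℂ (fun w => starRingEnd ℂ (g (p.1, w))) p.2 := by
  have h1 := Complex.conjCLE.hasFDerivAt.comp p.2 (HasFDerivAt.comp p.2 (f := fun z : E => (p.1, z))
    (h.differentiableAt hS hp).hasFDerivAt (hasFDerivAt_prodMk_right p.1 p.2))
  refine differentiableAt_complex_of_J (f := fun w => starRingEnd ℂ (g (p.1, w)))
    h1.differentiableAt fun v => ?_
  have h2 : fderiv ℝ (fun w => starRingEnd ℂ (g (p.1, w))) p.2 = _ := h1.fderiv
  rw [h2]
  have h3 := congrArg (starRingEnd ℂ) (h.right p hp v)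
  refine h3.trans ?_
  simp

end IsSesqui

end Flat

/-! ### Polarized potentials on the manifold -/

section Manifold

variable {E : Type*} [NormedAddCommGroup E] [NormedSpace ℂ E]
  {M : Type*} [TopologicalSpace M] [ChartedSpace E M]
  {κ : TwoForm E M} {U U' : Set M} {u : M → ℝ} {uC : M → M → ℂ}

lemma IsPolarizedPotential.mono (h : IsPolarizedPotential κ U u uC) (hU : U' ⊆ U) :
    IsPolarizedPotential κ U' u uC :=
  ⟨h.analytic.mono hU, fun x hx => h.potential x (hU hx), h.smooth.mono (prod_mono hU hU),
    fun w hw => (h.holo w (hU hw)).mono hU, fun z hz => (h.antiholo z (hU hz)).mono hU,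
    fun z hz => h.diag z (hU hz)⟩

variable [IsManifold 𝓘(ℂ, E) ω M] {e e' : OpenPartialHomeomorph M E}

/-- A 2-form is determined at a point by its expression in a chart. -/
lemma eq_of_inChart_eq (he : e ∈ atlas E M) {x : M} (hx : x ∈ e.source) {α β : TwoForm E M}
    (h : inChart e α (e x) = inChart e β (e x)) : α x = β x := by
  have key : ∀ γ : TwoForm E M, (γ x : E [⋀^Fin 2]→L[ℝ] ℝ) =
      (inChart e γ (e x)).compContinuousLinearMap
        (fderiv ℝ (e ∘ id ∘ (chartAt E x).symm) (chartAt E x x)) := fun γ => by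
    have hxx : (chartAt E x).symm (chartAt E x x) = x := (chartAt E x).left_inv (mem_chart_source E x)
    have h1 := inChart_pullback (G := id) (chart_mem_atlas E x) he (mem_chart_target E x)
      mdifferentiableAt_id (by rw [hxx]; exact hx) γ
    rw [pullback_id, inChart_chartAt] at h1
    rw [h1]
    simp only [id, hxx]
    rfl
  refine (key α).trans (.trans ?_ (key β).symm)
  rw [h]

/-- The differentials of the transition maps commute with `J`, so the type does not depend on the
chart. -/
lemma inChart_type_one_one (hκ : ∀ (x : M) (v w : TangentSpace 𝓘(ℝ, E) x),
    κ x ![tangentJ x v, tangentJ x w] = κ x ![v, w]) (he : e ∈ atlas E M) {y : E}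
    (hy : y ∈ e.target) (v w : E) : inChart e κ y ![J v, J w] = inChart e κ y ![v, w] := by
  have hJ := (eventually_fderiv_transition_J he (chart_mem_atlas E (e.symm y)) hy
    (mem_chart_source E _)).self_of_nhds
  have key : ∀ (α : E [⋀^Fin 2]→L[ℝ] ℝ) (L : E →L[ℝ] E), (∀ v w, α ![J v, J w] = α ![v, w]) →
      (∀ v, L (J v) = J (L v)) →
      α.compContinuousLinearMap L ![J v, J w] = α.compContinuousLinearMap L ![v, w] := by
    intro α L hα hL
    have hc : ∀ a b : E, α.compContinuousLinearMap L ![a, b] = α ![L a, L b] := fun a b => by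
      rw [ContinuousAlternatingMap.compContinuousLinearMap_apply]
      congr 1
      ext j
      fin_cases j <;> rfl
    rw [hc, hc, hL, hL, hα]
  rw [inChart_eq he hy]
  exact key _ _ (hκ (e.symm y)) hJ

lemma isPolarizedPotential_of_flat (he : e ∈ atlas E M) {B : Set E} (hB : IsOpen B)
    {g : E × E → ℂ} {u : E → ℝ} (hg : IsSesqui g (B ×ˢ B))
    (hd : ∀ y ∈ B, g (y, y) = u y) (hu : AnalyticOnNhd ℝ u B)
    (hκ : ∀ y ∈ B, ddbarFlat u y = inChart e κ y) :
    IsPolarizedPotential κ (e.source ∩ e ⁻¹' B) (u ∘ e) (fun z w => g (e z, e w)) := by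
  have hsm : ∀ x ∈ e.source ∩ e ⁻¹' B, ContMDiffAt 𝓘(ℝ, E) 𝓘(ℝ, ℝ) ω (u ∘ e) x := fun x hx =>
    ContMDiffAt.comp x (contMDiffAt_iff_contDiffAt.2 (hu _ hx.2).contDiffAt)
      (contMDiffAt_chart (𝕜 := ℝ) he hx.1)
  have hBo : IsOpen (B ×ˢ B) := hB.prod hB
  refine ⟨fun x hx => (hsm x hx).contMDiffWithinAt, fun x hx => ?_, fun p hp => ?_,
    fun w hw z hz => ?_, fun z hz w hw => ?_, fun z hz => hd _ hz.2⟩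
  · refine eq_of_inChart_eq he hx.1 ?_
    rw [← hκ _ hx.2, inChart_ddbar he (e.map_source hx.1)]
    · refine ddbarFlat_congr ?_
      filter_upwards [e.open_target.mem_nhds (e.map_source hx.1)] with z hz
      simp [e.right_inv hz]
    · rw [e.left_inv hx.1]
      exact (hsm x hx).of_le le_top
  · have h1 : ContMDiffAt (𝓘(ℝ, E).prod 𝓘(ℝ, E)) 𝓘(ℝ, E × E) ∞
        (fun p : M × M => (e p.1, e p.2)) p := by
      refine ContMDiffAt.prodMk_space ?_ ?_
      · exact ContMDiffAt.comp p ((contMDiffAt_chart (𝕜 := ℝ) he hp.1.1).of_le le_top)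
          contMDiffAt_fst
      · exact ContMDiffAt.comp p ((contMDiffAt_chart (𝕜 := ℝ) he hp.2.1).of_le le_top)
          contMDiffAt_snd
    exact (ContMDiffAt.comp p (contMDiffAt_iff_contDiffAt.2
      (hg.contDiffAt hBo (p := (e p.1, e p.2)) ⟨hp.1.2, hp.2.2⟩)) h1).contMDiffWithinAt
  · exact (MDifferentiableAt.comp z (mdifferentiableAt_iff_differentiableAt.2
      (hg.differentiableAt_left hBo (p := (e z, e w)) ⟨hz.2, hw.2⟩))
      ((contMDiffAt_chart (𝕜 := ℂ) he hz.1).mdifferentiableAt (by simp))).mdifferentiableWithinAt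
  · exact (MDifferentiableAt.comp w (mdifferentiableAt_iff_differentiableAt.2
      (hg.differentiableAt_right hBo (p := (e z, e w)) ⟨hz.2, hw.2⟩))
      ((contMDiffAt_chart (𝕜 := ℂ) he hw.1).mdifferentiableAt (by simp))).mdifferentiableWithinAt

/-- A real-analytic Kähler form has polarized potentials near every point. -/
lemma IsAnalyticKahlerForm.exists_isPolarizedPotential [FiniteDimensional ℂ E]
    (hκ : IsAnalyticKahlerForm κ) (x : M) :
    ∃ (U : Set M) (u : M → ℝ) (uC : M → M → ℂ), IsOpen U ∧ x ∈ U ∧ IsPolarizedPotential κ U u uC := by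
  set e := chartAt E x with he
  have hem : e ∈ atlas E M := chart_mem_atlas E x
  have hx : x ∈ e.source := mem_chart_source E x
  have hnh := e.open_target.mem_nhds (e.map_source hx)
  obtain ⟨r, hr, g, u, hg, hd, hu, hdd⟩ := exists_flat_potential (hκ.analytic e hem _ (e.map_source hx))
    (by filter_upwards [hnh] with y hy using inChart_type_one_one hκ.type_one_one hem hy)
    (by filter_upwards [hnh] with y hy using hκ.closed e hem y hy)
  exact ⟨_, _, _, e.isOpen_inter_preimage Metric.isOpen_ball, ⟨hx, Metric.mem_ball_self hr⟩,
    isPolarizedPotential_of_flat hem Metric.isOpen_ball hg hd hu hdd⟩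

/-- Two polarized potentials define the same diastasis function near the diagonal. -/
lemma IsPolarizedPotential.eventually_diastasis_eq {u' : M → ℝ} {uC' : M → M → ℂ}
    (h : IsPolarizedPotential κ U u uC) (h' : IsPolarizedPotential κ U' u' uC') (hU : IsOpen U)
    (hU' : IsOpen U') {x : M} (hx : x ∈ U) (hx' : x ∈ U') :
    ∀ᶠ p in 𝓝 (x, x), u p.1 + u p.2 - 2 * (uC p.1 p.2).re =
      u' p.1 + u' p.2 - 2 * (uC' p.1 p.2).re := by
  set e := chartAt E x with he
  have hem : e ∈ atlas E M := chart_mem_atlas E x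
  have hxs : x ∈ e.source := mem_chart_source E x
  have hUU : IsOpen (U ∩ U') := hU.inter hU'
  replace h := h.mono (U' := U ∩ U') inter_subset_left
  replace h' := h'.mono (U' := U ∩ U') inter_subset_right
  set Ω := chartDomain e (U ∩ U') with hΩ
  have hΩo : IsOpen Ω := isOpen_chartDomain e hUU
  have hΩx : e x ∈ Ω := mem_chartDomain hxs ⟨hx, hx'⟩
  have hs := (h.isSesqui hUU hem hem).sub (h'.isSesqui hUU hem hem) (hΩo.prod hΩo)
  -- The diastasis is additive in the potential, and the difference of two potentials of the same
  -- form is pluriharmonic.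
  have k := IsSesqui.eventually_diastasis_eq_zero (x := e x) (u := fun z => (u ∘ e.symm) z - (u' ∘ e.symm) z)
    hs (hΩo.prod hΩo) ⟨hΩx, hΩx⟩ ?_ ?_
  · have hc : ContinuousAt (fun p : M × M => (e p.1, e p.2)) (x, x) :=
      ((e.continuousAt hxs).comp_of_eq continuousAt_fst rfl).prodMk
        ((e.continuousAt hxs).comp_of_eq continuousAt_snd rfl)
    filter_upwards [hc.eventually k, (e.open_source.prod e.open_source).mem_nhds ⟨hxs, hxs⟩]
      with p hp hps
    simp only [Function.comp, e.left_inv hps.1, e.left_inv hps.2, Complex.sub_re] at hp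
    linarith
  · filter_upwards [hΩo.mem_nhds hΩx] with z hz
    simp [h.diag _ hz.2, h'.diag _ hz.2]
  · filter_upwards [hΩo.mem_nhds hΩx] with z hz
    have c := (h.contMDiffAt hUU hz.2).of_le two_le_smooth
    have c' := (h'.contMDiffAt hUU hz.2).of_le two_le_smooth
    rw [ddbarFlat_sub (contDiffAt_comp_symm hem hz.1 c) (contDiffAt_comp_symm hem hz.1 c'),
      ← inChart_ddbar hem hz.1 c, ← inChart_ddbar hem hz.1 c', sub_eq_zero]
    unfold inChart
    rw [h.potential _ hz.2, h'.potential _ hz.2]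

end Manifold

/-! ### Existence of admissible neighbourhoods -/

section Manifold

variable {E : Type*} [NormedAddCommGroup E] [NormedSpace ℂ E]
  {M : Type*} [TopologicalSpace M] [ChartedSpace E M]
  {κ : TwoForm E M} {D : M → M → ℝ} {x : M} {r c : ℝ}

lemma isConnected_chartBall (hr : 0 < r)
    (h : Metric.ball (chartAt E x x) r ⊆ (chartAt E x).target) : IsConnected (chartBall E x r) := by
  refine ⟨⟨x, mem_chartBall_self hr⟩, ?_⟩
  have e : chartBall E x r = (chartAt E x).symm '' Metric.ball (chartAt E x x) r := by
    ext p
    constructor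
    · exact fun hp => ⟨chartAt E x p, hp.2, (chartAt E x).left_inv hp.1⟩
    · rintro ⟨y, hy, rfl⟩
      exact ⟨(chartAt E x).map_target (h hy), by
        rwa [mem_preimage, (chartAt E x).right_inv (h hy)]⟩
  rw [e]
  exact (convex_ball _ _).isPreconnected.image _ ((chartAt E x).continuousOn_symm.mono h)

lemma exists_isConnected_subset (E : Type*) [NormedAddCommGroup E] [NormedSpace ℂ E]
    {M : Type*} [TopologicalSpace M] [ChartedSpace E M] {x : M} {A : Set M} (hA : A ∈ 𝓝 x) :
    ∃ W ⊆ A, IsOpen W ∧ IsConnected W ∧ x ∈ W := by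
  set e := chartAt E x with he
  have hx : x ∈ e.source := mem_chart_source E x
  have h1 : e.symm ⁻¹' A ∈ 𝓝 (e x) :=
    (e.continuousAt_symm (e.map_source hx)).preimage_mem_nhds (by rwa [e.left_inv hx])
  obtain ⟨r, hr, hb⟩ := Metric.mem_nhds_iff.1
    (inter_mem (e.open_target.mem_nhds (e.map_source hx)) h1)
  refine ⟨chartBall E x r, fun p hp => ?_, isOpen_chartBall x r,
    isConnected_chartBall hr fun y hy => (hb hy).1, mem_chartBall_self hr⟩
  have h2 := (hb hp.2).2
  rwa [mem_preimage, ← he, e.left_inv hp.1] at h2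

/-- In its first variable `D` is strictly convex on the ball, with critical value `0` at the second
point. -/
lemma IsConvexBall.pos_of_ne (h : IsConvexBall E D x r c) {p q : M} (hp : p ∈ chartBall E x r)
    (hq : q ∈ chartBall E x r) (hpq : p ≠ q) : 0 < D p q := by
  have hne : chartAt E x q ≠ chartAt E x p := fun h' =>
    hpq ((chartAt E x).injOn hp.1 hq.1 h'.symm)
  have h1 := pos_of_convex (convex_ball _ _) (fun p hp => (h.smooth p hp).of_le two_le_smooth)
    (fun p hp v hv => lt_of_lt_of_le (mul_pos h.pos (by positivity)) (h.convex p hp v)) hq.2 hp.2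
    (h.diag _ hq.2) (h.crit _ hq.2) hne
  simpa [inChartAt₂, (chartAt E x).left_inv hp.1, (chartAt E x).left_inv hq.1] using h1

lemma IsConvexBall.continuousOn (h : IsConvexBall E D x r c) :
    ContinuousOn (fun p : M × M => D p.1 p.2) (chartBall E x r ×ˢ chartBall E x r) := by
  set e := chartAt E x with he
  have h1 : ContinuousOn (inChartAt₂ (E := E) D x) (Metric.ball (e x) r ×ˢ Metric.ball (e x) r) :=
    fun p hp => (h.smooth p hp).continuousAt.continuousWithinAt
  have h2 : ContinuousOn (fun p : M × M => (e p.1, e p.2)) (chartBall E x r ×ˢ chartBall E x r) :=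
    ((e.continuousOn.mono inter_subset_left).comp continuousOn_fst fun p hp => hp.1).prodMk
      ((e.continuousOn.mono inter_subset_left).comp continuousOn_snd fun p hp => hp.2)
  refine (h1.comp h2 fun p hp => ⟨hp.1.2, hp.2.2⟩).congr fun p hp => ?_
  simp [inChartAt₂, ← he, e.left_inv hp.1.1, e.left_inv hp.2.1]

/-- On a compact part of a convex ball, `D` is bounded below away from the diagonal. -/
lemma IsConvexBall.exists_pos_le (h : IsConvexBall E D x r c) {K : Set M} (hK : IsCompact K)
    (hKr : K ⊆ chartBall E x r) {N : Set (M × M)} (hN : IsOpen N) (hdiag : ∀ p : M, (p, p) ∈ N) :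
    ∃ δ : ℝ, 0 < δ ∧ ∀ p ∈ K, ∀ q ∈ K, (p, q) ∉ N → δ ≤ D p q := by
  have hc : IsCompact ((K ×ˢ K) \ N) := (hK.prod hK).diff hN
  obtain hempty | hne := ((K ×ˢ K) \ N).eq_empty_or_nonempty
  · exact ⟨1, one_pos, fun p hp q hq hpq => absurd (show (p, q) ∈ (K ×ˢ K) \ N from ⟨⟨hp, hq⟩, hpq⟩)
      (hempty ▸ notMem_empty _)⟩
  · obtain ⟨m, hm, hmin⟩ := hc.exists_isMinOn hne
      (h.continuousOn.mono fun p hp => ⟨hKr hp.1.1, hKr hp.1.2⟩)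
    refine ⟨D m.1 m.2, h.pos_of_ne (hKr hm.1.1) (hKr hm.1.2) fun he => hm.2 ?_,
      fun p hp q hq hpq => hmin (show (p, q) ∈ (K ×ˢ K) \ N from ⟨⟨hp, hq⟩, hpq⟩)⟩
    have h1 := hdiag m.1
    rwa [show (m.1, m.1) = m from Prod.ext rfl he] at h1

/-- Calabi's diastasis function is defined in a neighbourhood of the diagonal. -/
theorem exists_isCalabiNhd [FiniteDimensional ℂ E] [IsManifold 𝓘(ℂ, E) ω M] [T2Space M]
    [CompactSpace M] (hκ : IsAnalyticKahlerForm κ) : ∃ V : Set (M × M), IsCalabiNhd κ V := by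
  choose U u uC hU hxU hP using fun x : M => hκ.exists_isPolarizedPotential x
  set D : M → M → M → ℝ := fun x z w => u x z + u x w - 2 * (uC x z w).re with hD
  choose r hr c hcb hball using fun x : M =>
    (hP x).exists_isConvexBall (hU x) hκ.pos (D := D x) (fun _ _ _ _ => rfl) (hxU x)
  have h2 : ∀ x, r x / 2 < r x := fun x => half_lt_self (hr x)
  set B : M → Set M := fun x => chartBall E x (r x / 2) with hB
  set K : M → Set M := fun x => closedChartBall E x (r x / 2) with hK
  have hBK : ∀ x, B x ⊆ K x := fun x => chartBall_subset_closedChartBall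
  have hKr : ∀ x, K x ⊆ chartBall E x (r x) := fun x => closedChartBall_subset (h2 x) (hcb x).subset
  have hKc : ∀ x, IsCompact (K x) := fun x => isCompact_closedChartBall (h2 x) (hcb x).subset
  have hrU : ∀ x, chartBall E x (r x) ⊆ U x := fun x p hp => by
    have h1 := (hball x hp.2).2
    rwa [mem_preimage, (chartAt E x).left_inv hp.1] at h1
  obtain ⟨t, -, ht⟩ := isCompact_univ.elim_nhds_subcover B
    fun x _ => (isOpen_chartBall x _).mem_nhds (mem_chartBall_self (half_pos (hr x)))
  have hcov : ∀ y : M, ∃ x ∈ t, y ∈ B x := fun y => by simpa using ht (mem_univ y)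
  choose i hit hiB using hcov
  -- The glued function uses at `(p, q)` the local diastasis with index `i p`, which may jump with
  -- `p`. On a small `W` around `y` this is harmless: only finitely many indices occur, closedness
  -- of the sets `K x` forces `y ∈ K (i p)`, and near `(y, y)` the corresponding local functions
  -- agree with that of index `i y`.
  have hW : ∀ y : M, ∃ W : Set M, IsOpen W ∧ IsConnected W ∧ y ∈ W ∧ W ⊆ B (i y) ∧
      ∀ p ∈ W, ∀ q ∈ W, D (i p) p q = D (i y) p q := by
    intro y
    have h1 : ∀ᶠ p in 𝓝 y, ∀ x ∈ t, p ∈ K x → y ∈ K x := by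
      refine (Finset.eventually_all t).2 fun x _ => ?_
      by_cases hy : y ∈ K x
      · exact .of_forall fun _ _ => hy
      · filter_upwards [(hKc x).isClosed.isOpen_compl.mem_nhds hy] with p hp hp'
        exact absurd hp' hp
    have h3 : ∀ᶠ p in 𝓝 (y, y), ∀ x ∈ t, y ∈ K x → D x p.1 p.2 = D (i y) p.1 p.2 := by
      refine (Finset.eventually_all t).2 fun x _ => ?_
      by_cases hy : y ∈ K x
      · filter_upwards [(hP x).eventually_diastasis_eq (hP (i y)) (hU x) (hU (i y))
          (hrU x (hKr x hy)) (hrU _ (hKr _ (hBK _ (hiB y))))] with p hp _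
        exact hp
      · exact .of_forall fun _ h => absurd h hy
    rw [nhds_prod_eq] at h3
    obtain ⟨A, hA, hA3⟩ := mem_prod_same_iff.1 h3
    obtain ⟨W, hWA, hWo, hWc, hyW⟩ := exists_isConnected_subset E
      (inter_mem (inter_mem hA h1) ((isOpen_chartBall (i y) _).mem_nhds (hiB y)))
    exact ⟨W, hWo, hWc, hyW, fun p hp => (hWA hp).2, fun p hp q hq =>
      hA3 (mk_mem_prod (hWA hp).1.1 (hWA hq).1.1) (i p) (hit p) ((hWA hp).1.2 _ (hit p) (hBK _ (hiB p)))⟩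
  choose W hWo hWc hyW hWB hWD using hW
  refine ⟨⋃ y, W y ×ˢ W y, fun p q => D (i p) p q, isOpen_iUnion fun y => (hWo y).prod (hWo y),
    fun p => mem_iUnion.2 ⟨p, hyW p, hyW p⟩, fun p q hpq => ?_, fun N hN hdiag => ?_⟩
  · obtain ⟨y, hp, hq⟩ := mem_iUnion.1 hpq
    exact ⟨W y, hWo y, hWc y, hp, hq, subset_iUnion (fun y => W y ×ˢ W y) y, u (i y), uC (i y),
      (hP (i y)).mono fun z hz => hrU _ (hKr _ (hBK _ (hWB y hz))), hWD y⟩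
  · choose δ hδ hδD using fun x => (hcb x).exists_pos_le (hKc x) (hKr x) hN hdiag
    obtain ⟨m, hm, hmle⟩ : ∃ m : ℝ, 0 < m ∧ ∀ x ∈ t, m ≤ δ x := by
      obtain rfl | hne := t.eq_empty_or_nonempty
      · exact ⟨1, one_pos, by simp⟩
      · exact ⟨t.inf' hne δ, (Finset.lt_inf'_iff hne).2 fun x _ => hδ x,
          fun x hx => Finset.inf'_le δ hx⟩
    refine ⟨m, hm, fun p q hpq hpN => ?_⟩
    obtain ⟨y, hp, hq⟩ := mem_iUnion.1 hpq
    rw [hWD y p hp q hq]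
    exact (hmle _ (hit y)).trans (hδD _ p (hBK _ (hWB y hp)) q (hBK _ (hWB y hq)) hpN)

end Manifold

end CxLegendre

end

open CxLegendre in
theorem theorem6p1
    {E : Type*} [NormedAddCommGroup E] [NormedSpace ℂ E] [FiniteDimensional ℂ E]
    [MeasurableSpace E] [BorelSpace E]
    {M : Type*} [TopologicalSpace M] [T2Space M] [CompactSpace M]
    [MeasurableSpace M] [BorelSpace M]
    [ChartedSpace E M] [IsManifold 𝓘(ℂ, E) ω M]
    (κ : TwoForm E M) (hκ : IsAnalyticKahlerForm κ) :
    (∃ V : Set (M × M), IsCalabiNhd κ V) ∧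
    ∀ V : Set (M × M), IsCalabiNhd κ V → ∀ 𝒜 : FiniteAtlas E M,
      ∃ ε : ℝ, 0 < ε ∧ ∀ ψ : M → ℝ, ContMDiff 𝓘(ℝ, E) 𝓘(ℝ, ℝ) ∞ ψ →
        c2Norm 𝒜 ψ < ENNReal.ofReal ε → IsPositive (perturb κ ψ) →
        -- the supremum is attained at exactly one point, and `G (ψ)` is a diffeomorphism
        (∀ q : M, ∃! z : M, IsAttainedAt κ V ψ q z) ∧
        (∃ Φ : M ≃ₘ^∞⟮𝓘(ℝ, E), 𝓘(ℝ, E)⟯ M, ∀ q : M, Φ q = gradientMap κ V ψ q) ∧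
        -- `φ` is the transform `L_κ ψ`, which is real-valued and smooth
        ∃ φ : M → ℝ, (∀ q : M, legendre κ V (fun p => (ψ p : EReal)) q = (φ q : EReal)) ∧
          ContMDiff 𝓘(ℝ, E) 𝓘(ℝ, ℝ) ∞ φ ∧
          pullback (gradientMap κ V ψ) (perturb κ ψ) = perturb κ φ ∧
          (∀ (q : M) (v : Fin (Module.finrank ℂ E) × Fin 2 → TangentSpace 𝓘(ℝ, E) q),
            wedgePow (E := E) (perturb κ ψ (gradientMap κ V ψ q)) (Module.finrank ℂ E)
                (fun i => mfderiv 𝓘(ℝ, E) 𝓘(ℝ, E) (gradientMap κ V ψ) q (v i)) =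
              wedgePow (E := E) (perturb κ φ q) (Module.finrank ℂ E) v) ∧
          (topMeasure (perturb κ ψ)).comap (gradientMap κ V ψ) = topMeasure (perturb κ φ) := by
  refine ⟨exists_isCalabiNhd hκ, fun V hV 𝒜 => ?_⟩
  obtain ⟨ε, hε, h⟩ := hV.isCalabiDiastasis.exists_isAdmissible hκ.pos 𝒜
  exact ⟨ε, hε, fun ψ hψ hψε _ => (h ψ hψ hψε).legendre_transform hV hψ⟩
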